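/- Let $\mathscr H$ be a complex Hilbert space, $A$ a (densely defined, possibly unbounded) selfadjoint operator on $\mathscr H$, and $H\in\mathcal B(\mathscr H)$ a bounded, not necessarily selfadjoint, operator. Write $\operatorname{Re}H=\frac12(H+H^*)$, $\operatorname{Im}H=\frac1{2i}(H-H^*)$, $\sigma_+=\max\sigma(\operatorname{Im}H)$, $\sigma_-=\min\sigma(\operatorname{Im}H)$, $\langle A\rangle=(1+A^2)^{1/2}$, and for a Borel set $\Delta\subset\mathbb R$ let $E_{\operatorname{Re}H}(\Delta)$ be the spectral projection of $\operatorname{Re}H$ on $\Delta$ and $E^{\perp}_{\operatorname{Re}H}(\Delta)=1-E_{\operatorname{Re}H}(\Delta)$. A bounded operator $B$ is in $C^1(A)$ if $\theta\mapsto e^{i\theta A}Be^{-i\theta A}$ is strongly continuously differentiable on $\mathbb R$; then $\mathrm{ad}_A(B)=[A,B]$ denotes the unique bounded operator associated with the form $(\varphi,\psi)\mapsto\langle A\varphi,B\psi\rangle-\langle\varphi,BA\psi\rangle$ on $\mathcal D(A)\times\mathcal D(A)$. It is in $\mathcal C^{1,1}(A)$ if $$\int_0^1\big\|e^{i\theta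 A}Be^{-i\theta A}+e^{-i\theta A}Be^{i\theta A}-2B\big\|\,\frac{d\theta}{\theta^2}<\infty .$$ Consider the following conditions on $\Delta$. (M$+$) $\operatorname{Re}H\in C^1(A)$ and there exist $a_+>0$, $b_+>0$, $\beta_+\ge 0$ such that $$i\,\mathrm{ad}_A(\operatorname{Re}H)+\beta_+(\sigma_+-\operatorname{Im}H)\ \ge\ a_+E_{\operatorname{Re}H}(\Delta)-b_+E^{\perp}_{\operatorname{Re}H}(\Delta).$$ (M$-$) $\operatorname{Re}H\in C^1(A)$ and there exist $a_->0$, $b_->0$, $\beta_-\ge 0$ such that $$i\,\mathrm{ad}_A(\operatorname{Re}H)+\beta_-(\operatorname{Im}H-\sigma_-)\ \ge\ a_-E_{\operatorname{Re}H}(\Delta)-b_-E^{\perp}_{\operatorname{Re}H}(\Delta).$$ **Theorem.** Let $H\in\mathcal C^{1,1}(A)$, let $\Delta\subset\mathbb R$ be an open interval and let $s>1/2$. (1) If (M$+$) holds on $\Delta$, then for every relatively compact interval $\Delta_0$ with $\overline{\Delta_0}\subset\Delta$, the operator $z-H$ is boundedly invertible for all $z\in\Delta_0+i(\sigma_+,\infty)$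 and $$\sup_{z\in\Delta_0+i(\sigma_+,\infty)}\big\|\langle A\rangle^{-s}(z-H)^{-1}\langle A\rangle^{-s}\big\|<\infty .$$ (2) If (M$-$) holds on $\Delta$, then for every relatively compact interval $\Delta_0$ with $\overline{\Delta_0}\subset\Delta$, the operator $z-H$ is boundedly invertible for all $z\in\Delta_0+i(-\infty,\sigma_-)$ and $$\sup_{z\in\Delta_0+i(-\infty,\sigma_-)}\big\|\langle A\rangle^{-s}(z-H)^{-1}\langle A\rangle^{-s}\big\|<\infty .$$ -/

import Mathlib

noncomputable section

open MeasureTheory Set Filter Topology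
open scoped ComplexStarModule CompactlySupported

namespace NSAMourre

variable {E : Type*} [NormedAddCommGroup E] [InnerProductSpace ℂ E] [CompleteSpace E]

/-! ### Borel functional calculus of a bounded normal operator -/

/-- The positive functional `f ↦ ⟨x, f(N) x⟩` on `C_c(ℂ, ℝ)`, for a bounded normal operator `N`. -/
def spectralFunctional (N : E →L[ℂ] E) (x : E) : C_c(ℂ, ℝ) →ₚ[ℝ] ℝ :=
  PositiveLinearMap.mk₀
    { toFun := fun f => (inner ℂ x (cfc (fun w : ℂ => (f w : ℂ)) N x)).re
      map_add' := by
        intro f g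
        have h : cfc (fun w : ℂ => ((f + g) w : ℂ)) N
            = cfc (fun w : ℂ => (f w : ℂ)) N + cfc (fun w : ℂ => (g w : ℂ)) N := by
          rw [← cfc_add (a := N) (fun w : ℂ => (f w : ℂ)) (fun w : ℂ => (g w : ℂ))
            (by fun_prop) (by fun_prop)]
          simp
        rw [h]
        simp
      map_smul' := by
        intro c f
        have h : cfc (fun w : ℂ => ((c • f) w : ℂ)) N
            = (c : ℂ) • cfc (fun w : ℂ => (f w : ℂ)) N := by
          rw [← cfc_const_mul (c : ℂ) (fun w : ℂ => (f w : ℂ)) N (by fun_prop)]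
          simp
        rw [h]
        simp }
    (by
      intro f hf
      have h : 0 ≤ cfc (fun w : ℂ => (f w : ℂ)) N := by
        open scoped ComplexOrder in apply cfc_nonneg
        intro w _
        exact_mod_cast hf w
      have h2 := (ContinuousLinearMap.nonneg_iff_isPositive _).1 h
      exact h2.re_inner_nonneg_right x)

/-- The spectral measure `μ_x(·) = ⟨x, E_N(·) x⟩` of a bounded normal operator `N`. -/
def spectralMeasure (N : E →L[ℂ] E) (x : E) : Measure ℂ :=
  RealRMK.rieszMeasure (spectralFunctional N x)

theorem spectralFunctional_le (N : E →L[ℂ] E) (x : E) (f : C_c(ℂ, ℝ))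
    (hf : ∀ w, f w ∈ Icc (0 : ℝ) 1) : spectralFunctional N x f ≤ ‖x‖ ^ 2 := by
  have hn : ‖cfc (fun w : ℂ => (f w : ℂ)) N‖ ≤ 1 := by
    apply norm_cfc_le zero_le_one
    intro w _
    rw [Complex.norm_real, Real.norm_eq_abs, abs_le]
    exact ⟨by linarith [(hf w).1], (hf w).2⟩
  calc (inner ℂ x (cfc (fun w : ℂ => (f w : ℂ)) N x)).re
      ≤ ‖inner ℂ x (cfc (fun w : ℂ => (f w : ℂ)) N x)‖ := Complex.re_le_norm _
    _ ≤ ‖x‖ * ‖cfc (fun w : ℂ => (f w : ℂ)) N x‖ := norm_inner_le_norm _ _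
    _ ≤ ‖x‖ * (1 * ‖x‖) := by
        gcongr
        exact ContinuousLinearMap.le_of_opNorm_le _ hn x
    _ = ‖x‖ ^ 2 := by ring

instance (N : E →L[ℂ] E) (x : E) : IsFiniteMeasure (spectralMeasure N x) := by
  refine ⟨lt_of_le_of_lt (b := ENNReal.ofReal (‖x‖ ^ 2)) ?_ ENNReal.ofReal_lt_top⟩
  have hreg : (spectralMeasure N x).Regular := RealRMK.regular_rieszMeasure _
  rw [isOpen_univ.measure_eq_iSup_isCompact]
  refine iSup_le fun K => iSup_le fun _ => iSup_le fun hK => ?_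
  obtain ⟨f, hf1, -, hfc, hf⟩ := exists_continuous_one_zero_of_isCompact hK
    (isClosed_empty (X := ℂ)) (disjoint_empty K)
  let g : C_c(ℂ, ℝ) := ⟨f, hfc⟩
  refine (RealRMK.rieszMeasure_le_of_eq_one _ (f := g) (fun w => (hf w).1) hK
    (fun w hw => hf1 hw)).trans ?_
  exact ENNReal.ofReal_le_ofReal (spectralFunctional_le N x g hf)

/-- `T` is the operator `f(N) = ∫ f dE_N`: its quadratic form is `x ↦ ∫ f dμ_x`. -/
def IsBorelCalc (N : E →L[ℂ] E) (f : ℂ → ℂ) (T : E →L[ℂ] E) : Prop :=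
  ∀ x : E, inner ℂ x (T x) = ∫ w, f w ∂(spectralMeasure N x)

open Classical in
/-- The Borel functional calculus `f(N)` of a bounded normal operator `N`, for `f` bounded and
Borel; existence is `isBorelCalc_borelCalc`, uniqueness is `IsBorelCalc.unique`. -/
def borelCalc (N : E →L[ℂ] E) (f : ℂ → ℂ) : E →L[ℂ] E :=
  if h : ∃ T, IsBorelCalc N f T then h.choose else 0

theorem IsBorelCalc.unique {N : E →L[ℂ] E} {f : ℂ → ℂ} {S T : E →L[ℂ] E}
    (hS : IsBorelCalc N f S) (hT : IsBorelCalc N f T) : S = T := by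
  have h := (ext_inner_map (S : E →ₗ[ℂ] E) (T : E →ₗ[ℂ] E)).1 (fun x => by
    have := (hS x).trans (hT x).symm
    have h := congrArg (starRingEnd ℂ) this
    rwa [inner_conj_symm, inner_conj_symm] at h)
  exact ContinuousLinearMap.coe_injective h

theorem isBorelCalc_compactlySupported (N : E →L[ℂ] E) (f : C_c(ℂ, ℝ)) :
    IsBorelCalc N (fun w => (f w : ℂ)) (cfc (fun w : ℂ => (f w : ℂ)) N) := by
  intro x
  have hsa : IsSelfAdjoint (cfc (fun w : ℂ => (f w : ℂ)) N) := by
    rw [IsSelfAdjoint, ← cfc_star]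
    simp
  have h1 : ∫ w, (f w : ℂ) ∂(spectralMeasure N x) = ((spectralFunctional N x f : ℝ) : ℂ) := by
    rw [integral_complex_ofReal, spectralMeasure, RealRMK.integral_rieszMeasure]
  rw [h1]
  exact (hsa.isSymmetric.coe_re_inner_self_apply x).symm

theorem IsBorelCalc.add {N : E →L[ℂ] E} {f g : ℂ → ℂ} {S T : E →L[ℂ] E}
    (hS : IsBorelCalc N f S) (hT : IsBorelCalc N g T)
    (hf : ∀ x, Integrable f (spectralMeasure N x)) (hg : ∀ x, Integrable g (spectralMeasure N x)) :
    IsBorelCalc N (fun w => f w + g w) (S + T) := by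
  intro x
  rw [integral_add (hf x) (hg x), add_apply, inner_add_right, hS x, hT x]

theorem IsBorelCalc.const_mul {N : E →L[ℂ] E} {f : ℂ → ℂ} {S : E →L[ℂ] E}
    (hS : IsBorelCalc N f S) (c : ℂ) : IsBorelCalc N (fun w => c * f w) (c • S) := by
  intro x
  rw [integral_const_mul, smul_apply, inner_smul_right, hS x]

/-- A sequence of operators whose quadratic forms converge has a weak limit. -/
theorem exists_weak_limit (T : ℕ → E →L[ℂ] E) (q : E → ℂ)
    (h : ∀ x, Tendsto (fun n => inner ℂ x (T n x)) atTop (𝓝 (q x))) :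
    ∃ S : E →L[ℂ] E, ∀ x, inner ℂ x (S x) = q x := by
  have hconv : ∀ x y, ∃ l, Tendsto (fun n => inner ℂ (T n x) y) atTop (𝓝 l) := by
    intro x y
    have h' : ∀ z, Tendsto (fun n => inner ℂ (T n z) z) atTop (𝓝 ((starRingEnd ℂ) (q z))) := by
      intro z
      have := (Complex.continuous_conj.tendsto _).comp (h z)
      refine this.congr fun n => ?_
      exact inner_conj_symm _ _
    refine ⟨_, Tendsto.congr (fun n => (inner_map_polarization' (T n : E →ₗ[ℂ] E) x y).symm)
      (((((h' (x + y)).sub (h' (x - y))).sub ((h' (x + Complex.I • y)).const_mul Complex.I)).add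
        ((h' (x - Complex.I • y)).const_mul Complex.I)).div_const 4)⟩
  choose B hB using hconv
  have hbdd : ∃ C, ∀ n, ‖T n‖ ≤ C := by
    apply banach_steinhaus
    intro x
    have : ∃ C, ∀ n, ‖innerSL ℂ (T n x)‖ ≤ C := by
      apply banach_steinhaus
      intro y
      obtain ⟨C, hC⟩ := (hB x y).norm.bddAbove_range
      exact ⟨C, fun n => hC ⟨n, rfl⟩⟩
    obtain ⟨C, hC⟩ := this
    exact ⟨C, fun n => by simpa using hC n⟩
  obtain ⟨C, hC⟩ := hbdd
  let L : E →ₗ⋆[ℂ] E →ₗ[ℂ] ℂ := LinearMap.mk₂'ₛₗ (starRingEnd ℂ) (RingHom.id ℂ) B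
    (fun x x' y => tendsto_nhds_unique (hB _ _) (by
      simpa [inner_add_left] using (hB x y).add (hB x' y)))
    (fun c x y => tendsto_nhds_unique (hB _ _) (by
      simpa [inner_smul_left, mul_comm] using (hB x y).const_mul (starRingEnd ℂ c)))
    (fun x y y' => tendsto_nhds_unique (hB _ _) (by
      simpa [inner_add_right] using (hB x y).add (hB x y')))
    (fun c x y => tendsto_nhds_unique (hB _ _) (by
      simpa [inner_smul_right] using (hB x y).const_mul c))
  let B' : E →L⋆[ℂ] E →L[ℂ] ℂ := L.mkContinuous₂ C (fun x y => by
    refine le_of_tendsto (hB x y).norm (Eventually.of_forall fun n => ?_)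
    refine (norm_inner_le_norm _ _).trans ?_
    gcongr
    exact ContinuousLinearMap.le_of_opNorm_le _ (hC n) x)
  refine ⟨InnerProductSpace.continuousLinearMapOfBilin B', fun x => ?_⟩
  have h1 : inner ℂ (InnerProductSpace.continuousLinearMapOfBilin B' x) x = B x x := by
    rw [InnerProductSpace.continuousLinearMapOfBilin_apply]
    rfl
  rw [← inner_conj_symm, h1]
  refine tendsto_nhds_unique ((Complex.continuous_conj.tendsto _).comp (hB x x)) ?_
  refine (h x).congr fun n => ?_
  exact (inner_conj_symm _ _).symm

theorem exists_isBorelCalc_of_tendsto (N : E →L[ℂ] E) (F : ℕ → ℂ → ℂ) (f : ℂ → ℂ) (C : ℝ)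
    (hm : ∀ n, Measurable (F n)) (hb : ∀ n w, ‖F n w‖ ≤ C)
    (hlim : ∀ w, Tendsto (fun n => F n w) atTop (𝓝 (f w)))
    (hT : ∀ n, ∃ T, IsBorelCalc N (F n) T) : ∃ T, IsBorelCalc N f T := by
  choose T hT using hT
  apply exists_weak_limit T
  intro x
  have := tendsto_integral_of_dominated_convergence (μ := spectralMeasure N x) (fun _ => C)
    (fun n => (hm n).aestronglyMeasurable) (integrable_const C)
    (fun n => Eventually.of_forall (hb n)) (Eventually.of_forall hlim)
  exact this.congr fun n => (hT n x).symm

theorem exists_isBorelCalc_isCompact (N : E →L[ℂ] E) {K : Set ℂ} (hK : IsCompact K) :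
    ∃ T, IsBorelCalc N (K.indicator fun _ => (1 : ℂ)) T := by
  obtain ⟨f, hfK, -, hfc, hf⟩ := exists_continuous_one_zero_of_isCompact_of_isGδ hK
    hK.isClosed.isGδ (isClosed_empty (X := ℂ)) (disjoint_empty K)
  let g : ℕ → C_c(ℂ, ℝ) := fun n => ⟨f ^ (n + 1), by
    have : (⇑(f ^ (n + 1)) : ℂ → ℝ) = fun w => f w * (f w) ^ n := by
      ext w; simp [pow_succ']
    change HasCompactSupport (⇑(f ^ (n + 1)))
    rw [this]
    exact hfc.mul_right⟩
  have hg : ∀ n w, g n w = f w ^ (n + 1) := fun n w => rfl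
  refine exists_isBorelCalc_of_tendsto N (fun n w => (g n w : ℂ)) _ 1
    (fun n => (Complex.continuous_ofReal.comp (g n).continuous).measurable) ?_ ?_
    (fun n => ⟨_, isBorelCalc_compactlySupported N (g n)⟩)
  · intro n w
    rw [hg, Complex.norm_real, Real.norm_eq_abs, abs_of_nonneg (pow_nonneg (hf w).1 _)]
    exact pow_le_one₀ (hf w).1 (hf w).2
  · intro w
    simp only [hg]
    by_cases hw : w ∈ K
    · have h1 : f w = 1 := by rw [hfK] at hw; exact hw
      simp [hw, h1]
    · have h1 : f w < 1 := lt_of_le_of_ne (hf w).2 (fun h => hw (by rw [hfK]; exact h))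
      rw [indicator_of_notMem hw]
      have := ((tendsto_pow_atTop_nhds_zero_of_lt_one (hf w).1 h1).comp (tendsto_add_atTop_nat 1))
      exact_mod_cast (Complex.continuous_ofReal.tendsto 0).comp this

theorem exists_isBorelCalc_isClosed (N : E →L[ℂ] E) {K : Set ℂ} (hK : IsClosed K) :
    ∃ T, IsBorelCalc N (K.indicator fun _ => (1 : ℂ)) T := by
  refine exists_isBorelCalc_of_tendsto N
    (fun n : ℕ => (K ∩ Metric.closedBall 0 n).indicator fun _ => (1 : ℂ)) _ 1
    (fun n => measurable_const.indicator (hK.inter Metric.isClosed_closedBall).measurableSet)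
    (fun n w => ?_) (fun w => ?_)
    (fun n => exists_isBorelCalc_isCompact N ((isCompact_closedBall _ _).inter_left hK))
  · by_cases hw : w ∈ K ∩ Metric.closedBall 0 n <;> simp [indicator, hw]
  · refine tendsto_const_nhds.congr' ?_
    filter_upwards [eventually_ge_atTop ⌈‖w‖⌉₊] with n hn
    have : w ∈ Metric.closedBall (0 : ℂ) n := by
      simpa using Nat.ceil_le.1 hn
    by_cases hw : w ∈ K <;> simp only [indicator, hw, mem_inter_iff, this, and_true]

theorem exists_isBorelCalc_measurableSet (N : E →L[ℂ] E) {s : Set ℂ} (hs : MeasurableSet s) :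
    ∃ T, IsBorelCalc N (s.indicator fun _ => (1 : ℂ)) T := by
  have hint : ∀ {t : Set ℂ}, MeasurableSet t → ∀ x,
      Integrable (t.indicator fun _ => (1 : ℂ)) (spectralMeasure N x) :=
    fun ht x => (integrable_const (1 : ℂ)).indicator ht
  have hgen : (inferInstance : MeasurableSpace ℂ)
      = MeasurableSpace.generateFrom {t : Set ℂ | IsClosed t} := by
    rw [← borel_eq_generateFrom_isClosed]
    exact BorelSpace.measurable_eq
  induction s, hs using MeasurableSpace.induction_on_inter hgen isPiSystem_isClosed with
  | empty => exact ⟨0, fun x => by simp⟩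
  | basic t ht => exact exists_isBorelCalc_isClosed N ht
  | compl t ht ih =>
    obtain ⟨T, hT⟩ := ih
    obtain ⟨S, hS⟩ := exists_isBorelCalc_isClosed N (isClosed_univ (X := ℂ))
    refine ⟨S + (-1 : ℂ) • T, ?_⟩
    have := hS.add (hT.const_mul (-1)) (hint MeasurableSet.univ)
      (fun x => (hint ht x).const_mul _)
    convert this using 2 with w
    by_cases hw : w ∈ t <;> simp [hw]
  | iUnion t hd hm ih =>
    have hfin : ∀ n : ℕ, ∃ T, IsBorelCalc N
        (fun w => ∑ i ∈ Finset.range n, (t i).indicator (fun _ => (1 : ℂ)) w) T := by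
      intro n
      induction n with
      | zero => exact ⟨0, fun x => by simp⟩
      | succ n ihn =>
        obtain ⟨S, hS⟩ := ihn
        obtain ⟨T, hT⟩ := ih n
        refine ⟨S + T, ?_⟩
        simp only [Finset.sum_range_succ]
        exact hS.add hT (fun x => integrable_finsetSum _ fun i _ => hint (hm i) x) (hint (hm n))
    have hEq : ∀ (n : ℕ) (w : ℂ), ∑ i ∈ Finset.range n, (t i).indicator (fun _ => (1 : ℂ)) w
        = (⋃ i ∈ Finset.range n, t i).indicator (fun _ => (1 : ℂ)) w := by
      intro n w
      rw [Finset.indicator_biUnion]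
      intro i _ j _ hij
      exact hd hij
    refine exists_isBorelCalc_of_tendsto N
      (fun n w => ∑ i ∈ Finset.range n, (t i).indicator (fun _ => (1 : ℂ)) w) _ 1
      (fun n => Finset.measurable_sum _ fun i _ => measurable_const.indicator (hm i))
      (fun n w => ?_) (fun w => ?_) hfin
    · rw [hEq]
      by_cases hw : w ∈ ⋃ i ∈ Finset.range n, t i <;> simp only [indicator, hw] <;> simp
    · simp only [hEq]
      by_cases hw : w ∈ ⋃ i, t i
      · obtain ⟨k, hk⟩ := mem_iUnion.1 hw
        refine tendsto_const_nhds.congr' ?_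
        filter_upwards [eventually_gt_atTop k] with n hn
        rw [indicator_of_mem hw, indicator_of_mem]
        exact mem_iUnion₂.2 ⟨k, Finset.mem_range.2 hn, hk⟩
      · refine tendsto_const_nhds.congr fun n => ?_
        rw [indicator_of_notMem hw, indicator_of_notMem]
        intro h
        obtain ⟨i, _, hi⟩ := mem_iUnion₂.1 h
        exact hw (mem_iUnion.2 ⟨i, hi⟩)

theorem exists_isBorelCalc_simpleFunc (N : E →L[ℂ] E) (f : SimpleFunc ℂ ℂ) :
    ∃ T, IsBorelCalc N f T := by
  induction f using SimpleFunc.induction with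
  | const c hs =>
    obtain ⟨T, hT⟩ := exists_isBorelCalc_measurableSet N hs
    refine ⟨c • T, ?_⟩
    convert hT.const_mul c using 2 with w
    simp [indicator]
  | @add f g _ hf hg =>
    obtain ⟨S, hS⟩ := hf
    obtain ⟨T, hT⟩ := hg
    exact ⟨S + T, hS.add hT (fun x => f.integrable_of_isFiniteMeasure)
      (fun x => g.integrable_of_isFiniteMeasure)⟩

/-- `f(N)` exists for every bounded Borel function `f`. -/
theorem isBorelCalc_borelCalc (N : E →L[ℂ] E) {f : ℂ → ℂ} (hf : Measurable f)
    {C : ℝ} (hC : ∀ w, ‖f w‖ ≤ C) : IsBorelCalc N f (borelCalc N f) := by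
  have h : ∃ T, IsBorelCalc N f T := by
    have hs := hf.stronglyMeasurable
    refine exists_isBorelCalc_of_tendsto N (fun n => hs.approxBounded C n) f C
      (fun n => (hs.approxBounded C n).measurable)
      (fun n w => hs.norm_approxBounded_le ((norm_nonneg _).trans (hC w)) n w)
      (fun w => hs.tendsto_approxBounded_of_norm_le (hC w))
      (fun n => exists_isBorelCalc_simpleFunc N _)
  rw [borelCalc, dif_pos h]
  exact h.choose_spec

/-! ### Borel functional calculus of an unbounded selfadjoint operator -/

/-- `U` is the Cayley transform `(A - i)(A + i)⁻¹`. -/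
def IsCayley (A : E →ₗ.[ℂ] E) (U : E →L[ℂ] E) : Prop :=
  ∀ u : A.domain, U (A u + Complex.I • (u : E)) = A u - Complex.I • (u : E)

theorem norm_sq_add_smul {A : E →ₗ.[ℂ] E} (hA : IsSelfAdjoint A) (c : ℝ) (u : A.domain) :
    ‖A u + (c * Complex.I) • (u : E)‖ ^ 2 = ‖A u‖ ^ 2 + c ^ 2 * ‖(u : E)‖ ^ 2 := by
  have hsym : inner ℂ (A u) (u : E) = inner ℂ (u : E) (A u) := by
    have := LinearPMap.adjoint_isFormalAdjoint hA.dense_domain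
    rw [LinearPMap.isSelfAdjoint_def.1 hA] at this
    exact this u u
  have him : (inner ℂ (A u) (u : E)).im = 0 := by
    have h := inner_conj_symm (𝕜 := ℂ) (A u) (u : E)
    rw [← hsym] at h
    exact Complex.conj_eq_iff_im.1 h
  rw [@norm_add_sq ℂ, inner_smul_right, norm_smul]
  have : RCLike.re ((c * Complex.I) * inner ℂ (A u) (u : E)) = 0 := by
    simp [him]
  rw [this]
  simp [mul_pow]

theorem exists_add_smul_eq {A : E →ₗ.[ℂ] E} (hA : IsSelfAdjoint A) {c : ℝ} (hc : c ≠ 0) (y : E) :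
    ∃ u : A.domain, A u + (c * Complex.I) • (u : E) = y := by
  let L : A.domain →ₗ[ℂ] E := A.toFun + (c * Complex.I) • A.domain.subtype
  have hL : ∀ u : A.domain, L u = A u + (c * Complex.I) • (u : E) := fun u => rfl
  have hclosed : IsClosed (LinearMap.range L : Set E) := by
    rw [← isSeqClosed_iff_isClosed]
    intro y z hy hz
    choose u hu using hy
    have hnorm : ∀ m n, ‖L (u m) - L (u n)‖ ^ 2
        = ‖A (u m - u n)‖ ^ 2 + c ^ 2 * ‖((u m - u n : A.domain) : E)‖ ^ 2 := by
      intro m n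
      rw [← map_sub, hL, norm_sq_add_smul hA]
    have hcy : CauchySeq y := hz.cauchySeq
    have hcu : CauchySeq fun n => (u n : E) := by
      rw [Metric.cauchySeq_iff] at hcy ⊢
      intro ε hε
      obtain ⟨K, hK⟩ := hcy (|c| * ε) (by positivity)
      refine ⟨K, fun m hm n hn => ?_⟩
      have h1 := hK m hm n hn
      have h2 := hnorm m n
      rw [hu, hu, ← dist_eq_norm] at h2
      rw [dist_eq_norm, ← Submodule.coe_sub]
      have h3 : (|c| * ‖((u m - u n : A.domain) : E)‖) ^ 2 ≤ dist (y m) (y n) ^ 2 := by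
        rw [mul_pow, sq_abs, h2]
        nlinarith [sq_nonneg ‖A (u m - u n)‖]
      have h4 := (abs_le_of_sq_le_sq' h3 dist_nonneg).2
      exact lt_of_mul_lt_mul_left (h4.trans_lt h1) (abs_nonneg c)
    obtain ⟨v, hv⟩ := cauchySeq_tendsto_of_complete hcu
    have hAu : Tendsto (fun n => A (u n)) atTop (𝓝 (z - (c * Complex.I) • v)) := by
      refine (hz.sub (hv.const_smul (c * Complex.I))).congr fun n => ?_
      rw [← hu, hL]
      simp
    have hg : (v, z - (c * Complex.I) • v) ∈ A.graph := by
      refine hA.isClosed.mem_of_tendsto (hv.prodMk_nhds hAu) (Eventually.of_forall fun n => ?_)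
      exact A.mem_graph (u n)
    obtain ⟨w, hw1, hw2⟩ := (LinearPMap.mem_graph_iff A).1 hg
    refine ⟨w, ?_⟩
    rw [hL, hw2]
    simp only at hw1
    rw [hw1]
    simp
  have horth : (LinearMap.range L)ᗮ = ⊥ := by
    rw [Submodule.eq_bot_iff]
    intro v hv
    have h1 : ∀ u : A.domain, inner ℂ v (A u) = - inner ℂ v ((c * Complex.I) • (u : E)) := by
      intro u
      have := Submodule.inner_left_of_mem_orthogonal (LinearMap.mem_range_self L u) hv
      rw [hL, inner_add_right] at this
      exact eq_neg_of_add_eq_zero_left this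
    have h2 : ∀ u : A.domain, inner ℂ ((c * Complex.I) • v) (u : E) = inner ℂ v (A u) := by
      intro u
      rw [h1, inner_smul_left, inner_smul_right]
      simp
    have hmem : v ∈ A.domain := by
      have := LinearPMap.mem_adjoint_domain_of_exists (T := A) v ⟨_, h2⟩
      rwa [LinearPMap.isSelfAdjoint_def.1 hA] at this
    have hAv : A ⟨v, hmem⟩ = (c * Complex.I) • v := by
      apply hA.dense_domain.eq_of_inner_left ℂ
      intro w hw
      have hf := LinearPMap.adjoint_isFormalAdjoint hA.dense_domain
      rw [LinearPMap.isSelfAdjoint_def.1 hA] at hf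
      rw [h2 ⟨w, hw⟩]
      exact hf ⟨v, hmem⟩ ⟨w, hw⟩
    have h3 := norm_sq_add_smul hA (-c) ⟨v, hmem⟩
    rw [hAv] at h3
    simp only [Complex.ofReal_neg, neg_mul, neg_smul, add_neg_cancel, norm_zero] at h3
    have h4 : 0 < c ^ 2 := by positivity
    have h5 : ‖v‖ ^ 2 = 0 := by
      nlinarith [sq_nonneg ‖(c * Complex.I) • v‖, sq_nonneg ‖v‖]
    simpa using h5
  have htop : LinearMap.range L = ⊤ := by
    have : CompleteSpace (LinearMap.range L) := hclosed.completeSpace_coe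
    exact (Submodule.orthogonal_eq_bot_iff).1 horth
  have : y ∈ LinearMap.range L := htop ▸ Submodule.mem_top
  exact this

theorem exists_isCayley {A : E →ₗ.[ℂ] E} (hA : IsSelfAdjoint A) :
    ∃ U ∈ unitary (E →L[ℂ] E), IsCayley A U := by
  have hs : ∀ y, ∃ u : A.domain, A u + Complex.I • (u : E) = y := by
    simpa using exists_add_smul_eq hA one_ne_zero
  have hs' : ∀ y, ∃ u : A.domain, A u - Complex.I • (u : E) = y := by
    simpa [sub_eq_add_neg] using exists_add_smul_eq hA (c := -1) (by norm_num)
  have hn : ∀ u : A.domain, ‖A u + Complex.I • (u : E)‖ ^ 2 = ‖A u‖ ^ 2 + ‖(u : E)‖ ^ 2 := by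
    simpa using norm_sq_add_smul hA 1
  have hn' : ∀ u : A.domain, ‖A u - Complex.I • (u : E)‖ ^ 2 = ‖A u‖ ^ 2 + ‖(u : E)‖ ^ 2 := by
    simpa [sub_eq_add_neg] using norm_sq_add_smul hA (-1)
  let P : A.domain →ₗ[ℂ] E := A.toFun + Complex.I • A.domain.subtype
  let M : A.domain →ₗ[ℂ] E := A.toFun - Complex.I • A.domain.subtype
  have hP : Function.Bijective P := by
    refine ⟨?_, hs⟩
    rw [injective_iff_map_eq_zero]
    intro u hu
    have h : A u + Complex.I • (u : E) = 0 := hu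
    have h1 := hn u
    rw [h, norm_zero] at h1
    have h2 : ‖(u : E)‖ ^ 2 = 0 := by
      nlinarith [sq_nonneg ‖A u‖, sq_nonneg ‖(u : E)‖]
    simpa using h2
  let e := LinearEquiv.ofBijective P hP
  let V : E →ₗ[ℂ] E := M ∘ₗ (e.symm : E →ₗ[ℂ] A.domain)
  have hV : ∀ u : A.domain, V (A u + Complex.I • (u : E)) = A u - Complex.I • (u : E) := by
    intro u
    have : e.symm (A u + Complex.I • (u : E)) = u := e.symm_apply_apply u
    change M (e.symm (A u + Complex.I • (u : E))) = _
    rw [this]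
    rfl
  have hVn : ∀ x, ‖V x‖ = ‖x‖ := by
    intro x
    obtain ⟨u, rfl⟩ := hs x
    rw [hV]
    have := (hn' u).trans (hn u).symm
    exact (sq_eq_sq₀ (norm_nonneg _) (norm_nonneg _)).1 this
  have hVs : Function.Surjective V := by
    intro y
    obtain ⟨u, rfl⟩ := hs' y
    exact ⟨_, hV u⟩
  let W : E ≃ₗᵢ[ℂ] E := LinearIsometryEquiv.ofSurjective ⟨V, hVn⟩ hVs
  refine ⟨(Unitary.linearIsometryEquiv.symm W : unitary (E →L[ℂ] E)), SetLike.coe_mem _, hV⟩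

open Classical in
/-- The Cayley transform `(A - i)(A + i)⁻¹` of a selfadjoint operator `A`. -/
def cayley (A : E →ₗ.[ℂ] E) : E →L[ℂ] E :=
  if h : ∃ U, IsCayley A U then h.choose else 0

theorem isCayley_cayley {A : E →ₗ.[ℂ] E} (hA : IsSelfAdjoint A) : IsCayley A (cayley A) := by
  obtain ⟨U, -, hU⟩ := exists_isCayley hA
  have h : ∃ U, IsCayley A U := ⟨U, hU⟩
  rw [cayley, dif_pos h]
  exact h.choose_spec

theorem cayley_mem_unitary {A : E →ₗ.[ℂ] E} (hA : IsSelfAdjoint A) :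
    cayley A ∈ unitary (E →L[ℂ] E) := by
  obtain ⟨U, hU, hAU⟩ := exists_isCayley hA
  have : cayley A = U := by
    ext y
    obtain ⟨u, rfl⟩ : ∃ u : A.domain, A u + Complex.I • (u : E) = y := by
      simpa using exists_add_smul_eq hA one_ne_zero y
    rw [isCayley_cayley hA u, hAU u]
  rwa [this]

/-- The inverse Cayley map `w ↦ i (1 + w) / (1 - w)`, which sends the unit circle without the
point `1` onto the real line (`1` is not an eigenvalue of a Cayley transform, so the value given
to it is irrelevant). -/
def cayleyCoord (w : ℂ) : ℝ := (Complex.I * (1 + w) / (1 - w)).re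

/-- The Borel functional calculus `f(A) = ∫ f dE_A` of a selfadjoint operator `A`, possibly
unbounded, for a bounded Borel function `f` on the real line. -/
def funcCalc (A : E →ₗ.[ℂ] E) (f : ℝ → ℂ) : E →L[ℂ] E :=
  borelCalc (cayley A) fun w => f (cayleyCoord w)

/-- The unitary group `e^{iθA}`. -/
def expI (A : E →ₗ.[ℂ] E) (θ : ℝ) : E →L[ℂ] E :=
  funcCalc A fun t => Complex.exp (Complex.I * θ * t)

/-- The weight `⟨A⟩^{-s}`, where `⟨t⟩ = (1 + t²)^{1/2}`. -/
def weight (A : E →ₗ.[ℂ] E) (s : ℝ) : E →L[ℂ] E :=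
  funcCalc A fun t => ((Real.sqrt (1 + t ^ 2) ^ (-s) : ℝ) : ℂ)

/-- The spectral projection `E_T(Δ)` of a bounded selfadjoint operator `T`. -/
def spectralProj (T : E →L[ℂ] E) (Δ : Set ℝ) : E →L[ℂ] E :=
  borelCalc T fun w => Δ.indicator (fun _ => (1 : ℂ)) w.re

/-! ### Regularity with respect to `A`, commutators, positive commutator estimates -/

/-- `W_A(θ) = e^{iθA} B e^{-iθA}`. -/
def conjugate (A : E →ₗ.[ℂ] E) (B : E →L[ℂ] E) (θ : ℝ) : E →L[ℂ] E :=
  expI A θ * B * expI A (-θ)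

/-- The class `C^k(A)`: `θ ↦ e^{iθA} B e^{-iθA}` is `k` times strongly continuously
differentiable. -/
def ClassC (A : E →ₗ.[ℂ] E) (k : ℕ) (B : E →L[ℂ] E) : Prop :=
  ∀ x : E, ContDiff ℝ k fun θ : ℝ => conjugate A B θ x

/-- The class `𝒞^{1,1}(A)`. -/
def ClassC11 (A : E →ₗ.[ℂ] E) (B : E →L[ℂ] E) : Prop :=
  ∫⁻ θ in Ioo (0 : ℝ) 1,
    ENNReal.ofReal (‖conjugate A B θ + conjugate A B (-θ) - (2 : ℂ) • B‖ / θ ^ 2) < ⊤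

/-- `D` is the bounded operator associated with the form
`(φ, ψ) ↦ ⟨A φ, B ψ⟩ - ⟨φ, B A ψ⟩` on `D(A) × D(A)`. -/
def IsCommutator (A : E →ₗ.[ℂ] E) (B D : E →L[ℂ] E) : Prop :=
  ∀ φ ψ : A.domain,
    inner ℂ (φ : E) (D ψ) = inner ℂ (A φ) (B ψ) - inner ℂ (φ : E) (B (A ψ))

open Classical in
/-- The commutator `ad_A(B) = [A, B]`, for `B` of class `C^1(A)`. -/
def ad (A : E →ₗ.[ℂ] E) (B : E →L[ℂ] E) : E →L[ℂ] E :=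
  if h : ∃ D, IsCommutator A B D then h.choose else 0

theorem IsCommutator.ad_eq {A : E →ₗ.[ℂ] E} (hA : IsSelfAdjoint A) {B D : E →L[ℂ] E}
    (hD : IsCommutator A B D) : ad A B = D := by
  have h : ∃ D, IsCommutator A B D := ⟨D, hD⟩
  rw [ad, dif_pos h]
  have hd := hA.dense_domain
  refine ContinuousLinearMap.ext_on (s := (A.domain : Set E)) (hd.mono
    Submodule.subset_span) fun ψ hψ => ?_
  refine hd.eq_of_inner_right ℂ fun φ hφ => ?_
  exact (h.choose_spec ⟨φ, hφ⟩ ⟨ψ, hψ⟩).trans (hD ⟨φ, hφ⟩ ⟨ψ, hψ⟩).symm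

/-- `σ₊ = max σ(Im H)`. -/
def sigmaPlus (H : E →L[ℂ] E) : ℝ := sSup (spectrum ℝ (ℑ H : E →L[ℂ] E))

/-- `σ₋ = min σ(Im H)`. -/
def sigmaMinus (H : E →L[ℂ] E) : ℝ := sInf (spectrum ℝ (ℑ H : E →L[ℂ] E))

/-- The estimate (M+) on `Δ`. -/
def MourrePlus (A : E →ₗ.[ℂ] E) (H : E →L[ℂ] E) (Δ : Set ℝ) : Prop :=
  ClassC A 1 (ℜ H : E →L[ℂ] E) ∧
    ∃ a b β : ℝ, 0 < a ∧ 0 < b ∧ 0 ≤ β ∧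
      (a : ℂ) • spectralProj (ℜ H : E →L[ℂ] E) Δ
          - (b : ℂ) • (1 - spectralProj (ℜ H : E →L[ℂ] E) Δ)
        ≤ Complex.I • ad A (ℜ H : E →L[ℂ] E)
          + (β : ℂ) • ((sigmaPlus H : ℂ) • (1 : E →L[ℂ] E) - (ℑ H : E →L[ℂ] E))

/-- The estimate (M-) on `Δ`. -/
def MourreMinus (A : E →ₗ.[ℂ] E) (H : E →L[ℂ] E) (Δ : Set ℝ) : Prop :=
  ClassC A 1 (ℜ H : E →L[ℂ] E) ∧
    ∃ a b β : ℝ, 0 < a ∧ 0 < b ∧ 0 ≤ β ∧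
      (a : ℂ) • spectralProj (ℜ H : E →L[ℂ] E) Δ
          - (b : ℂ) • (1 - spectralProj (ℜ H : E →L[ℂ] E) Δ)
        ≤ Complex.I • ad A (ℜ H : E →L[ℂ] E)
          + (β : ℂ) • ((ℑ H : E →L[ℂ] E) - (sigmaMinus H : ℂ) • (1 : E →L[ℂ] E))

/-- The weighted resolvent `⟨A⟩^{-s} (z - H)⁻¹ ⟨A⟩^{-s}`. -/
def weightedResolvent (A : E →ₗ.[ℂ] E) (H : E →L[ℂ] E) (s : ℝ) (z : ℂ) : E →L[ℂ] E :=
  weight A s * resolvent H z * weight A s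

end NSAMourre

end

/-!
The resolvent estimate for the upper half plane is proved by a differential inequality; the lower
half plane is the upper one for `H*`, since `Re H* = Re H` and `Im H* = -Im H`.

Let `W(θ) = e^{iθA} H e^{-iθA}` and let `K_ε = ∫ φ(t) W(εt) dt`, where `φ(t) = (t - i) ψ(t)` for an
odd kernel `ψ` of compact support with first moment one (`cKernel`, `regularize`). If `H` were
analytic with respect to `A`, one would use `e^{εA} H e^{-εA}` instead, a solution of
`∂_ε K_ε = [A, K_ε]`. Here `(t + i) φ(t)` is odd, its derivative is even with integral zero, and
hence the defect `∂_ε K_ε - [A, K_ε]` contains only the symmetric second differences of `W`: its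
norm is at most `M ε⁻² ∫₀^ε ‖W(τ) + W(-τ) - 2H‖ dτ` (`IsOddKernel.exists_hasDerivAt_regularize`).
That `H` is in `𝒞^{1,1}(A)` says exactly that `ε⁻¹` times this bound is integrable at `0`;
`diniPrimitive` is a bounded primitive.

The spectral projection in (M+) enters only through `1_Δ(t) ≥ 1 - δ⁻² (t - x)²`, valid if `Δ`
contains the `δ`-neighbourhood of `x`. It turns (M+) into a form inequality for
`i ad_A(Re H) + β (σ₊ - Im H)` with an error `c ‖(Re H - x) u‖²`
(`MourrePlus.exists_forall_le`). Integrating the inequality along the flow `e^{-iτA} u` against `ψ`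
gives `Im (z - K_ε) ≥ (Im z - σ₊) + (1 - βε) (σ₊ - Im H) + ε (a/2 - 2c (Re H - x)²)`
(`exists_forall_im_inner_regularize_le`). The error `‖(Re H - x) w‖` is absorbed by `‖(z - K_ε) w‖`
and by the positive terms. The result is `(aε/4) ‖w‖² ≤ |Im ⟨w, (z - K_ε) w⟩| + 8cε ‖(z - K_ε) w‖²`,
also for the adjoint, for small `ε` and uniformly in `z` (`quadratic_bound_of_im_inner_le`). So
`G_ε = (z - K_ε)⁻¹` exists, also on the boundary of the half plane, and
`‖G_ε u‖², ‖G_ε* u‖² ≤ D ε⁻¹ (1 + |⟨u, G_ε u⟩|)` for `‖u‖ ≤ 1`.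

Let `u_ε = ⟨A⟩^{-s} (1 + ε|A|)⁻¹ x` and `f(ε) = ⟨u_ε, G_ε u_ε⟩`. In `f'` the commutator `[A, G_ε]`
puts `A` on `u_ε`, and `‖A u_ε‖, ‖∂_ε u_ε‖ ≤ ε^{p-1}` for `p = min(s, 1)`
(`exists_hasDerivAt_inner_resolvent`). With the bounds above, `|f'| ≤ Φ' (1 + |f|)` where
`Φ' = M D ε⁻³ ∫₀^ε ‖W(τ) + W(-τ) - 2H‖ dτ + 4 √D ε^{p-3/2}` is integrable at `0`, as `p > 1/2`.
A Gronwall argument (`norm_sq_le_of_deriv_le`) bounds `f` as `ε → 0`, uniformly in `z` and `x`, and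
the limit is `⟨x, ⟨A⟩^{-s} (z - H)⁻¹ ⟨A⟩^{-s} x⟩`.

All functions of `A` come from the Borel functional calculus of the Cayley transform, so the first
part shows that this calculus is a `*`-homomorphism, that `expI` is the unitary group with generator
`A`, and that the commutator `i ad_A` is the derivative of the conjugation by it.
-/

noncomputable section

open MeasureTheory Set Filter Topology
open scoped ComplexStarModule CompactlySupported

namespace NSAMourre

variable {E : Type*} [NormedAddCommGroup E] [InnerProductSpace ℂ E] [CompleteSpace E]

/-! ### The Borel functional calculus is a `*`-homomorphism -/

/-- Bounded Borel functions. -/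
structure IsBddBorel {X : Type*} [MeasurableSpace X] (f : X → ℂ) : Prop where
  measurable : Measurable f
  bounded : ∃ C : ℝ, ∀ w, ‖f w‖ ≤ C

namespace IsBddBorel

variable {X : Type*} [MeasurableSpace X] {f g : X → ℂ}

theorem of_bound (hf : Measurable f) (C : ℝ) (h : ∀ w, ‖f w‖ ≤ C) : IsBddBorel f := ⟨hf, C, h⟩

theorem const (c : ℂ) : IsBddBorel (fun _ : X => c) := ⟨measurable_const, ‖c‖, fun _ => le_rfl⟩

theorem sub (hf : IsBddBorel f) (hg : IsBddBorel g) : IsBddBorel (fun w => f w - g w) := by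
  obtain ⟨C, hC⟩ := hf.bounded
  obtain ⟨D, hD⟩ := hg.bounded
  exact ⟨hf.measurable.sub hg.measurable, C + D,
    fun w => (norm_sub_le _ _).trans (add_le_add (hC w) (hD w))⟩

theorem mul (hf : IsBddBorel f) (hg : IsBddBorel g) : IsBddBorel (fun w => f w * g w) := by
  obtain ⟨C, hC⟩ := hf.bounded
  obtain ⟨D, hD⟩ := hg.bounded
  refine ⟨hf.measurable.mul hg.measurable, C * D, fun w => ?_⟩
  rw [norm_mul]
  exact mul_le_mul (hC w) (hD w) (norm_nonneg _) ((norm_nonneg _).trans (hC w))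

theorem conj (hf : IsBddBorel f) : IsBddBorel (fun w => (starRingEnd ℂ) (f w)) := by
  obtain ⟨C, hC⟩ := hf.bounded
  exact ⟨Complex.continuous_conj.measurable.comp hf.measurable, C, fun w => by simpa using hC w⟩

theorem comp {Y : Type*} [MeasurableSpace Y] (hf : IsBddBorel f) {c : Y → X} (hc : Measurable c) :
    IsBddBorel (fun w => f (c w)) := by
  obtain ⟨C, hC⟩ := hf.bounded
  exact ⟨hf.measurable.comp hc, C, fun w => hC _⟩

theorem integrable (hf : IsBddBorel f) (μ : Measure X) [IsFiniteMeasure μ] : Integrable f μ := by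
  obtain ⟨C, hC⟩ := hf.bounded
  exact Integrable.of_bound hf.measurable.aestronglyMeasurable C (Eventually.of_forall hC)

theorem isBorelCalc {N : E →L[ℂ] E} {f : ℂ → ℂ} (hf : IsBddBorel f) :
    IsBorelCalc N f (borelCalc N f) := by
  obtain ⟨C, hC⟩ := hf.bounded
  exact isBorelCalc_borelCalc N hf.measurable hC

end IsBddBorel

theorem spectralMeasure_compl_spectrum (N : E →L[ℂ] E) (x : E) :
    spectralMeasure N x (spectrum ℂ N)ᶜ = 0 := by
  have hreg : (spectralMeasure N x).Regular := RealRMK.regular_rieszMeasure _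
  have hS : IsCompact (spectrum ℂ N) := spectrum.isCompact N
  rw [hS.isClosed.isOpen_compl.measure_eq_iSup_isCompact]
  simp only [ENNReal.iSup_eq_zero]
  intro K hKS hK
  obtain ⟨f, hf1, hf0, hfc, hf⟩ := exists_continuous_one_zero_of_isCompact hK
    hS.isClosed (subset_compl_iff_disjoint_right.1 hKS)
  let g : C_c(ℂ, ℝ) := ⟨f, hfc⟩
  have h0 : spectralFunctional N x g = 0 := by
    change (inner ℂ x (cfc (fun w : ℂ => (f w : ℂ)) N x)).re = 0
    have : cfc (fun w : ℂ => (f w : ℂ)) N = 0 := by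
      rw [cfc_congr (g := fun _ => 0) (fun w hw => by simp [hf0 hw])]
      exact cfc_const_zero ℂ N
    simp [this]
  have := RealRMK.rieszMeasure_le_of_eq_one (spectralFunctional N x) (f := g)
    (fun w => (hf w).1) hK (fun w hw => hf1 hw)
  rw [h0, ENNReal.ofReal_zero, nonpos_iff_eq_zero] at this
  exact this

theorem ae_mem_spectrum (N : E →L[ℂ] E) (x : E) :
    ∀ᵐ w ∂(spectralMeasure N x), w ∈ spectrum ℂ N :=
  spectralMeasure_compl_spectrum N x

theorem IsBorelCalc.congr_ae {N : E →L[ℂ] E} {f g : ℂ → ℂ} {T : E →L[ℂ] E}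
    (hT : IsBorelCalc N f T) (h : ∀ x, f =ᵐ[spectralMeasure N x] g) : IsBorelCalc N g T :=
  fun x => (hT x).trans (integral_congr_ae (h x))

/-- On continuous functions the Borel functional calculus is the continuous one. -/
theorem isBorelCalc_cfc (N : E →L[ℂ] E) [IsStarNormal N] {f : ℂ → ℂ} (hf : Continuous f) :
    IsBorelCalc N f (cfc f N) := by
  obtain ⟨χ, hχ1, -, hχc, -⟩ := exists_continuous_one_zero_of_isCompact (spectrum.isCompact N)
    (isClosed_empty (X := ℂ)) (disjoint_empty _)
  let F : C_c(ℂ, ℝ) := ⟨⟨fun w => χ w * (f w).re, by fun_prop⟩, hχc.mul_right⟩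
  let G : C_c(ℂ, ℝ) := ⟨⟨fun w => χ w * (f w).im, by fun_prop⟩, hχc.mul_right⟩
  have hF : ∀ w, F w = χ w * (f w).re := fun w => rfl
  have hG : ∀ w, G w = χ w * (f w).im := fun w => rfl
  have hFc : Continuous fun w => (F w : ℂ) := Complex.continuous_ofReal.comp F.continuous
  have hGc : Continuous fun w => (G w : ℂ) := Complex.continuous_ofReal.comp G.continuous
  have hint : ∀ (K : C_c(ℂ, ℝ)) x, Integrable (fun w => (K w : ℂ)) (spectralMeasure N x) := by
    intro K x
    exact (K.continuous.integrable_of_hasCompactSupport K.hasCompactSupport).ofReal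
  have h := (isBorelCalc_compactlySupported N F).add
    ((isBorelCalc_compactlySupported N G).const_mul Complex.I) (hint F)
    (fun x => (hint G x).const_mul _)
  have hEq : ∀ w ∈ spectrum ℂ N, (F w : ℂ) + Complex.I * (G w : ℂ) = f w := by
    intro w hw
    have h1 : χ w = 1 := hχ1 hw
    rw [hF, hG, h1, mul_comm Complex.I]
    simp
  have hT : cfc f N = cfc (fun w => (F w : ℂ)) N + Complex.I • cfc (fun w => (G w : ℂ)) N := by
    rw [← cfc_const_mul Complex.I (fun w => (G w : ℂ)) N hGc.continuousOn,
      ← cfc_add (a := N) _ _ hFc.continuousOn (hGc.const_mul _).continuousOn]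
    exact cfc_congr fun w hw => (hEq w hw).symm
  rw [hT]
  refine h.congr_ae fun x => ?_
  filter_upwards [ae_mem_spectrum N x] with w hw using hEq w hw

theorem isBorelCalc_id (N : E →L[ℂ] E) [IsStarNormal N] : IsBorelCalc N (fun w => w) N := by
  have := isBorelCalc_cfc N continuous_id
  rwa [cfc_id ℂ N] at this

theorem isBorelCalc_one (N : E →L[ℂ] E) [IsStarNormal N] : IsBorelCalc N (fun _ => 1) 1 := by
  have := isBorelCalc_cfc N (f := fun _ => 1) continuous_const
  rwa [cfc_const_one ℂ N] at this

/-- The sum of the four spectral measures that enter the polarization identity of `⟨y, f(N) x⟩`. -/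
def pairMeasure (N : E →L[ℂ] E) (y x : E) : Measure ℂ :=
  spectralMeasure N (y + x) + spectralMeasure N (y - x)
    + spectralMeasure N (y + Complex.I • x) + spectralMeasure N (y - Complex.I • x)

instance (N : E →L[ℂ] E) (y x : E) : IsFiniteMeasure (pairMeasure N y x) := by
  unfold pairMeasure; infer_instance

theorem IsBorelCalc.norm_inner_le {N : E →L[ℂ] E} {f : ℂ → ℂ} {T : E →L[ℂ] E}
    (hT : IsBorelCalc N f T) (hf : IsBddBorel f) (y x : E) :
    ‖inner ℂ y (T x)‖ ≤ ∫ w, ‖f w‖ ∂(pairMeasure N y x) := by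
  have hb : ∀ z, ‖inner ℂ (T z) z‖ ≤ ∫ w, ‖f w‖ ∂(spectralMeasure N z) := fun z => by
    rw [norm_inner_symm, hT z]
    exact norm_integral_le_integral_norm _
  have hi : ∀ z, Integrable (fun w => ‖f w‖) (spectralMeasure N z) := fun z =>
    (hf.integrable _).norm
  rw [norm_inner_symm, ← ContinuousLinearMap.coe_coe T,
    inner_map_polarization (T : E →ₗ[ℂ] E) y x, pairMeasure,
    integral_add_measure ((((hi _).add_measure (hi _)).add_measure (hi _))) (hi _),
    integral_add_measure (((hi _).add_measure (hi _))) (hi _),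
    integral_add_measure (hi _) (hi _), norm_div]
  have h1 := hb (y + x)
  have h2 := hb (y - x)
  have h3 := hb (y + Complex.I • x)
  have h4 := hb (y - Complex.I • x)
  have n3 : ∀ c : ℂ, ‖Complex.I * c‖ = ‖c‖ := fun c => by simp
  have := norm_sub_le (inner ℂ (T (y + x)) (y + x) - inner ℂ (T (y - x)) (y - x) +
    Complex.I * inner ℂ (T (y + Complex.I • x)) (y + Complex.I • x))
    (Complex.I * inner ℂ (T (y - Complex.I • x)) (y - Complex.I • x))
  have h5 := norm_add_le (inner ℂ (T (y + x)) (y + x) - inner ℂ (T (y - x)) (y - x))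
    (Complex.I * inner ℂ (T (y + Complex.I • x)) (y + Complex.I • x))
  have h6 := norm_sub_le (inner ℂ (T (y + x)) (y + x)) (inner ℂ (T (y - x)) (y - x))
  rw [n3] at this h5
  have h7 : ‖(4 : ℂ)‖ = 4 := by simp
  rw [h7, div_le_iff₀ (by norm_num)]
  simp only [ContinuousLinearMap.coe_coe]
  have p1 := norm_nonneg (inner ℂ (T (y + x)) (y + x))
  have p2 := norm_nonneg (inner ℂ (T (y - x)) (y - x))
  have p3 := norm_nonneg (inner ℂ (T (y + Complex.I • x)) (y + Complex.I • x))
  have p4 := norm_nonneg (inner ℂ (T (y - Complex.I • x)) (y - Complex.I • x))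
  linarith

/-- A functional on bounded Borel functions that is Lipschitz for the norm of `L¹(ν)` and vanishes
on continuous functions of compact support is zero. -/
theorem eq_zero_of_forall_continuous (ν : Measure ℂ) [IsFiniteMeasure ν] (Λ : (ℂ → ℂ) → ℂ) (C : ℝ)
    (hΛ : ∀ f g, IsBddBorel f → IsBddBorel g → ‖Λ f - Λ g‖ ≤ C * ∫ w, ‖f w - g w‖ ∂ν)
    (h0 : ∀ f, Continuous f → IsBddBorel f → Λ f = 0) {f : ℂ → ℂ} (hf : IsBddBorel f) :
    Λ f = 0 := by
  rw [← norm_le_zero_iff]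
  refine le_of_forall_pos_le_add fun ε hε => ?_
  obtain ⟨g, hgc, hg, hcont, -⟩ := (hf.integrable ν).exists_hasCompactSupport_integral_sub_le
    (ε := ε / (|C| + 1)) (by positivity)
  have hgb : IsBddBorel g := by
    obtain ⟨D, hD⟩ := hcont.bounded_above_of_compact_support hgc
    exact ⟨hcont.measurable, D, hD⟩
  have h1 := hΛ f g hf hgb
  rw [h0 g hcont hgb, sub_zero] at h1
  have h2 : 0 ≤ ∫ w, ‖f w - g w‖ ∂ν := integral_nonneg fun _ => norm_nonneg _
  calc ‖Λ f‖ ≤ C * ∫ w, ‖f w - g w‖ ∂ν := h1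
    _ ≤ (|C| + 1) * ∫ w, ‖f w - g w‖ ∂ν := by gcongr; linarith [le_abs_self C]
    _ ≤ (|C| + 1) * (ε / (|C| + 1)) := by gcongr
    _ = 0 + ε := by field_simp; ring

theorem IsBorelCalc.sub {N : E →L[ℂ] E} {f g : ℂ → ℂ} {S T : E →L[ℂ] E}
    (hS : IsBorelCalc N f S) (hT : IsBorelCalc N g T) (hf : IsBddBorel f) (hg : IsBddBorel g) :
    IsBorelCalc N (fun w => f w - g w) (S - T) := by
  intro x
  rw [integral_sub (hf.integrable _) (hg.integrable _), sub_apply, inner_sub_right, hS x, hT x]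

theorem IsBorelCalc.adjoint {N : E →L[ℂ] E} {f : ℂ → ℂ} {T : E →L[ℂ] E}
    (hT : IsBorelCalc N f T) : IsBorelCalc N (fun w => (starRingEnd ℂ) (f w)) (star T) := by
  intro x
  rw [integral_conj, ← hT x, inner_conj_symm, ContinuousLinearMap.star_eq_adjoint,
    ContinuousLinearMap.adjoint_inner_right]

theorem IsBorelCalc.mul {N : E →L[ℂ] E} [IsStarNormal N] {f g : ℂ → ℂ} {S T : E →L[ℂ] E}
    (hS : IsBorelCalc N f S) (hT : IsBorelCalc N g T) (hf : IsBddBorel f) (hg : IsBddBorel g) :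
    IsBorelCalc N (fun w => f w * g w) (S * T) := by
  -- Both sides are `L¹`-continuous in `f` and in `g`; for continuous functions the claim is the
  -- multiplicativity of the continuous functional calculus.
  have key : ∀ {f : ℂ → ℂ}, IsBddBorel f → ∀ x : E, ∀ C : ℝ,
      (∀ w, ‖f w‖ ≤ C) → ∀ y : E, (∀ g, IsBddBorel g →
        ‖inner ℂ y (borelCalc N g x) - ∫ w, f w * g w ∂(spectralMeasure N x)‖ ≤
        ‖inner ℂ y (borelCalc N g x)‖ + C * ∫ w, ‖g w‖ ∂(spectralMeasure N x)) := by
    intro f hf x C hC y g hg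
    refine (norm_sub_le _ _).trans ?_
    gcongr
    refine (norm_integral_le_integral_norm _).trans ?_
    rw [← integral_const_mul]
    refine integral_mono (hf.mul hg |>.integrable _).norm
      ((hg.integrable _).norm.const_mul C) fun w => ?_
    simp only [norm_mul]
    gcongr
    exact hC w
  have step : ∀ {f : ℂ → ℂ}, IsBddBorel f → ∀ x y : E,
      (∀ g, Continuous g → IsBddBorel g →
        inner ℂ y (borelCalc N g x) = ∫ w, f w * g w ∂(spectralMeasure N x)) →
      ∀ g, IsBddBorel g →
        inner ℂ y (borelCalc N g x) = ∫ w, f w * g w ∂(spectralMeasure N x) := by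
    intro f hf x y h0 g hg
    obtain ⟨C, hC⟩ := hf.bounded
    have hC0 : 0 ≤ C := (norm_nonneg _).trans (hC 0)
    refine sub_eq_zero.1 (eq_zero_of_forall_continuous
      (pairMeasure N y x + spectralMeasure N x)
      (fun g => inner ℂ y (borelCalc N g x) - ∫ w, f w * g w ∂(spectralMeasure N x)) (1 + C)
      ?_ (fun g hgc hg => sub_eq_zero.2 (h0 g hgc hg)) hg)
    intro g₁ g₂ h₁ h₂
    have hd := h₁.sub h₂
    have e1 : borelCalc N (fun w => g₁ w - g₂ w) = borelCalc N g₁ - borelCalc N g₂ :=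
      hd.isBorelCalc.unique (h₁.isBorelCalc.sub h₂.isBorelCalc h₁ h₂)
    have e2 : ∫ w, f w * (g₁ w - g₂ w) ∂(spectralMeasure N x)
        = (∫ w, f w * g₁ w ∂(spectralMeasure N x)) - ∫ w, f w * g₂ w ∂(spectralMeasure N x) := by
      rw [← integral_sub ((hf.mul h₁).integrable _) ((hf.mul h₂).integrable _)]
      simp only [mul_sub]
    have h3 := key hf x C hC y _ hd
    rw [e1, e2, sub_apply, inner_sub_right] at h3
    have h4 := hd.isBorelCalc.norm_inner_le (N := N) hd y x
    rw [e1, sub_apply, inner_sub_right] at h4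
    have i1 : 0 ≤ ∫ w, ‖g₁ w - g₂ w‖ ∂(pairMeasure N y x) :=
      integral_nonneg fun _ => norm_nonneg _
    have i2 : 0 ≤ ∫ w, ‖g₁ w - g₂ w‖ ∂(spectralMeasure N x) :=
      integral_nonneg fun _ => norm_nonneg _
    rw [integral_add_measure (hd.integrable _).norm (hd.integrable _).norm]
    have e3 : (inner ℂ y (borelCalc N g₁ x) - ∫ w, f w * g₁ w ∂(spectralMeasure N x))
        - (inner ℂ y (borelCalc N g₂ x) - ∫ w, f w * g₂ w ∂(spectralMeasure N x))
        = (inner ℂ y (borelCalc N g₁ x) - inner ℂ y (borelCalc N g₂ x))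
        - ((∫ w, f w * g₁ w ∂(spectralMeasure N x))
          - ∫ w, f w * g₂ w ∂(spectralMeasure N x)) := by ring
    rw [e3]
    nlinarith [mul_nonneg hC0 i1]
  have hS' := hf.isBorelCalc.unique hS
  have hT' := hg.isBorelCalc.unique hT
  subst hS' hT'
  have hcont : ∀ g : ℂ → ℂ, Continuous g → IsBddBorel g → borelCalc N g = cfc g N :=
    fun g hgc hg => hg.isBorelCalc.unique (isBorelCalc_cfc N hgc)
  have hstar : ∀ g : ℂ → ℂ, IsBddBorel g →
      borelCalc N (fun w => (starRingEnd ℂ) (g w)) = star (borelCalc N g) :=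
    fun g hg => hg.conj.isBorelCalc.unique hg.isBorelCalc.adjoint
  -- `f` continuous, `g` Borel
  have h1 : ∀ f : ℂ → ℂ, Continuous f → IsBddBorel f → ∀ g : ℂ → ℂ, IsBddBorel g → ∀ x : E,
      inner ℂ x ((borelCalc N f * borelCalc N g) x)
        = ∫ w, f w * g w ∂(spectralMeasure N x) := by
    intro f hfc hf g hg x
    have := step hf x (star (borelCalc N f) x) (fun g hgc hg => ?_) g hg
    · rwa [ContinuousLinearMap.star_eq_adjoint, ContinuousLinearMap.adjoint_inner_left] at this
    · have h2 := isBorelCalc_cfc N (hfc.mul hgc) x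
      rw [ContinuousLinearMap.star_eq_adjoint, ContinuousLinearMap.adjoint_inner_left,
        hcont f hfc hf, hcont g hgc hg]
      change _ = ∫ w, (f * g) w ∂(spectralMeasure N x)
      rw [← h2]
      change _ = inner ℂ x (cfc (fun w => f w * g w) N x)
      rw [cfc_mul f g N hfc.continuousOn hgc.continuousOn]
      rfl
  intro x
  have := step hf x (star (borelCalc N f) x) (fun g hgc hg => ?_) g hg
  · rwa [ContinuousLinearMap.star_eq_adjoint, ContinuousLinearMap.adjoint_inner_left] at this
  · rw [← hstar f hf]
    have h2 := h1 _ (Complex.continuous_conj.comp hgc) hg.conj _ hf.conj x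
    have h3 := congrArg (starRingEnd ℂ) h2
    rw [← integral_conj, inner_conj_symm] at h3
    simp only [Function.comp_def] at h3
    rw [hstar g hg, mul_apply_eq_comp, ContinuousLinearMap.star_eq_adjoint,
      ContinuousLinearMap.adjoint_inner_left] at h3
    rw [h3]
    congr 1 with w
    simp [mul_comm]

theorem IsBorelCalc.norm_sq_apply {N : E →L[ℂ] E} [IsStarNormal N] {f : ℂ → ℂ} {T : E →L[ℂ] E}
    (hT : IsBorelCalc N f T) (hf : IsBddBorel f) (x : E) :
    ‖T x‖ ^ 2 = ∫ w, ‖f w‖ ^ 2 ∂(spectralMeasure N x) := by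
  have h := (hT.adjoint.mul hT hf.conj hf) x
  rw [mul_apply_eq_comp, ContinuousLinearMap.star_eq_adjoint,
    ContinuousLinearMap.adjoint_inner_right, inner_self_eq_norm_sq_to_K] at h
  have e : ∀ w, (starRingEnd ℂ) (f w) * f w = ((‖f w‖ ^ 2 : ℝ) : ℂ) := fun w => by
    rw [← Complex.normSq_eq_conj_mul_self, Complex.normSq_eq_norm_sq]
  simp only [e] at h
  rw [integral_complex_ofReal] at h
  rw [← Complex.ofReal_inj, ← h]
  simp

theorem IsBorelCalc.norm_le {N : E →L[ℂ] E} [IsStarNormal N] {f : ℂ → ℂ} {T : E →L[ℂ] E}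
    (hT : IsBorelCalc N f T) (hm : Measurable f) {C : ℝ} (hC0 : 0 ≤ C) (hC : ∀ w, ‖f w‖ ≤ C) :
    ‖T‖ ≤ C := by
  have hf : IsBddBorel f := ⟨hm, C, hC⟩
  refine ContinuousLinearMap.opNorm_le_bound _ hC0 fun x => ?_
  refine (sq_le_sq₀ (norm_nonneg _) (by positivity)).1 ?_
  have h1 := (isBorelCalc_one N).norm_sq_apply (.const 1) x
  rw [hT.norm_sq_apply hf x, mul_pow]
  simp only [one_apply_eq_self, norm_one, one_pow] at h1
  rw [h1, ← integral_const_mul]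
  refine integral_mono_of_nonneg (Eventually.of_forall fun w => by positivity)
    (integrable_const _) (Eventually.of_forall fun w => ?_)
  simp only [mul_one]
  gcongr
  exact hC w

/-- Bounded pointwise convergence of functions gives strong convergence of the operators. -/
theorem tendsto_isBorelCalc {ι : Type*} {l : Filter ι} [l.IsCountablyGenerated]
    {N : E →L[ℂ] E} [IsStarNormal N] {F : ι → ℂ → ℂ} {f : ℂ → ℂ} {T : ι → E →L[ℂ] E}
    {S : E →L[ℂ] E} (hT : ∀ᶠ i in l, IsBorelCalc N (F i) (T i)) (hS : IsBorelCalc N f S)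
    (hF : ∀ᶠ i in l, Measurable (F i)) (hf : IsBddBorel f) {C : ℝ}
    (hb : ∀ᶠ i in l, ∀ w, ‖F i w‖ ≤ C)
    (hlim : ∀ w, Tendsto (fun i => F i w) l (𝓝 (f w))) (x : E) :
    Tendsto (fun i => T i x) l (𝓝 (S x)) := by
  obtain ⟨D, hD⟩ := hf.bounded
  rw [tendsto_iff_norm_sub_tendsto_zero]
  have h2 : Tendsto (fun i => ∫ w, ‖F i w - f w‖ ^ 2 ∂(spectralMeasure N x)) l (𝓝 0) := by
    have := tendsto_integral_filter_of_dominated_convergence (l := l)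
      (F := fun i w => ‖F i w - f w‖ ^ 2) (f := fun _ => (0 : ℝ)) (μ := spectralMeasure N x)
      (fun _ => (C + D) ^ 2) ?_ ?_ (integrable_const _) ?_
    · simpa using this
    · filter_upwards [hF] with i hi
      exact ((hi.sub hf.measurable).norm.pow_const 2).aestronglyMeasurable
    · filter_upwards [hb] with i hi
      refine Eventually.of_forall fun w => ?_
      rw [norm_pow, norm_norm]
      gcongr
      exact (norm_sub_le _ _).trans (add_le_add (hi w) (hD w))
    · refine Eventually.of_forall fun w => ?_
      have := ((hlim w).sub_const (f w)).norm.pow 2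
      simpa using this
  have h3 := (Real.continuous_sqrt.tendsto 0).comp h2
  rw [Real.sqrt_zero] at h3
  refine h3.congr' ?_
  filter_upwards [hT, hF, hb] with i hi hFi hbi
  have hbd : IsBddBorel (F i) := ⟨hFi, C, hbi⟩
  have := (hi.sub hS hbd hf).norm_sq_apply (hbd.sub hf) x
  simp only [Function.comp_def]
  rw [← this, Real.sqrt_sq (norm_nonneg _), sub_apply]

/-! ### Functions of an unbounded selfadjoint operator -/

theorem measurable_cayleyCoord : Measurable cayleyCoord := by
  unfold cayleyCoord
  exact Complex.measurable_re.comp ((measurable_const.mul (measurable_const.add measurable_id)).div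
    (measurable_const.sub measurable_id))

theorem isStarNormal_cayley {A : E →ₗ.[ℂ] E} (hA : IsSelfAdjoint A) : IsStarNormal (cayley A) := by
  have h := cayley_mem_unitary hA
  refine ⟨?_⟩
  rw [commute_iff_eq, (Unitary.mem_iff.1 h).1, (Unitary.mem_iff.1 h).2]

theorem ae_norm_eq_one {A : E →ₗ.[ℂ] E} (hA : IsSelfAdjoint A) (x : E) :
    ∀ᵐ w ∂(spectralMeasure (cayley A) x), ‖w‖ = 1 := by
  have h : spectrum ℂ (cayley A) ⊆ Metric.sphere 0 1 :=
    spectrum.subset_circle_of_unitary (cayley_mem_unitary hA)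
  filter_upwards [ae_mem_spectrum (cayley A) x] with w hw
  exact mem_sphere_zero_iff_norm.1 (h hw)

/-- The identity function, cut off outside of the closed unit disc. -/
theorem isBorelCalc_cayley_indicator {A : E →ₗ.[ℂ] E} (hA : IsSelfAdjoint A) :
    IsBddBorel ((Metric.closedBall (0 : ℂ) 1).indicator fun w => w) ∧
    IsBorelCalc (cayley A) ((Metric.closedBall (0 : ℂ) 1).indicator fun w => w) (cayley A) := by
  have := isStarNormal_cayley hA
  refine ⟨⟨measurable_id.indicator Metric.isClosed_closedBall.measurableSet, 1, fun w => ?_⟩, ?_⟩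
  · by_cases hw : w ∈ Metric.closedBall (0 : ℂ) 1
    · rw [indicator_of_mem hw]
      simpa using hw
    · rw [indicator_of_notMem hw]
      simp
  · refine (isBorelCalc_id (cayley A)).congr_ae fun x => ?_
    filter_upwards [ae_norm_eq_one hA x] with w hw
    rw [indicator_of_mem]
    simp [hw]

/-- The number `1` is not an eigenvalue of the Cayley transform, so that the spectral measures do
not charge the point which corresponds to `t = ∞`. -/
theorem ae_ne_one {A : E →ₗ.[ℂ] E} (hA : IsSelfAdjoint A) (x : E) :
    ∀ᵐ w ∂(spectralMeasure (cayley A) x), w ≠ 1 := by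
  have := isStarNormal_cayley hA
  have hb : IsBddBorel (({1} : Set ℂ).indicator fun _ => (1 : ℂ)) := by
    refine ⟨measurable_const.indicator (measurableSet_singleton 1), 1, fun w => ?_⟩
    by_cases hw : w ∈ ({1} : Set ℂ) <;> simp only [indicator, hw] <;> simp
  set P := borelCalc (cayley A) (({1} : Set ℂ).indicator fun _ => (1 : ℂ)) with hP
  have hPb : IsBorelCalc (cayley A) _ P := hb.isBorelCalc
  obtain ⟨h1, h2⟩ := isBorelCalc_cayley_indicator hA
  have hUP : cayley A * P = P := by
    refine (h2.mul hPb h1 hb).unique ?_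
    convert hPb using 2 with w
    by_cases hw : w = 1
    · subst hw; simp
    · simp [hw]
  have hP0 : P x = 0 := by
    have h3 : cayley A (P x) = P x := congrArg (fun T : E →L[ℂ] E => T x) hUP
    obtain ⟨u, hu⟩ : ∃ u : A.domain, A u + Complex.I • (u : E) = P x := by
      simpa using exists_add_smul_eq hA one_ne_zero (P x)
    rw [← hu, isCayley_cayley hA u] at h3
    have h4 : (2 * Complex.I) • (u : E) = 0 := by
      have : A u + Complex.I • (u : E) - (A u - Complex.I • (u : E)) = 0 := by rw [h3]; simp
      rw [← this, mul_smul, two_smul]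
      abel
    have h5 : (u : E) = 0 := by simpa using h4
    have h6 : u = 0 := by simpa using h5
    rw [← hu, h6]
    simp
  have h7 := hPb x
  rw [hP0, inner_zero_right, integral_indicator (measurableSet_singleton 1)] at h7
  have h8 : (spectralMeasure (cayley A) x).real {1} = 0 := by
    rw [setIntegral_const] at h7
    simpa using h7.symm
  rw [measureReal_eq_zero_iff] at h8
  rw [ae_iff]
  simpa using h8

theorem div_cayleyCoord {w : ℂ} (h1 : ‖w‖ = 1) (h : w ≠ 1) :
    (cayleyCoord w - Complex.I) / (cayleyCoord w + Complex.I) = w := by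
  have h0 : w ≠ 0 := by rintro rfl; simp at h1
  have hs : 1 - w ≠ 0 := sub_ne_zero.2 (Ne.symm h)
  have hs' : w - 1 ≠ 0 := sub_ne_zero.2 h
  have hc : (cayleyCoord w : ℂ) = Complex.I * (1 + w) / (1 - w) := by
    unfold cayleyCoord
    apply Complex.conj_eq_iff_re.1
    have hw : (starRingEnd ℂ) w = w⁻¹ := (Complex.inv_eq_conj h1).symm
    have hs2 : 1 - w⁻¹ ≠ 0 := by
      rw [sub_ne_zero]; intro h'; exact h (by rw [← inv_inv w, ← h', inv_one])
    simp only [map_div₀, map_mul, Complex.conj_I, map_add, map_one, map_sub, hw]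
    field_simp
    ring
  rw [hc]
  have e1 : Complex.I * (1 + w) / (1 - w) - Complex.I = 2 * Complex.I * w / (1 - w) := by
    field_simp; ring
  have e2 : Complex.I * (1 + w) / (1 - w) + Complex.I = 2 * Complex.I / (1 - w) := by
    field_simp; ring
  rw [e1, e2]
  field_simp

theorem ofReal_add_I_ne_zero (t : ℝ) : (t : ℂ) + Complex.I ≠ 0 := by
  intro h
  have := congrArg Complex.im h
  simp at this

theorem one_le_norm_ofReal_add_I (t : ℝ) : 1 ≤ ‖(t : ℂ) + Complex.I‖ := by
  have := Complex.abs_im_le_norm ((t : ℂ) + Complex.I)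
  simpa using this

theorem abs_le_norm_ofReal_add_I (t : ℝ) : |t| ≤ ‖(t : ℂ) + Complex.I‖ := by
  have := Complex.abs_re_le_norm ((t : ℂ) + Complex.I)
  simpa using this

theorem IsBddBorel.isBorelCalc_funcCalc {A : E →ₗ.[ℂ] E} {f : ℝ → ℂ} (hf : IsBddBorel f) :
    IsBorelCalc (cayley A) (fun w => f (cayleyCoord w)) (funcCalc A f) :=
  (hf.comp measurable_cayleyCoord).isBorelCalc

section FuncCalc

variable {A : E →ₗ.[ℂ] E}

theorem funcCalc_mul (hA : IsSelfAdjoint A) {f g : ℝ → ℂ} (hf : IsBddBorel f)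
    (hg : IsBddBorel g) : funcCalc A (fun t => f t * g t) = funcCalc A f * funcCalc A g := by
  have := isStarNormal_cayley hA
  exact (hf.mul hg).isBorelCalc_funcCalc.unique (hf.isBorelCalc_funcCalc.mul
    hg.isBorelCalc_funcCalc (hf.comp measurable_cayleyCoord) (hg.comp measurable_cayleyCoord))

theorem funcCalc_one (hA : IsSelfAdjoint A) : funcCalc A (fun _ => 1) = 1 := by
  have := isStarNormal_cayley hA
  exact (IsBddBorel.const 1).isBorelCalc_funcCalc.unique (isBorelCalc_one (cayley A))

theorem funcCalc_conj {f : ℝ → ℂ} (hf : IsBddBorel f) :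
    funcCalc A (fun t => (starRingEnd ℂ) (f t)) = star (funcCalc A f) :=
  hf.conj.isBorelCalc_funcCalc.unique hf.isBorelCalc_funcCalc.adjoint

theorem funcCalc_sub {f g : ℝ → ℂ} (hf : IsBddBorel f) (hg : IsBddBorel g) :
    funcCalc A (fun t => f t - g t) = funcCalc A f - funcCalc A g :=
  (hf.sub hg).isBorelCalc_funcCalc.unique (hf.isBorelCalc_funcCalc.sub
    hg.isBorelCalc_funcCalc (hf.comp measurable_cayleyCoord) (hg.comp measurable_cayleyCoord))

theorem funcCalc_const_mul {f : ℝ → ℂ} (hf : IsBddBorel f) (c : ℂ) :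
    funcCalc A (fun t => c * f t) = c • funcCalc A f :=
  ((IsBddBorel.const c).mul hf).isBorelCalc_funcCalc.unique (hf.isBorelCalc_funcCalc.const_mul c)

theorem norm_funcCalc_le (hA : IsSelfAdjoint A) {f : ℝ → ℂ} (hf : Measurable f) {C : ℝ}
    (hC0 : 0 ≤ C) (hC : ∀ t, ‖f t‖ ≤ C) : ‖funcCalc A f‖ ≤ C := by
  have := isStarNormal_cayley hA
  exact (IsBddBorel.of_bound hf C hC).isBorelCalc_funcCalc.norm_le
    (hf.comp measurable_cayleyCoord) hC0 fun w => hC _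

theorem tendsto_funcCalc (hA : IsSelfAdjoint A) {ι : Type*} {l : Filter ι}
    [l.IsCountablyGenerated] {F : ι → ℝ → ℂ} {f : ℝ → ℂ} (hf : IsBddBorel f)
    (hF : ∀ᶠ i in l, Measurable (F i)) {C : ℝ} (hb : ∀ᶠ i in l, ∀ t, ‖F i t‖ ≤ C)
    (hlim : ∀ t, Tendsto (fun i => F i t) l (𝓝 (f t))) (x : E) :
    Tendsto (fun i => funcCalc A (F i) x) l (𝓝 (funcCalc A f x)) := by
  have := isStarNormal_cayley hA
  refine tendsto_isBorelCalc (C := C) (F := fun i w => F i (cayleyCoord w)) ?_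
    hf.isBorelCalc_funcCalc ?_ (hf.comp measurable_cayleyCoord) ?_ (fun w => hlim _) x
  · filter_upwards [hF, hb] with i h1 h2
    exact (IsBddBorel.of_bound h1 C h2).isBorelCalc_funcCalc
  · filter_upwards [hF] with i h1 using h1.comp measurable_cayleyCoord
  · filter_upwards [hb] with i h1 w using h1 _

/-- Differentiation of `F_θ(A) x` with respect to a parameter. -/
theorem hasDerivAt_funcCalc (hA : IsSelfAdjoint A) {F : ℝ → ℝ → ℂ} {F' : ℝ → ℂ} {θ₀ : ℝ}
    (hF : ∀ᶠ θ in 𝓝 θ₀, IsBddBorel (F θ)) (hF' : IsBddBorel F') {C : ℝ}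
    (hb : ∀ᶠ θ in 𝓝 θ₀, ∀ t, ‖F θ t - F θ₀ t‖ ≤ C * |θ - θ₀|)
    (hd : ∀ t, HasDerivAt (fun θ => F θ t) (F' t) θ₀) (x : E) :
    HasDerivAt (fun θ => funcCalc A (F θ) x) (funcCalc A F' x) θ₀ := by
  have h0 := hF.self_of_nhds
  have hF2 := nhdsWithin_le_nhds (s := {θ₀}ᶜ) hF
  rw [hasDerivAt_iff_tendsto_slope]
  have := tendsto_funcCalc hA (l := 𝓝[≠] θ₀) (C := C)
    (F := fun θ t => ((θ - θ₀ : ℝ) : ℂ)⁻¹ * (F θ t - F θ₀ t)) (f := F') hF' ?_ ?_ ?_ x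
  · refine this.congr' ?_
    filter_upwards [hF2] with θ hθ
    rw [funcCalc_const_mul (hθ.sub h0), funcCalc_sub hθ h0, slope_def_module, smul_apply,
      sub_apply, ← Complex.ofReal_inv, Complex.coe_smul]
  · filter_upwards [hF2] with θ hθ using measurable_const.mul (hθ.sub h0).measurable
  · filter_upwards [nhdsWithin_le_nhds hb, self_mem_nhdsWithin] with θ hθ hne t
    have hpos : 0 < |θ - θ₀| := abs_pos.2 (sub_ne_zero.2 hne)
    rw [norm_mul, norm_inv, Complex.norm_real, Real.norm_eq_abs, inv_mul_le_iff₀ hpos, mul_comm]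
    exact hθ t
  · intro t
    have := (hasDerivAt_iff_tendsto_slope.1 (hd t))
    refine this.congr fun θ => ?_
    rw [slope_def_module, ← Complex.ofReal_inv, Complex.real_smul]

/-! ### The unitary group -/

theorem isBddBorel_exp (θ : ℝ) : IsBddBorel fun t : ℝ => Complex.exp (Complex.I * θ * t) :=
  ⟨by fun_prop, 1, fun t => by
    rw [show Complex.I * θ * t = ((θ * t : ℝ) : ℂ) * Complex.I by push_cast; ring,
      Complex.norm_exp_ofReal_mul_I]⟩

theorem norm_exp_I_mul (θ t : ℝ) : ‖Complex.exp (Complex.I * θ * t)‖ = 1 := by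
  rw [show Complex.I * θ * t = ((θ * t : ℝ) : ℂ) * Complex.I by push_cast; ring,
    Complex.norm_exp_ofReal_mul_I]

theorem expI_add (hA : IsSelfAdjoint A) (a b : ℝ) : expI A (a + b) = expI A a * expI A b := by
  unfold expI
  rw [← funcCalc_mul hA (isBddBorel_exp a) (isBddBorel_exp b)]
  congr 1 with t
  rw [← Complex.exp_add]
  push_cast
  ring_nf

theorem expI_zero (hA : IsSelfAdjoint A) : expI A 0 = 1 := by
  unfold expI
  rw [← funcCalc_one hA]
  simp

theorem star_expI (θ : ℝ) : star (expI A θ) = expI A (-θ) := by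
  unfold expI
  rw [← funcCalc_conj (isBddBorel_exp θ)]
  congr 1 with t
  rw [← Complex.exp_conj]
  simp

theorem expI_mul_neg (hA : IsSelfAdjoint A) (θ : ℝ) : expI A θ * expI A (-θ) = 1 := by
  rw [← expI_add hA, add_neg_cancel, expI_zero hA]

theorem expI_neg_mul (hA : IsSelfAdjoint A) (θ : ℝ) : expI A (-θ) * expI A θ = 1 := by
  rw [← expI_add hA, neg_add_cancel, expI_zero hA]

theorem norm_expI_le (hA : IsSelfAdjoint A) (θ : ℝ) : ‖expI A θ‖ ≤ 1 :=
  norm_funcCalc_le hA (isBddBorel_exp θ).measurable zero_le_one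
    fun t => (norm_exp_I_mul θ t).le

theorem norm_expI_apply (hA : IsSelfAdjoint A) (θ : ℝ) (x : E) : ‖expI A θ x‖ = ‖x‖ := by
  have h : ∀ θ x, ‖expI A θ x‖ ≤ ‖x‖ := fun θ x => by
    simpa using ContinuousLinearMap.le_of_opNorm_le _ (norm_expI_le hA θ) x
  refine le_antisymm (h θ x) ?_
  have h2 := h (-θ) (expI A θ x)
  rwa [← mul_apply_eq_comp, expI_neg_mul hA, one_apply_eq_self] at h2

theorem inner_expI_left (θ : ℝ) (x y : E) :
    inner ℂ (expI A θ x) y = inner ℂ x (expI A (-θ) y) := by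
  rw [← star_expI, ContinuousLinearMap.star_eq_adjoint, ContinuousLinearMap.adjoint_inner_right]

theorem continuous_expI_apply (hA : IsSelfAdjoint A) (x : E) :
    Continuous fun θ => expI A θ x := by
  rw [continuous_iff_continuousAt]
  intro θ₀
  exact tendsto_funcCalc hA (isBddBorel_exp θ₀) (C := 1)
    (Eventually.of_forall fun θ => (isBddBorel_exp θ).measurable)
    (Eventually.of_forall fun θ t => (norm_exp_I_mul θ t).le)
    (fun t => Continuous.tendsto (by fun_prop) θ₀) x

theorem norm_exp_I_mul_sub_one_le (θ t : ℝ) :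
    ‖Complex.exp (Complex.I * θ * t) - 1‖ ≤ |θ| * |t| := by
  have := Real.norm_exp_I_mul_ofReal_sub_one_le (x := θ * t)
  rw [Real.norm_eq_abs, abs_mul] at this
  convert this using 4
  push_cast; ring

/-- If `f` and `t f(t)` are bounded, `θ ↦ e^{iθA} f(A) x` is differentiable at `0`, with
derivative `i A f(A) x`. -/
theorem hasDerivAt_expI_funcCalc (hA : IsSelfAdjoint A) {f : ℝ → ℂ} (hf : IsBddBorel f)
    (hg : IsBddBorel fun t : ℝ => (t : ℂ) * f t) (x : E) :
    HasDerivAt (fun θ => expI A θ (funcCalc A f x))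
      (Complex.I • funcCalc A (fun t : ℝ => (t : ℂ) * f t) x) 0 := by
  have hprod : ∀ θ, expI A θ (funcCalc A f x)
      = funcCalc A (fun t : ℝ => Complex.exp (Complex.I * θ * t) * f t) x := fun θ => by
    rw [funcCalc_mul hA (isBddBorel_exp θ) hf]; rfl
  simp only [hprod]
  rw [← smul_apply, ← funcCalc_const_mul hg]
  obtain ⟨C, hC⟩ := hg.bounded
  refine hasDerivAt_funcCalc hA (C := C) (Eventually.of_forall fun θ => (isBddBorel_exp θ).mul hf)
    ((IsBddBorel.const Complex.I).mul hg) (Eventually.of_forall fun θ t => ?_) (fun t => ?_) x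
  · have h1 : Complex.exp (Complex.I * θ * t) * f t - Complex.exp (Complex.I * (0 : ℝ) * t) * f t
        = (Complex.exp (Complex.I * θ * t) - 1) * f t := by simp; ring
    rw [h1, norm_mul, sub_zero]
    have h2 := hC t
    rw [norm_mul, Complex.norm_real, Real.norm_eq_abs] at h2
    calc _ ≤ |θ| * |t| * ‖f t‖ := by gcongr; exact norm_exp_I_mul_sub_one_le θ t
      _ = |θ| * (|t| * ‖f t‖) := by ring
      _ ≤ |θ| * C := by gcongr
      _ = C * |θ| := mul_comm _ _
  · have h1 : HasDerivAt (fun θ : ℝ => Complex.I * θ * t) (Complex.I * t) 0 := by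
      have := ((hasDerivAt_id (0 : ℝ)).ofReal_comp.const_mul Complex.I).mul_const (t : ℂ)
      simpa using this
    have h2 := h1.cexp.mul_const (f t)
    exact h2.congr_deriv (by simp [mul_assoc])

theorem isBddBorel_inv_add_I : IsBddBorel fun t : ℝ => ((t : ℂ) + Complex.I)⁻¹ :=
  ⟨by fun_prop, 1, fun t => by
    rw [norm_inv]; exact inv_le_one_of_one_le₀ (one_le_norm_ofReal_add_I t)⟩

theorem isBddBorel_mul_inv_add_I : IsBddBorel fun t : ℝ => (t : ℂ) * ((t : ℂ) + Complex.I)⁻¹ :=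
  ⟨by fun_prop, 1, fun t => by
    rw [norm_mul, norm_inv, Complex.norm_real, Real.norm_eq_abs, ← div_eq_mul_inv]
    exact div_le_one_of_le₀ (abs_le_norm_ofReal_add_I t) (norm_nonneg _)⟩

theorem cayley_eq (hA : IsSelfAdjoint A) :
    cayley A = 1 - (2 * Complex.I) • funcCalc A fun t => ((t : ℂ) + Complex.I)⁻¹ := by
  have := isStarNormal_cayley hA
  have h1 := (isBorelCalc_one (cayley A)).sub (isBddBorel_inv_add_I.isBorelCalc_funcCalc.const_mul
    (2 * Complex.I)) (.const 1)
    (((IsBddBorel.const (2 * Complex.I)).mul isBddBorel_inv_add_I).comp measurable_cayleyCoord)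
  refine (isBorelCalc_id (cayley A)).unique (h1.congr_ae fun x => ?_)
  filter_upwards [ae_norm_eq_one hA x, ae_ne_one hA x] with w hw hw1
  conv_rhs => rw [← div_cayleyCoord hw hw1]
  have := ofReal_add_I_ne_zero (cayleyCoord w)
  field_simp
  ring

/-- Vectors of the domain are in the range of `(A + i)⁻¹`. -/
theorem exists_eq_funcCalc_of_mem_domain (hA : IsSelfAdjoint A) (ψ : A.domain) :
    ∃ y, (ψ : E) = funcCalc A (fun t => ((t : ℂ) + Complex.I)⁻¹) y ∧
      A ψ = funcCalc A (fun t => (t : ℂ) * ((t : ℂ) + Complex.I)⁻¹) y := by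
  have h1 : funcCalc A (fun t => (t : ℂ) * ((t : ℂ) + Complex.I)⁻¹)
      = 1 - Complex.I • funcCalc A fun t => ((t : ℂ) + Complex.I)⁻¹ := by
    rw [← funcCalc_one hA, ← funcCalc_const_mul isBddBorel_inv_add_I,
      ← funcCalc_sub (.const 1) ((IsBddBorel.const Complex.I).mul isBddBorel_inv_add_I)]
    congr 1 with t
    have := ofReal_add_I_ne_zero t
    field_simp
    ring
  have h2 := isCayley_cayley hA ψ
  set y := A ψ + Complex.I • (ψ : E) with hy
  have h3 : (ψ : E) = funcCalc A (fun t => ((t : ℂ) + Complex.I)⁻¹) y := by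
    rw [cayley_eq hA, sub_apply, one_apply_eq_self, smul_apply] at h2
    have h4 : (2 * Complex.I) • funcCalc A (fun t => ((t : ℂ) + Complex.I)⁻¹) y
        = (2 * Complex.I) • (ψ : E) := by
      rw [show (2 * Complex.I) • (ψ : E) = y - (A ψ - Complex.I • (ψ : E)) by
        rw [hy, mul_smul, two_smul]; abel, ← h2]
      abel
    exact (smul_right_injective E (r := 2 * Complex.I) (by simp) h4).symm
  refine ⟨y, h3, ?_⟩
  rw [h1, sub_apply, one_apply_eq_self, smul_apply, ← h3, hy]
  abel

/-- The generator of `θ ↦ e^{iθA}` on the domain of `A`. -/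
theorem hasDerivAt_expI (hA : IsSelfAdjoint A) (ψ : A.domain) :
    HasDerivAt (fun θ => expI A θ ψ) (Complex.I • A ψ) 0 := by
  obtain ⟨y, h1, h2⟩ := exists_eq_funcCalc_of_mem_domain hA ψ
  rw [h1, h2]
  exact hasDerivAt_expI_funcCalc hA isBddBorel_inv_add_I isBddBorel_mul_inv_add_I y

end FuncCalc

/-! ### Conjugation by the unitary group and commutators -/

section Conjugate

variable {A : E →ₗ.[ℂ] E}

theorem conjugate_apply (B : E →L[ℂ] E) (θ : ℝ) (x : E) :
    conjugate A B θ x = expI A θ (B (expI A (-θ) x)) := rfl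

theorem conjugate_zero (hA : IsSelfAdjoint A) (B : E →L[ℂ] E) : conjugate A B 0 = B := by
  simp [conjugate, expI_zero hA]

theorem conjugate_conjugate (hA : IsSelfAdjoint A) (B : E →L[ℂ] E) (a b : ℝ) :
    conjugate A (conjugate A B a) b = conjugate A B (a + b) := by
  unfold conjugate
  rw [add_comm a b, expI_add hA, neg_add_rev, expI_add hA]
  simp only [mul_assoc]

theorem conjugate_mul (hA : IsSelfAdjoint A) (B C : E →L[ℂ] E) (θ : ℝ) :
    conjugate A (B * C) θ = conjugate A B θ * conjugate A C θ := by
  unfold conjugate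
  calc expI A θ * (B * C) * expI A (-θ) = expI A θ * B * 1 * C * expI A (-θ) := by
        simp only [mul_assoc, one_mul]
    _ = _ := by rw [← expI_neg_mul hA θ]; simp only [mul_assoc]

theorem conjugate_one (hA : IsSelfAdjoint A) (θ : ℝ) : conjugate A 1 θ = 1 := by
  rw [conjugate, mul_one, expI_mul_neg hA]

/-- Conjugation by `e^{iθA}` as a continuous linear map on bounded operators. -/
def conjugateL (A : E →ₗ.[ℂ] E) (θ : ℝ) : (E →L[ℂ] E) →L[ℂ] (E →L[ℂ] E) :=
  ContinuousLinearMap.mulLeftRight ℂ (E →L[ℂ] E) (expI A θ) (expI A (-θ))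

theorem conjugateL_apply (θ : ℝ) (B : E →L[ℂ] E) : conjugateL A θ B = conjugate A B θ := rfl

theorem conjugate_sub (B C : E →L[ℂ] E) (θ : ℝ) :
    conjugate A (B - C) θ = conjugate A B θ - conjugate A C θ :=
  map_sub (conjugateL A θ) B C

theorem conjugate_add (B C : E →L[ℂ] E) (θ : ℝ) :
    conjugate A (B + C) θ = conjugate A B θ + conjugate A C θ :=
  map_add (conjugateL A θ) B C

theorem conjugate_smul (c : ℂ) (B : E →L[ℂ] E) (θ : ℝ) :
    conjugate A (c • B) θ = c • conjugate A B θ :=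
  map_smul (conjugateL A θ) c B

theorem norm_conjugate_le (hA : IsSelfAdjoint A) (B : E →L[ℂ] E) (θ : ℝ) :
    ‖conjugate A B θ‖ ≤ ‖B‖ := by
  have h1 := norm_expI_le hA θ
  have h2 := norm_expI_le hA (-θ)
  calc ‖conjugate A B θ‖ ≤ ‖expI A θ‖ * ‖B‖ * ‖expI A (-θ)‖ :=
        (norm_mul_le _ _).trans (by gcongr; exact norm_mul_le _ _)
    _ ≤ 1 * ‖B‖ * 1 := by gcongr
    _ = ‖B‖ := by ring

theorem star_conjugate (B : E →L[ℂ] E) (θ : ℝ) :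
    star (conjugate A B θ) = conjugate A (star B) θ := by
  simp only [conjugate, star_mul, star_expI, neg_neg, mul_assoc]

theorem inner_conjugate (B : E →L[ℂ] E) (θ : ℝ) (x y : E) :
    inner ℂ x (conjugate A B θ y) = inner ℂ (expI A (-θ) x) (B (expI A (-θ) y)) := by
  rw [inner_expI_left, neg_neg, conjugate_apply]

theorem continuous_conjugate_apply (hA : IsSelfAdjoint A) (B : E →L[ℂ] E) (x : E) :
    Continuous fun θ => conjugate A B θ x := by
  rw [continuous_iff_continuousAt]
  intro θ₀
  rw [ContinuousAt, tendsto_iff_norm_sub_tendsto_zero]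
  have h1 : Tendsto (fun θ => ‖B (expI A (-θ) x) - B (expI A (-θ₀) x)‖) (𝓝 θ₀) (𝓝 0) := by
    rw [← tendsto_iff_norm_sub_tendsto_zero]
    exact (B.continuous.comp ((continuous_expI_apply hA x).comp continuous_neg)).tendsto θ₀
  have h2 : Tendsto (fun θ => ‖expI A θ (B (expI A (-θ₀) x)) - expI A θ₀ (B (expI A (-θ₀) x))‖)
      (𝓝 θ₀) (𝓝 0) := by
    rw [← tendsto_iff_norm_sub_tendsto_zero]
    exact (continuous_expI_apply hA _).tendsto θ₀
  have h3 := h1.add h2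
  rw [add_zero] at h3
  refine squeeze_zero (fun _ => norm_nonneg _) (fun θ => ?_) h3
  rw [conjugate_apply, conjugate_apply]
  refine (norm_sub_le_norm_sub_add_norm_sub _ (expI A θ (B (expI A (-θ₀) x))) _).trans ?_
  rw [← map_sub, norm_expI_apply hA]

/-- The generator of `θ ↦ e^{iθA} R e^{-iθA}`, for `R` of class `C^1(A)`, is `i ad_A(R)`. -/
theorem ClassC.hasDerivAt (hA : IsSelfAdjoint A) {R : E →L[ℂ] E} (hR : ClassC A 1 R) (x : E) :
    HasDerivAt (fun θ => conjugate A R θ x) ((Complex.I • ad A R) x) 0 := by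
  have hd : ∀ x, HasDerivAt (fun θ => conjugate A R θ x)
      (deriv (fun θ => conjugate A R θ x) 0) 0 := fun x =>
    ((hR x).differentiable (by simp)).differentiableAt.hasDerivAt
  let S : ℝ → E →L[ℂ] E := fun θ => ((θ⁻¹ : ℝ) : ℂ) • (conjugate A R θ - R)
  have hS : Tendsto (fun θ x => S θ x) (𝓝[≠] 0)
      (𝓝 fun x => deriv (fun θ => conjugate A R θ x) 0) := by
    rw [tendsto_pi_nhds]
    intro x
    refine (hasDerivAt_iff_tendsto_slope.1 (hd x)).congr fun θ => ?_
    rw [slope_def_module, conjugate_zero hA]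
    simp only [S]
    rw [smul_apply, sub_apply, Complex.coe_smul, sub_zero]
  let D : E →L[ℂ] E := continuousLinearMapOfTendsto S hS
  have hD : ∀ x, HasDerivAt (fun θ => conjugate A R θ x) (D x) 0 := hd
  have hc : IsCommutator A R (-Complex.I • D) := by
    intro φ ψ
    have h1 : HasDerivAt (fun θ => inner ℂ (φ : E) (conjugate A R θ ψ)) (inner ℂ (φ : E) (D ψ)) 0 :=
      (innerSL ℂ (φ : E)).restrictScalars ℝ |>.hasFDerivAt.comp_hasDerivAt _ (hD ψ)
    have hneg : ∀ χ : A.domain, HasDerivAt (fun θ => expI A (-θ) χ) (-(Complex.I • A χ)) 0 := by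
      intro χ
      have h := hasDerivAt_expI hA χ
      rw [← neg_zero] at h
      exact (h.scomp 0 (hasDerivAt_neg (0 : ℝ))).congr_deriv (by simp)
    have h2 : HasDerivAt (fun θ => R (expI A (-θ) ψ)) (R (-(Complex.I • A ψ))) 0 :=
      (R.restrictScalars ℝ).hasFDerivAt.comp_hasDerivAt _ (hneg ψ)
    have h3 := (hneg φ).inner ℂ h2
    simp only [← inner_conjugate] at h3
    have h4 := h1.unique h3
    simp only [neg_zero, expI_zero hA, one_apply_eq_self, map_neg, map_smul, inner_neg_right,
      inner_neg_left, inner_smul_left, inner_smul_right, Complex.conj_I] at h4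
    rw [smul_apply, inner_smul_right, h4]
    ring_nf
    simp
  rw [hc.ad_eq hA]
  simpa [smul_smul] using hD x

theorem ClassC.hasDerivAt_conjugate (hA : IsSelfAdjoint A) {R : E →L[ℂ] E} (hR : ClassC A 1 R)
    (x : E) (θ : ℝ) :
    HasDerivAt (fun θ => conjugate A R θ x) (conjugate A (Complex.I • ad A R) θ x) θ := by
  have h1 := hR.hasDerivAt hA (expI A (-θ) x)
  have h2 : HasDerivAt (fun h => conjugate A R (θ + h) x)
      (conjugate A (Complex.I • ad A R) θ x) 0 := by
    have := ((expI A θ).restrictScalars ℝ).hasFDerivAt.comp_hasDerivAt _ h1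
    refine this.congr_of_eventuallyEq (Eventually.of_forall fun h => ?_)
    simp only [Function.comp_def, ContinuousLinearMap.coe_restrictScalars']
    rw [add_comm, ← conjugate_conjugate hA]
    rfl
  have h3 := HasDerivAt.comp_sub_const θ θ (f := fun h => conjugate A R (θ + h) x)
    (by rwa [sub_self])
  simpa using h3

end Conjugate

/-! ### Smoothed weights -/

/-- The symbol `⟨t⟩^{-s} (1 + ε |t|)⁻¹` of the smoothed weight. -/
def weightSymbol (s ε t : ℝ) : ℝ := Real.sqrt (1 + t ^ 2) ^ (-s) / (1 + ε * |t|)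

/-- The smoothed weight `⟨A⟩^{-s} (1 + ε |A|)⁻¹`. -/
def smoothedWeight (A : E →ₗ.[ℂ] E) (s ε : ℝ) : E →L[ℂ] E :=
  funcCalc A fun t => (weightSymbol s ε t : ℂ)

section Weight

variable {s : ℝ}

theorem one_le_sqrt (t : ℝ) : 1 ≤ Real.sqrt (1 + t ^ 2) :=
  Real.one_le_sqrt.2 (by nlinarith [sq_nonneg t])

theorem abs_le_sqrt (t : ℝ) : |t| ≤ Real.sqrt (1 + t ^ 2) :=
  Real.abs_le_sqrt (by linarith)

theorem measurable_weightSymbol (s ε : ℝ) : Measurable (weightSymbol s ε) := by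
  unfold weightSymbol
  fun_prop

theorem weightSymbol_nonneg (s : ℝ) {ε : ℝ} (hε : 0 ≤ ε) (t : ℝ) : 0 ≤ weightSymbol s ε t := by
  unfold weightSymbol
  positivity

theorem sqrt_rpow_neg_le_one (hs : 0 ≤ s) (t : ℝ) : Real.sqrt (1 + t ^ 2) ^ (-s) ≤ 1 :=
  Real.rpow_le_one_of_one_le_of_nonpos (one_le_sqrt t) (by linarith)

theorem weightSymbol_le_one (hs : 0 ≤ s) {ε : ℝ} (hε : 0 ≤ ε) (t : ℝ) :
    weightSymbol s ε t ≤ 1 := by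
  unfold weightSymbol
  have := sqrt_rpow_neg_le_one hs t
  have h2 : 0 ≤ ε * |t| := by positivity
  rw [div_le_one (by positivity)]
  linarith

/-- The gain of the smoothing: `|t| ⟨t⟩^{-s} (1 + ε |t|)⁻¹ ≤ ε^{p - 1}` for `p ≤ s`, `p ≤ 1`. -/
theorem abs_mul_weightSymbol_le {p ε : ℝ} (hp0 : 0 ≤ p) (hp1 : p ≤ 1) (hps : p ≤ s) (hε : 0 < ε)
    (t : ℝ) : |t| * weightSymbol s ε t ≤ ε ^ (p - 1) := by
  have hx : 0 < ε * |t| ∨ t = 0 := by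
    rcases eq_or_ne t 0 with h | h
    · exact Or.inr h
    · exact Or.inl (mul_pos hε (abs_pos.2 h))
  rcases hx with hx | rfl
  swap
  · simp; positivity
  have ht : 0 < |t| := pos_of_mul_pos_right hx hε.le
  unfold weightSymbol
  have h1 : Real.sqrt (1 + t ^ 2) ^ (-s) ≤ |t| ^ (-p) :=
    calc Real.sqrt (1 + t ^ 2) ^ (-s) ≤ Real.sqrt (1 + t ^ 2) ^ (-p) :=
          Real.rpow_le_rpow_of_exponent_le (one_le_sqrt t) (by linarith)
      _ ≤ |t| ^ (-p) := Real.rpow_le_rpow_of_nonpos ht (abs_le_sqrt t) (by linarith)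
  have h2 : (ε * |t|) ^ (1 - p) ≤ 1 + ε * |t| := by
    rcases le_total (ε * |t|) 1 with h | h
    · have := Real.rpow_le_one hx.le h (by linarith : 0 ≤ 1 - p)
      linarith
    · have := Real.rpow_le_rpow_of_exponent_le h (by linarith : 1 - p ≤ 1)
      rw [Real.rpow_one] at this
      linarith
  rw [mul_div_assoc', div_le_iff₀ (by positivity)]
  calc |t| * Real.sqrt (1 + t ^ 2) ^ (-s) ≤ |t| * |t| ^ (-p) := by gcongr
    _ = ε ^ (p - 1) * (ε * |t|) ^ (1 - p) := by
        rw [Real.mul_rpow hε.le ht.le, ← mul_assoc, ← Real.rpow_add hε]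
        simp only [sub_add_sub_cancel, sub_self, Real.rpow_zero, one_mul]
        rw [sub_eq_add_neg, Real.rpow_add ht, Real.rpow_one]
    _ ≤ ε ^ (p - 1) * (1 + ε * |t|) := by gcongr

theorem isBddBorel_weightSymbol (hs : 0 ≤ s) {ε : ℝ} (hε : 0 ≤ ε) :
    IsBddBorel fun t => (weightSymbol s ε t : ℂ) :=
  ⟨Complex.measurable_ofReal.comp (measurable_weightSymbol s ε), 1, fun t => by
    rw [Complex.norm_real, Real.norm_of_nonneg (weightSymbol_nonneg s hε t)]
    exact weightSymbol_le_one hs hε t⟩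

variable {A : E →ₗ.[ℂ] E}

theorem weight_eq_smoothedWeight (s : ℝ) : weight A s = smoothedWeight A s 0 := by
  simp [weight, smoothedWeight, weightSymbol]

theorem norm_smoothedWeight_le (hA : IsSelfAdjoint A) (hs : 0 ≤ s) {ε : ℝ} (hε : 0 ≤ ε) :
    ‖smoothedWeight A s ε‖ ≤ 1 := by
  refine norm_funcCalc_le hA (isBddBorel_weightSymbol hs hε).measurable zero_le_one fun t => ?_
  rw [Complex.norm_real, Real.norm_of_nonneg (weightSymbol_nonneg s hε t)]
  exact weightSymbol_le_one hs hε t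

theorem star_weight (hs : 0 ≤ s) : star (weight A s) = weight A s := by
  rw [weight_eq_smoothedWeight, smoothedWeight, ← funcCalc_conj (isBddBorel_weightSymbol hs le_rfl)]
  simp

theorem tendsto_smoothedWeight (hA : IsSelfAdjoint A) (hs : 0 ≤ s) (x : E) :
    Tendsto (fun ε => smoothedWeight A s ε x) (𝓝[>] 0) (𝓝 (weight A s x)) := by
  rw [weight_eq_smoothedWeight]
  refine tendsto_funcCalc hA (isBddBorel_weightSymbol hs le_rfl) (C := 1) ?_ ?_ (fun t => ?_) x
  · filter_upwards [self_mem_nhdsWithin] with ε hε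
    exact (isBddBorel_weightSymbol hs (le_of_lt hε)).measurable
  · filter_upwards [self_mem_nhdsWithin] with ε hε t
    have hε' : 0 ≤ ε := le_of_lt hε
    rw [Complex.norm_real, Real.norm_of_nonneg (weightSymbol_nonneg s hε' t)]
    exact weightSymbol_le_one hs hε' t
  · refine tendsto_nhdsWithin_of_tendsto_nhds ?_
    refine (Complex.continuous_ofReal.tendsto _).comp ?_
    unfold weightSymbol
    refine ContinuousAt.tendsto (f := fun ε : ℝ => Real.sqrt (1 + t ^ 2) ^ (-s) / (1 + ε * |t|)) ?_
    exact ContinuousAt.div (by fun_prop) (by fun_prop) (by simp)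

theorem isBddBorel_mul_weightSymbol {p ε : ℝ} (hp0 : 0 ≤ p) (hp1 : p ≤ 1) (hps : p ≤ s)
    (hε : 0 < ε) : IsBddBorel fun t : ℝ => (t : ℂ) * (weightSymbol s ε t : ℂ) :=
  ⟨Complex.measurable_ofReal.mul (Complex.measurable_ofReal.comp (measurable_weightSymbol s ε)),
    ε ^ (p - 1), fun t => by
      rw [norm_mul, Complex.norm_real, Complex.norm_real,
        Real.norm_of_nonneg (weightSymbol_nonneg s hε.le t), Real.norm_eq_abs]
      exact abs_mul_weightSymbol_le hp0 hp1 hps hε t⟩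

/-- The vector `A ⟨A⟩^{-s} (1 + ε |A|)⁻¹ x`. -/
theorem exists_hasDerivAt_expI_smoothedWeight (hA : IsSelfAdjoint A) {p ε : ℝ} (hp0 : 0 ≤ p)
    (hp1 : p ≤ 1) (hps : p ≤ s) (hε : 0 < ε) (x : E) :
    ∃ v, HasDerivAt (fun θ => expI A (-θ) (smoothedWeight A s ε x)) (-(Complex.I • v)) 0 ∧
      ‖v‖ ≤ ε ^ (p - 1) * ‖x‖ := by
  have hb := isBddBorel_mul_weightSymbol hp0 hp1 hps hε
  refine ⟨funcCalc A (fun t : ℝ => (t : ℂ) * (weightSymbol s ε t : ℂ)) x, ?_, ?_⟩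
  · have h := hasDerivAt_expI_funcCalc hA
      (isBddBorel_weightSymbol (s := s) (hp0.trans hps) hε.le) hb x
    rw [← neg_zero] at h
    exact (h.scomp 0 (hasDerivAt_neg (0 : ℝ))).congr_deriv (by simp)
  · refine ContinuousLinearMap.le_of_opNorm_le _ (norm_funcCalc_le hA hb.measurable
      (by positivity) fun t => ?_) x
    rw [norm_mul, Complex.norm_real, Complex.norm_real,
      Real.norm_of_nonneg (weightSymbol_nonneg s hε.le t), Real.norm_eq_abs]
    exact abs_mul_weightSymbol_le hp0 hp1 hps hε t

theorem exists_hasDerivAt_smoothedWeight (hA : IsSelfAdjoint A) {p ε : ℝ} (hp0 : 0 ≤ p)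
    (hp1 : p ≤ 1) (hps : p ≤ s) (hε : 0 < ε) (x : E) :
    ∃ u', HasDerivAt (fun ε => smoothedWeight A s ε x) u' ε ∧ ‖u'‖ ≤ ε ^ (p - 1) * ‖x‖ := by
  have hs : 0 ≤ s := hp0.trans hps
  let f : ℝ → ℝ := fun t => -(|t| * weightSymbol s ε t) / (1 + ε * |t|)
  have hfm : Measurable f := by
    have := measurable_weightSymbol s ε
    fun_prop
  have hfb : ∀ t, ‖((f t : ℝ) : ℂ)‖ ≤ ε ^ (p - 1) := fun t => by
    have h1 : 0 ≤ |t| * weightSymbol s ε t :=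
      mul_nonneg (abs_nonneg t) (weightSymbol_nonneg s hε.le t)
    have h2 : 1 ≤ 1 + ε * |t| := by
      have : 0 ≤ ε * |t| := by positivity
      linarith
    rw [Complex.norm_real, Real.norm_eq_abs, abs_div, abs_neg, abs_of_nonneg h1,
      abs_of_nonneg (zero_le_one.trans h2)]
    exact (div_le_self h1 h2).trans (abs_mul_weightSymbol_le hp0 hp1 hps hε t)
  refine ⟨funcCalc A (fun t => (f t : ℂ)) x, ?_, ?_⟩
  · refine hasDerivAt_funcCalc hA (C := ε⁻¹) ?_ ⟨Complex.measurable_ofReal.comp hfm, _, hfb⟩ ?_ ?_ x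
    · filter_upwards [eventually_gt_nhds hε] with η hη using isBddBorel_weightSymbol hs hη.le
    · filter_upwards [eventually_gt_nhds hε] with η hη t
      have hw := sqrt_rpow_neg_le_one hs t
      have hw0 : 0 ≤ Real.sqrt (1 + t ^ 2) ^ (-s) := by positivity
      have h0 : 0 ≤ |t| := abs_nonneg t
      have h1 : 0 < 1 + ε * |t| := by positivity
      have h2 : 0 < 1 + η * |t| := by positivity
      have e : weightSymbol s η t - weightSymbol s ε t
          = (Real.sqrt (1 + t ^ 2) ^ (-s) / (1 + η * |t|)) * (|t| / (1 + ε * |t|)) * (ε - η) := by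
        unfold weightSymbol; field_simp; ring
      rw [← Complex.ofReal_sub, Complex.norm_real, e, Real.norm_eq_abs, abs_mul, abs_sub_comm,
        abs_of_nonneg (by positivity)]
      gcongr
      have h3 : Real.sqrt (1 + t ^ 2) ^ (-s) / (1 + η * |t|) ≤ 1 := weightSymbol_le_one hs hη.le t
      have h4 : |t| / (1 + ε * |t|) ≤ ε⁻¹ := by
        rw [div_le_iff₀ h1]
        have : ε⁻¹ * (1 + ε * |t|) = ε⁻¹ + |t| := by field_simp
        rw [this]
        have : 0 < ε⁻¹ := by positivity
        linarith
      calc _ ≤ 1 * ε⁻¹ := by gcongr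
        _ = ε⁻¹ := one_mul _
    · intro t
      have h1 : 1 + ε * |t| ≠ 0 := by positivity
      have h2 : HasDerivAt (fun η => weightSymbol s η t) (f t) ε := by
        have h3 := ((hasDerivAt_id ε).mul_const |t|).const_add 1
        have h4 := (hasDerivAt_const ε (Real.sqrt (1 + t ^ 2) ^ (-s))).div h3 h1
        refine h4.congr_deriv ?_
        simp only [f, weightSymbol, id]
        field_simp
        ring
      exact h2.ofReal_comp
  · exact ContinuousLinearMap.le_of_opNorm_le _ (norm_funcCalc_le hA
      (Complex.measurable_ofReal.comp hfm) (by positivity) hfb) x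

end Weight

/-! ### Averages of a Banach space valued function against an odd kernel -/

section Kernel

/-- The kernels used for the regularization: odd functions `ψ`, nonnegative on the half line,
supported in `[-1, 1]`, with first moment one. -/
structure IsOddKernel (ψ : ℝ → ℝ) : Prop where
  contDiff : ContDiff ℝ 1 ψ
  odd : ∀ t, ψ (-t) = -ψ t
  nonneg : ∀ t, 0 ≤ t → 0 ≤ ψ t
  eq_zero : ∀ t, 1 < |t| → ψ t = 0
  integral_mul : ∫ t, t * ψ t = 1

theorem exists_isOddKernel : ∃ ψ, IsOddKernel ψ := by
  let χ : ContDiffBump (0 : ℝ) := ⟨1 / 2, 1, by norm_num, by norm_num⟩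
  have hχ0 : ∀ t : ℝ, 1 < |t| → χ t = 0 := fun t ht =>
    χ.zero_of_le_dist (by simpa [χ] using ht.le)
  have hc : Continuous fun t : ℝ => t * (t * χ t) := by
    have := χ.continuous
    fun_prop
  have hsupp : HasCompactSupport fun t : ℝ => t * (t * χ t) :=
    HasCompactSupport.intro (isCompact_Icc (a := (-1 : ℝ)) (b := 1)) fun t ht => by
      rw [hχ0 t (by rw [mem_Icc, ← abs_le] at ht; exact not_le.1 ht)]
      simp
  have hpos : 0 < ∫ t : ℝ, t * (t * χ t) := by
    refine hc.integral_pos_of_hasCompactSupport_nonneg_nonzero hsupp (fun t => ?_) (x := 1 / 2) ?_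
    · have := χ.nonneg (x := t)
      have h2 : t * (t * χ t) = t ^ 2 * χ t := by ring
      simp only [h2, Pi.zero_apply]
      positivity
    · have : χ (1 / 2 : ℝ) = 1 := χ.one_of_mem_closedBall (by simp [χ])
      rw [this]
      norm_num
  refine ⟨fun t => (∫ t : ℝ, t * (t * χ t))⁻¹ * (t * χ t), ?_, ?_, ?_, ?_, ?_⟩
  · exact contDiff_const.mul (contDiff_id.mul χ.contDiff)
  · intro t
    simp only [χ.neg]
    ring
  · intro t ht
    have := χ.nonneg (x := t)
    positivity
  · intro t ht
    simp [hχ0 t ht]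
  · have : ∀ t : ℝ, t * ((∫ t : ℝ, t * (t * χ t))⁻¹ * (t * χ t))
        = (∫ t : ℝ, t * (t * χ t))⁻¹ * (t * (t * χ t)) := fun t => by ring
    simp only [this]
    rw [integral_const_mul, inv_mul_cancel₀ hpos.ne']

/-- A continuous function that vanishes outside of `[-1, 1]` is bounded. -/
theorem exists_bound_of_eq_zero {F : Type*} [NormedAddCommGroup F] {k : ℝ → F}
    (hk : Continuous k) (h0 : ∀ t, 1 < |t| → k t = 0) : ∃ M, 0 ≤ M ∧ ∀ t, ‖k t‖ ≤ M := by
  have hsupp : HasCompactSupport k :=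
    HasCompactSupport.intro (isCompact_Icc (a := (-1 : ℝ)) (b := 1)) fun t ht =>
      h0 t (by rw [mem_Icc, ← abs_le] at ht; exact not_le.1 ht)
  obtain ⟨M, hM⟩ := hk.bounded_above_of_compact_support hsupp
  exact ⟨M, (norm_nonneg _).trans (hM 0), hM⟩

theorem deriv_eq_zero_of_eq_zero {F : Type*} [NormedAddCommGroup F] [NormedSpace ℝ F] {k : ℝ → F}
    (h0 : ∀ t, 1 < |t| → k t = 0) (t : ℝ) (ht : 1 < |t|) : deriv k t = 0 := by
  have : k =ᶠ[𝓝 t] fun _ => 0 := by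
    filter_upwards [(continuous_abs.tendsto t).eventually (lt_mem_nhds ht)] with u hu using h0 u hu
  rw [this.deriv_eq, deriv_const]

variable {F : Type*} [NormedAddCommGroup F] [NormedSpace ℂ F]

theorem integrable_kernel_smul {k : ℝ → ℂ} {W : ℝ → F} (hk : Continuous k) (hW : Continuous W)
    {ρ : ℝ} (h0 : ∀ t, ρ < |t| → k t = 0) : Integrable fun t => k t • W t := by
  refine (hk.smul hW).integrable_of_hasCompactSupport
    (HasCompactSupport.intro (isCompact_Icc (a := -ρ) (b := ρ)) fun t ht => ?_)
  change k t • W t = 0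
  rw [h0 t (by rw [mem_Icc, ← abs_le] at ht; exact not_le.1 ht), zero_smul]

/-- Only the symmetric second difference of `W` enters an average with an even kernel. -/
theorem norm_integral_even_smul_sub_le [CompleteSpace F] {k : ℝ → ℂ} {W : ℝ → F}
    (hk : Continuous k)
    (hW : Continuous W) (h0 : ∀ t, 1 < |t| → k t = 0) (heven : ∀ t, k (-t) = k t) {M : ℝ}
    (hM : ∀ t, ‖k t‖ ≤ M) {ε : ℝ} (hε : 0 < ε) :
    ‖(∫ t, k t • W (ε * t)) - (∫ t, k t) • W 0‖
      ≤ M * ε⁻¹ * ∫ τ in (0 : ℝ)..ε, ‖W τ + W (-τ) - (2 : ℂ) • W 0‖ := by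
  have hM0 : 0 ≤ M := (norm_nonneg _).trans (hM 0)
  set D : ℝ → F := fun τ => W τ + W (-τ) - (2 : ℂ) • W 0 with hD
  have hDc : Continuous D := by fun_prop
  have hDneg : ∀ τ, D (-τ) = D τ := fun τ => by simp only [hD, neg_neg]; abel
  have i1 : Integrable fun t => k t • W (ε * t) :=
    integrable_kernel_smul hk (hW.comp (continuous_const_mul ε)) h0
  have i2 : Integrable fun t => k t • W (-(ε * t)) :=
    integrable_kernel_smul hk (hW.comp (continuous_const_mul ε).neg) h0
  have i3 : Integrable fun t => k t • ((2 : ℂ) • W 0) :=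
    integrable_kernel_smul hk continuous_const h0
  have hsym : ∫ t, k t • W (-(ε * t)) = ∫ t, k t • W (ε * t) := by
    rw [← integral_neg_eq_self]
    simp [heven]
  have e1 : (2 : ℂ) • ((∫ t, k t • W (ε * t)) - (∫ t, k t) • W 0)
      = ∫ t, k t • D (ε * t) := by
    have : ∀ t, k t • D (ε * t) = k t • W (ε * t) + k t • W (-(ε * t)) - k t • ((2 : ℂ) • W 0) :=
      fun t => by simp only [hD, smul_sub, smul_add]
    simp only [this]
    rw [integral_sub (by exact i1.add i2) i3, integral_add i1 i2, hsym, integral_smul_const,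
      smul_sub, two_smul, smul_comm]
  have e2 : ‖∫ t, k t • D (ε * t)‖ ≤ ∫ t in (-1 : ℝ)..1, M * ‖D (ε * t)‖ := by
    have hs : ∫ t, k t • D (ε * t) = ∫ t in (-1 : ℝ)..1, k t • D (ε * t) := by
      rw [intervalIntegral.integral_of_le (by norm_num), ← integral_Icc_eq_integral_Ioc,
        setIntegral_eq_integral_of_forall_compl_eq_zero]
      intro t ht
      rw [h0 t (by rw [mem_Icc, ← abs_le] at ht; exact not_le.1 ht), zero_smul]
    rw [hs]
    refine intervalIntegral.norm_integral_le_of_norm_le (by norm_num)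
      (Eventually.of_forall fun t _ => ?_) (Continuous.intervalIntegrable (by fun_prop) _ _)
    rw [norm_smul]
    gcongr
    exact hM t
  have e3 : ∫ t in (-1 : ℝ)..1, M * ‖D (ε * t)‖ = 2 * (M * ε⁻¹ * ∫ τ in (0 : ℝ)..ε, ‖D τ‖) := by
    have hc : Continuous fun t => ‖D (ε * t)‖ := by fun_prop
    rw [intervalIntegral.integral_const_mul, ← intervalIntegral.integral_add_adjacent_intervals
      (b := 0) (hc.intervalIntegrable _ _) (hc.intervalIntegrable _ _)]
    have h1 : ∫ t in (-1 : ℝ)..0, ‖D (ε * t)‖ = ∫ t in (0 : ℝ)..1, ‖D (ε * t)‖ := by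
      have := intervalIntegral.integral_comp_neg (a := 0) (b := 1) fun t => ‖D (ε * t)‖
      rw [neg_zero] at this
      rw [← this]
      simp only [mul_neg, hDneg]
    have h2 : ∫ t in (0 : ℝ)..1, ‖D (ε * t)‖ = ε⁻¹ * ∫ τ in (0 : ℝ)..ε, ‖D τ‖ := by
      rw [intervalIntegral.integral_comp_mul_left (fun τ => ‖D τ‖) hε.ne']
      simp
    rw [h1, h2]
    ring
  have e4 := congrArg norm e1
  rw [norm_smul, Complex.norm_ofNat] at e4
  rw [e3, ← e4] at e2
  linarith

/-- Differentiation under the integral sign, for kernels of locally uniformly compact support. -/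
theorem hasDerivAt_integral_kernel [CompleteSpace F] {W : ℝ → F} (hW : Continuous W) {C : ℝ}
    (hC : ∀ τ, ‖W τ‖ ≤ C) {k k' : ℝ → ℝ → ℂ} {x₀ δ ρ M : ℝ} (hδ : 0 < δ)
    (hk : ∀ x ∈ Metric.ball x₀ δ, Continuous (k x))
    (hk0 : ∀ τ, ρ < |τ| → k x₀ τ = 0) (hk' : Continuous (k' x₀))
    (hk'0 : ∀ x ∈ Metric.ball x₀ δ, ∀ τ, ρ < |τ| → k' x τ = 0)
    (hM : ∀ x ∈ Metric.ball x₀ δ, ∀ τ, ‖k' x τ‖ ≤ M)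
    (hd : ∀ x ∈ Metric.ball x₀ δ, ∀ τ, HasDerivAt (fun x => k x τ) (k' x τ) x) :
    HasDerivAt (fun x => ∫ τ, k x τ • W τ) (∫ τ, k' x₀ τ • W τ) x₀ := by
  have hC0 : 0 ≤ C := (norm_nonneg _).trans (hC 0)
  refine (hasDerivAt_integral_of_dominated_loc_of_deriv_le (F := fun x τ => k x τ • W τ)
    (F' := fun x τ => k' x τ • W τ) (s := Metric.ball x₀ δ)
    (bound := (Icc (-ρ) ρ).indicator fun _ => M * C) (Metric.ball_mem_nhds x₀ hδ) ?_
    (integrable_kernel_smul (hk x₀ (Metric.mem_ball_self hδ)) hW hk0)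
    (hk'.smul hW).aestronglyMeasurable (Eventually.of_forall fun τ x hx => ?_) ?_
    (Eventually.of_forall fun τ x hx => (hd x hx τ).smul_const (W τ))).2
  · filter_upwards [Metric.ball_mem_nhds x₀ hδ] with x hx
    exact ((hk x hx).smul hW).aestronglyMeasurable
  · by_cases hτ : τ ∈ Icc (-ρ) ρ
    · rw [indicator_of_mem hτ, norm_smul]
      have := (norm_nonneg _).trans (hM x hx τ)
      gcongr
      · exact hM x hx τ
      · exact hC τ
    · rw [indicator_of_notMem hτ,
        hk'0 x hx τ (by rw [mem_Icc, ← abs_le] at hτ; exact not_le.1 hτ), zero_smul, norm_zero]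
  · exact (integrable_indicator_iff measurableSet_Icc).2
      (continuous_const.integrableOn_Icc)

/-- The complex kernel `φ(t) = (t - i) ψ(t)`. It satisfies `∫ φ = 1` and `∫ t φ = -i`, and
`(t + i) φ(t)` is odd. -/
def cKernel (ψ : ℝ → ℝ) (t : ℝ) : ℂ := ((t : ℂ) - Complex.I) * (ψ t : ℂ)

/-- The regularization `∫ φ(t) W(ε t) dt` of `W` at `0`, where `φ` is `cKernel ψ`. For
`W(θ) = e^{iθA} H e^{-iθA}` it imitates `e^{εA} H e^{-εA}`. -/
def regularize (ψ : ℝ → ℝ) (W : ℝ → F) (ε : ℝ) : F := ∫ t, cKernel ψ t • W (ε * t)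

namespace IsOddKernel

variable {ψ : ℝ → ℝ}

theorem contDiff_cKernel (hψ : IsOddKernel ψ) : ContDiff ℝ 1 (cKernel ψ) := by
  have := hψ.contDiff
  unfold cKernel
  exact (Complex.ofRealCLM.contDiff.sub contDiff_const).mul (Complex.ofRealCLM.contDiff.comp this)

theorem cKernel_eq_zero (hψ : IsOddKernel ψ) (t : ℝ) (ht : 1 < |t|) : cKernel ψ t = 0 := by
  simp [cKernel, hψ.eq_zero t ht]

theorem integrable_mul (hψ : IsOddKernel ψ) : Integrable fun t : ℝ => (t : ℂ) * (ψ t : ℂ) := by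
  have h2 : ∀ t, 1 < |t| → (ψ t : ℂ) = 0 := fun t ht => by simp [hψ.eq_zero t ht]
  have := integrable_kernel_smul (k := fun t => (ψ t : ℂ)) (W := fun t : ℝ => (t : ℂ))
    (Complex.continuous_ofReal.comp hψ.contDiff.continuous) Complex.continuous_ofReal h2
  refine this.congr (Eventually.of_forall fun t => ?_)
  simp [mul_comm]

theorem integral_ofReal_mul (hψ : IsOddKernel ψ) : ∫ t : ℝ, (t : ℂ) * (ψ t : ℂ) = 1 := by
  have := hψ.integral_mul
  rw [← Complex.ofReal_inj, ← integral_complex_ofReal] at this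
  simpa using this

theorem integral_ofReal (hψ : IsOddKernel ψ) : ∫ t, (ψ t : ℂ) = 0 := by
  have h := integral_neg_eq_self (fun t => (ψ t : ℂ)) volume
  simp only [hψ.odd, Complex.ofReal_neg, integral_neg] at h
  exact self_eq_neg.1 h.symm

theorem integral_cKernel (hψ : IsOddKernel ψ) : ∫ t, cKernel ψ t = 1 := by
  have h2 : ∀ t, 1 < |t| → (ψ t : ℂ) = 0 := fun t ht => by simp [hψ.eq_zero t ht]
  have hc : Continuous fun t => (ψ t : ℂ) := Complex.continuous_ofReal.comp hψ.contDiff.continuous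
  have hi : Integrable fun t => Complex.I * (ψ t : ℂ) := by
    have := integrable_kernel_smul (W := fun _ => Complex.I) hc continuous_const h2
    simpa [mul_comm] using this
  simp only [cKernel, sub_mul]
  rw [integral_sub hψ.integrable_mul hi, integral_const_mul, hψ.integral_ofReal_mul,
    hψ.integral_ofReal]
  simp

variable {W : ℝ → F}

/-- The regularization converges to the value at `0`. -/
theorem tendsto_regularize [CompleteSpace F] (hψ : IsOddKernel ψ) (hW : Continuous W) {C : ℝ}
    (hC : ∀ τ, ‖W τ‖ ≤ C) : Tendsto (regularize ψ W) (𝓝 0) (𝓝 (W 0)) := by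
  have hφ := hψ.contDiff_cKernel.continuous
  have h1 : Tendsto (fun ε => ∫ t, cKernel ψ t • W (ε * t)) (𝓝 0)
      (𝓝 (∫ t, cKernel ψ t • W 0)) := by
    refine tendsto_integral_filter_of_dominated_convergence (fun t => ‖cKernel ψ t‖ * C) ?_ ?_ ?_ ?_
    · exact Eventually.of_forall fun ε =>
        (hφ.smul (hW.comp (continuous_const_mul ε))).aestronglyMeasurable
    · refine Eventually.of_forall fun ε => Eventually.of_forall fun t => ?_
      rw [norm_smul]
      gcongr
      exact hC _
    · have := integrable_kernel_smul (W := fun _ => (1 : ℂ)) hφ continuous_const hψ.cKernel_eq_zero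
      simp only [smul_eq_mul, mul_one] at this
      exact this.norm.mul_const C
    · refine Eventually.of_forall fun t => ?_
      have : Continuous fun ε => cKernel ψ t • W (ε * t) := by fun_prop
      simpa using this.tendsto 0
  rw [integral_smul_const, hψ.integral_cKernel, one_smul] at h1
  exact h1

theorem regularize_eq (W : ℝ → F) {ε : ℝ} (hε : 0 < ε) (θ : ℝ) :
    regularize ψ (fun τ => W (τ + θ)) ε
      = ∫ τ, (((ε⁻¹ : ℝ) : ℂ) * cKernel ψ ((τ - θ) / ε)) • W τ := by
  rw [← integral_add_right_eq_self _ θ]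
  have := Measure.integral_comp_mul_left (fun τ => cKernel ψ (τ / ε) • W (τ + θ)) ε
  simp only [mul_div_cancel_left₀ _ hε.ne'] at this
  rw [regularize, this, abs_of_pos (inv_pos.2 hε), ← integral_smul]
  congr 1 with τ
  rw [add_sub_cancel_right, mul_smul, Complex.coe_smul]

/-- The regularization `K_ε` solves `∂_ε K_ε + i ∂_θ K_ε = O(second differences)`, where `∂_θ` is
the derivative under translations of `W`. The left side is an integral of `W` against the
derivative of the odd function `(t + i) φ(t)`. -/
theorem exists_hasDerivAt_regularize [CompleteSpace F] (hψ : IsOddKernel ψ) : ∃ M, 0 ≤ M ∧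
    ∀ W : ℝ → F, Continuous W → (∃ C, ∀ τ, ‖W τ‖ ≤ C) → ∀ ε : ℝ, 0 < ε → ∃ K' L : F,
      HasDerivAt (regularize ψ W) K' ε ∧
      HasDerivAt (fun θ => regularize ψ (fun τ => W (τ + θ)) ε) L 0 ∧
      ‖K' + Complex.I • L‖
        ≤ M * (ε ^ 2)⁻¹ * ∫ τ in (0 : ℝ)..ε, ‖W τ + W (-τ) - (2 : ℂ) • W 0‖ := by
  have hφ := hψ.contDiff_cKernel
  have hφd : ∀ t, HasDerivAt (cKernel ψ) (deriv (cKernel ψ) t) t := fun t =>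
    (hφ.differentiable (by simp)).differentiableAt.hasDerivAt
  have hφ'c : Continuous (deriv (cKernel ψ)) := hφ.continuous_deriv le_rfl
  have hφ'0 := deriv_eq_zero_of_eq_zero hψ.cKernel_eq_zero
  obtain ⟨M₀, hM₀, hb₀⟩ := exists_bound_of_eq_zero hφ.continuous hψ.cKernel_eq_zero
  obtain ⟨M₁, hM₁, hb₁⟩ := exists_bound_of_eq_zero hφ'c hφ'0
  -- the odd function `g(t) = (t + i) φ(t)`, and its even derivative
  let g : ℝ → ℂ := fun t => ((t : ℂ) ^ 2 + 1) * (ψ t : ℂ)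
  have hg : ∀ t, g t = ((t : ℂ) + Complex.I) * cKernel ψ t := fun t => by
    simp only [g, cKernel]
    linear_combination (ψ t : ℂ) * Complex.I_sq
  have hgC : ContDiff ℝ 1 g :=
    ((Complex.ofRealCLM.contDiff.pow 2).add contDiff_const).mul
      (Complex.ofRealCLM.contDiff.comp hψ.contDiff)
  have hg0 : ∀ t, 1 < |t| → g t = 0 := fun t ht => by simp [g, hψ.eq_zero t ht]
  have hg'c : Continuous (deriv g) := hgC.continuous_deriv le_rfl
  have hg'0 := deriv_eq_zero_of_eq_zero hg0
  have hg'even : ∀ t, deriv g (-t) = deriv g t := by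
    intro t
    have h1 : (fun t => g (-t)) = fun t => -g t := by
      funext t
      simp [g, hψ.odd]
    have h2 := congrFun (congrArg deriv h1) t
    rw [deriv_comp_neg, deriv.fun_neg] at h2
    exact neg_injective h2
  have hg' : ∀ t, deriv g t = cKernel ψ t + ((t : ℂ) + Complex.I) * deriv (cKernel ψ) t := by
    intro t
    have h1 := ((hasDerivAt_id t).ofReal_comp.add_const Complex.I).mul (hφd t)
    have h2 : HasDerivAt g (cKernel ψ t + ((t : ℂ) + Complex.I) * deriv (cKernel ψ) t) t := by
      refine (h1.congr_of_eventuallyEq (Eventually.of_forall fun u => ?_)).congr_deriv ?_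
      · exact hg u
      · simp
    exact h2.deriv
  have hgint : ∫ t, deriv g t = 0 := by
    refine integral_eq_zero_of_hasDerivAt_of_integrable (f := g)
      (fun t => (hgC.differentiable (by simp)).differentiableAt.hasDerivAt) ?_ ?_
    · simpa using integrable_kernel_smul (W := fun _ => (1 : ℂ)) hg'c continuous_const hg'0
    · simpa using integrable_kernel_smul (W := fun _ => (1 : ℂ)) hgC.continuous continuous_const hg0
  obtain ⟨M, hM, hb⟩ := exists_bound_of_eq_zero hg'c hg'0
  refine ⟨M, hM, fun W hW ⟨C, hC⟩ ε hε => ?_⟩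
  let k' : ℝ → ℝ → ℂ := fun η τ =>
    -((((η ^ 2)⁻¹ : ℝ) : ℂ) * (cKernel ψ (τ / η) + ((τ / η : ℝ) : ℂ) * deriv (cKernel ψ) (τ / η)))
  let l' : ℝ → ℝ → ℂ := fun θ τ =>
    -((((ε ^ 2)⁻¹ : ℝ) : ℂ) * deriv (cKernel ψ) ((τ - θ) / ε))
  have big : ∀ {η τ : ℝ}, 0 < η → η < |τ| → 1 < |τ / η| := fun {η τ} hη h => by
    rw [abs_div, abs_of_pos hη]; exact (one_lt_div hη).2 h
  have hball : ∀ {η}, η ∈ Metric.ball ε (ε / 2) → ε / 2 < η ∧ η < 2 * ε := fun {η} hη => by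
    rw [Metric.mem_ball, Real.dist_eq, abs_lt] at hη
    constructor <;> linarith
  have hball' : ∀ {θ}, θ ∈ Metric.ball (0 : ℝ) ε → ∀ {τ : ℝ}, 2 * ε < |τ| → ε < |τ - θ| :=
    fun {θ} hθ {τ} hτ => by
      rw [mem_ball_zero_iff, Real.norm_eq_abs] at hθ
      have := abs_sub_abs_le_abs_sub τ θ
      linarith
  have hK : HasDerivAt (regularize ψ W) (∫ τ, k' ε τ • W τ) ε := by
    have h := hasDerivAt_integral_kernel hW hC
      (k := fun η τ => ((η⁻¹ : ℝ) : ℂ) * cKernel ψ (τ / η)) (k' := k') (x₀ := ε) (δ := ε / 2)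
      (ρ := 2 * ε) (M := ((ε / 2) ^ 2)⁻¹ * (M₀ + 1 * M₁)) (by positivity) ?_ ?_ ?_ ?_ ?_ ?_
    · refine h.congr_of_eventuallyEq ?_
      filter_upwards [lt_mem_nhds hε] with η hη
      have := regularize_eq (ψ := ψ) W hη 0
      simpa using this
    · intro η _
      have := hφ.continuous
      fun_prop
    · intro τ hτ
      rw [hψ.cKernel_eq_zero _ (big hε (by linarith)), mul_zero]
    · have := hφ.continuous
      simp only [k']
      fun_prop
    · intro η hη τ hτ
      have h1 := hball hη
      have h2 : 1 < |τ / η| := big (by linarith) (by linarith)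
      simp only [k', hψ.cKernel_eq_zero _ h2, hφ'0 _ h2]
      simp
    · intro η hη τ
      have h1 := hball hη
      have h3 : 0 < η := by linarith
      simp only [k', norm_neg, norm_mul, Complex.norm_real]
      rw [Real.norm_of_nonneg (by positivity)]
      have h4 : ‖cKernel ψ (τ / η) + ((τ / η : ℝ) : ℂ) * deriv (cKernel ψ) (τ / η)‖
          ≤ M₀ + 1 * M₁ := by
        by_cases h2 : 1 < |τ / η|
        · rw [hψ.cKernel_eq_zero _ h2, hφ'0 _ h2]
          simp
          positivity
        · refine (norm_add_le _ _).trans ?_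
          rw [norm_mul, Complex.norm_real, Real.norm_eq_abs]
          gcongr
          · exact hb₀ _
          · exact not_lt.1 h2
          · exact hb₁ _
      gcongr
      exact h1.1.le
    · intro η hη τ
      have h1 := hball hη
      have h3 : η ≠ 0 := by linarith
      have h4 : HasDerivAt (fun η : ℝ => τ / η) (-τ / η ^ 2) η := by
        exact ((hasDerivAt_const η τ).div (hasDerivAt_id η) h3).congr_deriv (by simp)
      have h5 := (hφd (τ / η)).scomp η h4
      have h6 := (hasDerivAt_inv h3).ofReal_comp.mul h5
      refine h6.congr_deriv ?_
      simp only [k', Function.comp_def, Complex.real_smul]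
      push_cast
      have h7 : (η : ℂ) ≠ 0 := by exact_mod_cast h3
      field_simp
      ring
  have hL : HasDerivAt (fun θ => regularize ψ (fun τ => W (τ + θ)) ε) (∫ τ, l' 0 τ • W τ) 0 := by
    have h := hasDerivAt_integral_kernel hW hC
      (k := fun θ τ => ((ε⁻¹ : ℝ) : ℂ) * cKernel ψ ((τ - θ) / ε)) (k' := l') (x₀ := 0) (δ := ε)
      (ρ := 2 * ε) (M := (ε ^ 2)⁻¹ * M₁) hε ?_ ?_ ?_ ?_ ?_ ?_
    · exact h.congr_of_eventuallyEq (Eventually.of_forall fun θ => regularize_eq W hε θ)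
    · intro η _
      have := hφ.continuous
      fun_prop
    · intro τ hτ
      rw [hψ.cKernel_eq_zero _ (big hε (by rw [sub_zero]; linarith)), mul_zero]
    · simp only [l']
      fun_prop
    · intro θ hθ τ hτ
      simp only [l', hφ'0 _ (big hε (hball' hθ hτ))]
      simp
    · intro θ hθ τ
      simp only [l', norm_neg, norm_mul, Complex.norm_real]
      rw [Real.norm_of_nonneg (by positivity)]
      gcongr
      exact hb₁ _
    · intro θ hθ τ
      have h4 : HasDerivAt (fun θ : ℝ => (τ - θ) / ε) (-1 / ε) θ :=
        ((hasDerivAt_id θ).const_sub τ).div_const ε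
      have h5 := ((hφd ((τ - θ) / ε)).scomp θ h4).const_mul ((ε⁻¹ : ℝ) : ℂ)
      refine h5.congr_deriv ?_
      simp only [l', Complex.real_smul]
      push_cast
      have h7 : (ε : ℂ) ≠ 0 := by exact_mod_cast hε.ne'
      field_simp
  refine ⟨_, _, hK, hL, ?_⟩
  have hI1 : Integrable fun τ => k' ε τ • W τ := by
    refine integrable_kernel_smul (ρ := ε) ?_ hW fun τ hτ => ?_
    · have := hφ.continuous
      simp only [k']
      fun_prop
    · simp only [k', hψ.cKernel_eq_zero _ (big hε hτ), hφ'0 _ (big hε hτ)]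
      simp
  have hI2 : Integrable fun τ => l' 0 τ • W τ := by
    refine integrable_kernel_smul (ρ := ε) ?_ hW fun τ hτ => ?_
    · simp only [l']
      fun_prop
    · simp only [l', sub_zero, hφ'0 _ (big hε hτ)]
      simp
  have hsum : (∫ τ, k' ε τ • W τ) + Complex.I • ∫ τ, l' 0 τ • W τ
      = (-(ε⁻¹ : ℝ) : ℂ) • ∫ t, deriv g t • W (ε * t) := by
    have := Measure.integral_comp_mul_left (fun τ => deriv g (τ / ε) • W τ) ε
    simp only [mul_div_cancel_left₀ _ hε.ne'] at this
    rw [this, abs_of_pos (inv_pos.2 hε), ← integral_smul, ← integral_smul,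
      ← integral_add hI1 (by exact hI2.smul Complex.I), ← integral_smul]
    congr 1 with τ
    simp only [smul_smul, ← add_smul, k', l', sub_zero]
    rw [← Complex.coe_smul, smul_smul, smul_smul, hg']
    congr 1
    push_cast
    have h7 : (ε : ℂ) ≠ 0 := by exact_mod_cast hε.ne'
    field_simp
    ring
  have hmain := norm_integral_even_smul_sub_le hg'c hW hg'0 hg'even hb hε
  rw [hgint, zero_smul, sub_zero] at hmain
  rw [hsum, norm_smul, norm_neg, Complex.norm_real, Real.norm_of_nonneg (by positivity)]
  calc ε⁻¹ * ‖∫ t, deriv g t • W (ε * t)‖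
      ≤ ε⁻¹ * (M * ε⁻¹ * ∫ τ in (0 : ℝ)..ε, ‖W τ + W (-τ) - (2 : ℂ) • W 0‖) := by gcongr
    _ = _ := by ring

end IsOddKernel

end Kernel

/-! ### Second differences and the class `𝒞^{1,1}(A)` -/

section DiniWeight

variable {ω : ℝ → ℝ}

/-- The primitive of `ε ↦ ε^{-3} ∫_0^ε ω`, found by partial integration; it stays bounded as
`ε → 0` as soon as `ω(τ) τ^{-2}` is integrable. -/
def diniPrimitive (ω : ℝ → ℝ) (ε : ℝ) : ℝ :=
  ((∫ τ in (0 : ℝ)..ε, ω τ / τ ^ 2) - (ε ^ 2)⁻¹ * ∫ τ in (0 : ℝ)..ε, ω τ) / 2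

theorem intervalIntegrable_of_le_one (hint : IntervalIntegrable (fun τ => ω τ / τ ^ 2) volume 0 1)
    {ε : ℝ} (h0 : 0 ≤ ε) (h1 : ε ≤ 1) :
    IntervalIntegrable (fun τ => ω τ / τ ^ 2) volume 0 ε :=
  hint.mono_set (by rw [uIcc_of_le h0, uIcc_of_le zero_le_one]; exact Icc_subset_Icc_right h1)

theorem integral_le_sq_mul (hω : Continuous ω) (h0 : ∀ τ, 0 ≤ ω τ)
    (hint : IntervalIntegrable (fun τ => ω τ / τ ^ 2) volume 0 1) {ε : ℝ} (hε : 0 < ε)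
    (h1 : ε ≤ 1) :
    ∫ τ in (0 : ℝ)..ε, ω τ ≤ ε ^ 2 * ∫ τ in (0 : ℝ)..ε, ω τ / τ ^ 2 := by
  rw [← intervalIntegral.integral_const_mul]
  refine intervalIntegral.integral_mono_on_of_le_Ioo hε.le (hω.intervalIntegrable _ _)
    ((intervalIntegrable_of_le_one hint hε.le h1).const_mul _) fun τ hτ => ?_
  have h2 : 0 < τ := hτ.1
  rw [mul_div_assoc', le_div_iff₀ (by positivity), mul_comm]
  have := h0 τ
  have := hτ.2
  gcongr

theorem diniPrimitive_nonneg (hω : Continuous ω) (h0 : ∀ τ, 0 ≤ ω τ)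
    (hint : IntervalIntegrable (fun τ => ω τ / τ ^ 2) volume 0 1) {ε : ℝ} (hε : 0 < ε)
    (h1 : ε ≤ 1) : 0 ≤ diniPrimitive ω ε := by
  have := integral_le_sq_mul hω h0 hint hε h1
  rw [← inv_mul_le_iff₀ (by positivity)] at this
  unfold diniPrimitive
  linarith

theorem hasDerivAt_diniPrimitive (hω : Continuous ω)
    (hint : IntervalIntegrable (fun τ => ω τ / τ ^ 2) volume 0 1) {ε : ℝ} (hε : 0 < ε)
    (h1 : ε ≤ 1) :
    HasDerivAt (diniPrimitive ω) ((ε ^ 3)⁻¹ * ∫ τ in (0 : ℝ)..ε, ω τ) ε := by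
  have hm : Measurable fun τ => ω τ / τ ^ 2 := hω.measurable.div (by fun_prop)
  have hc : ContinuousAt (fun τ => ω τ / τ ^ 2) ε :=
    hω.continuousAt.div (by fun_prop) (by positivity)
  have d1 := intervalIntegral.integral_hasDerivAt_right (intervalIntegrable_of_le_one hint hε.le h1)
    hm.stronglyMeasurable.stronglyMeasurableAtFilter hc
  have d2 := intervalIntegral.integral_hasDerivAt_right (hω.intervalIntegrable 0 ε)
    hω.stronglyMeasurable.stronglyMeasurableAtFilter hω.continuousAt
  have d3 := (hasDerivAt_pow 2 ε).inv (by positivity)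
  refine ((d1.sub (d3.mul d2)).div_const 2).congr_deriv ?_
  simp only [Pi.inv_apply]
  field_simp
  ring

theorem tendsto_integral_div_sq (hint : IntervalIntegrable (fun τ => ω τ / τ ^ 2) volume 0 1) :
    Tendsto (fun ε => ∫ τ in (0 : ℝ)..ε, ω τ / τ ^ 2) (𝓝[>] 0) (𝓝 0) := by
  have h := intervalIntegral.continuousOn_primitive_interval (a := 0) (b := 1)
    (f := fun τ => ω τ / τ ^ 2) (μ := volume) (by
      rw [uIcc_of_le zero_le_one, integrableOn_Icc_iff_integrableOn_Ioc]
      exact (intervalIntegrable_iff_integrableOn_Ioc_of_le zero_le_one).1 hint)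
  have h2 := h 0 left_mem_uIcc
  rw [ContinuousWithinAt, intervalIntegral.integral_same, uIcc_of_le zero_le_one] at h2
  exact h2.mono_left (nhdsWithin_le_of_mem (mem_of_superset (Ioo_mem_nhdsGT one_pos)
    Ioo_subset_Icc_self))

end DiniWeight

section SecondDiff

variable {A : E →ₗ.[ℂ] E} {H : E →L[ℂ] E}

/-- The norm `‖e^{iτA} H e^{-iτA} + e^{-iτA} H e^{iτA} - 2 H‖`. -/
def secondDiff (A : E →ₗ.[ℂ] E) (H : E →L[ℂ] E) (τ : ℝ) : ℝ :=
  ‖conjugate A H τ + conjugate A H (-τ) - (2 : ℂ) • H‖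

theorem secondDiff_nonneg (τ : ℝ) : 0 ≤ secondDiff A H τ := norm_nonneg _

theorem norm_secondDiff_apply_le (hA : IsSelfAdjoint A) (θ τ : ℝ) (x : E) :
    ‖conjugate A H (θ + τ) x + conjugate A H (θ - τ) x - (2 : ℂ) • conjugate A H θ x‖
      ≤ secondDiff A H τ * ‖x‖ := by
  have e : conjugate A H (θ + τ) x + conjugate A H (θ - τ) x - (2 : ℂ) • conjugate A H θ x
      = expI A θ ((conjugate A H τ + conjugate A H (-τ) - (2 : ℂ) • H) (expI A (-θ) x)) := by
    have h : ∀ τ, conjugate A H (θ + τ) x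
        = expI A θ (conjugate A H τ (expI A (-θ) x)) := fun τ => by
      rw [add_comm, ← conjugate_conjugate hA, conjugate_apply]
    rw [h, sub_eq_add_neg θ, h, conjugate_apply H θ]
    simp
  rw [e, norm_expI_apply hA, ← norm_expI_apply hA (-θ) x]
  exact ContinuousLinearMap.le_opNorm _ _

/-- A quantitative continuity estimate: `W(θ)` is close to its mean over an interval of length
`2ε`, and the mean is Lipschitz in `θ`. -/
theorem norm_conjugate_sub_le (hA : IsSelfAdjoint A) {c : ℝ} (hc : 0 ≤ c)
    (hcH : ∫⁻ θ in Ioo (0 : ℝ) 1, ENNReal.ofReal (secondDiff A H θ / θ ^ 2) ≤ ENNReal.ofReal c)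
    {ε : ℝ} (hε : 0 < ε) (h1 : ε ≤ 1) (θ : ℝ) :
    ‖conjugate A H θ - H‖ ≤ c * ε + |θ| * ‖H‖ / ε := by
  refine ContinuousLinearMap.opNorm_le_bound _ (by positivity) fun x => ?_
  set W : ℝ → E := fun τ => conjugate A H τ x with hW
  have hWc : Continuous W := continuous_conjugate_apply hA H x
  have hWi : ∀ a b, IntervalIntegrable W volume a b := fun a b => hWc.intervalIntegrable a b
  have hWb : ∀ τ, ‖W τ‖ ≤ ‖H‖ * ‖x‖ := fun τ =>
    ContinuousLinearMap.le_of_opNorm_le _ (norm_conjugate_le hA H τ) x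
  have hmean : ∀ θ, ‖(∫ τ in (θ - ε)..(θ + ε), W τ) - ((2 * ε : ℝ) : ℂ) • W θ‖
      ≤ c * ε ^ 2 * ‖x‖ := by
    intro θ
    have i1 : IntervalIntegrable (fun τ => W (θ + τ)) volume 0 ε :=
      (hWc.comp (continuous_const_add θ)).intervalIntegrable _ _
    have i2 : IntervalIntegrable (fun τ => W (θ - τ)) volume 0 ε :=
      (hWc.comp (continuous_sub_left θ)).intervalIntegrable _ _
    have e : (∫ τ in (θ - ε)..(θ + ε), W τ) - ((2 * ε : ℝ) : ℂ) • W θ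
        = ∫ τ in (0 : ℝ)..ε, (W (θ + τ) + W (θ - τ) - (2 : ℂ) • W θ) := by
      rw [intervalIntegral.integral_sub (i1.add i2) (by simp), intervalIntegral.integral_add i1 i2,
        intervalIntegral.integral_comp_add_left W, intervalIntegral.integral_comp_sub_left W,
        intervalIntegral.integral_const, add_zero, sub_zero, sub_zero,
        add_comm (∫ τ in θ..θ + ε, W τ),
        intervalIntegral.integral_add_adjacent_intervals (hWi _ _) (hWi _ _)]
      congr 1
      rw [← Complex.coe_smul, smul_smul]
      push_cast
      ring_nf
    rw [e, intervalIntegral.integral_of_le hε.le, integral_Ioc_eq_integral_Ioo, ← toReal_enorm]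
    have hle : ‖∫ τ in Ioo 0 ε, (W (θ + τ) + W (θ - τ) - (2 : ℂ) • W θ)‖ₑ
        ≤ ENNReal.ofReal (c * ε ^ 2 * ‖x‖) := by
      calc _ ≤ ∫⁻ τ in Ioo 0 ε, ‖W (θ + τ) + W (θ - τ) - (2 : ℂ) • W θ‖ₑ :=
            enorm_integral_le_lintegral_enorm _
        _ ≤ ∫⁻ τ in Ioo 0 ε, ENNReal.ofReal (ε ^ 2 * ‖x‖)
              * ENNReal.ofReal (secondDiff A H τ / τ ^ 2) := by
            refine setLIntegral_mono' measurableSet_Ioo fun τ hτ => ?_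
            rw [← ofReal_norm, ← ENNReal.ofReal_mul (by positivity)]
            refine ENNReal.ofReal_le_ofReal ((norm_secondDiff_apply_le hA θ τ x).trans ?_)
            have hτ0 : 0 < τ := hτ.1
            have hτ1 : τ ≤ ε := hτ.2.le
            rw [mul_div_assoc', le_div_iff₀ (by positivity)]
            have := secondDiff_nonneg (A := A) (H := H) τ
            calc secondDiff A H τ * ‖x‖ * τ ^ 2 ≤ secondDiff A H τ * ‖x‖ * ε ^ 2 := by gcongr
              _ = _ := by ring
        _ = ENNReal.ofReal (ε ^ 2 * ‖x‖)
              * ∫⁻ τ in Ioo 0 ε, ENNReal.ofReal (secondDiff A H τ / τ ^ 2) :=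
            lintegral_const_mul' _ _ ENNReal.ofReal_ne_top
        _ ≤ ENNReal.ofReal (ε ^ 2 * ‖x‖) * ENNReal.ofReal c := by
            gcongr
            exact (lintegral_mono_set (Ioo_subset_Ioo_right h1)).trans hcH
        _ = _ := by
            rw [← ENNReal.ofReal_mul (by positivity)]
            congr 1
            ring
    exact ENNReal.toReal_le_of_le_ofReal (by positivity) hle
  have hdiff : ‖(∫ τ in (θ - ε)..(θ + ε), W τ) - ∫ τ in (0 - ε)..(0 + ε), W τ‖
      ≤ 2 * (|θ| * (‖H‖ * ‖x‖)) := by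
    rw [intervalIntegral.integral_interval_sub_interval_comm (hWi _ _) (hWi _ _) (hWi _ _)]
    have b1 := intervalIntegral.norm_integral_le_of_norm_le_const
      (a := θ - ε) (b := 0 - ε) (C := ‖H‖ * ‖x‖) (f := W) fun τ _ => hWb τ
    have b2 := intervalIntegral.norm_integral_le_of_norm_le_const
      (a := θ + ε) (b := 0 + ε) (C := ‖H‖ * ‖x‖) (f := W) fun τ _ => hWb τ
    have e1 : |0 - ε - (θ - ε)| = |θ| := by rw [← abs_neg]; congr 1; ring
    have e2 : |0 + ε - (θ + ε)| = |θ| := by rw [← abs_neg]; congr 1; ring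
    rw [e1] at b1
    rw [e2] at b2
    refine (norm_sub_le _ _).trans ?_
    linarith
  have h3 := hmean θ
  have h4 := hmean 0
  have h5 : ‖((2 * ε : ℝ) : ℂ) • (W θ - W 0)‖
      ≤ c * ε ^ 2 * ‖x‖ + c * ε ^ 2 * ‖x‖ + 2 * (|θ| * (‖H‖ * ‖x‖)) := by
    have e : ((2 * ε : ℝ) : ℂ) • (W θ - W 0)
        = -((∫ τ in (θ - ε)..(θ + ε), W τ) - ((2 * ε : ℝ) : ℂ) • W θ)
          + ((∫ τ in (0 - ε)..(0 + ε), W τ) - ((2 * ε : ℝ) : ℂ) • W 0)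
          + ((∫ τ in (θ - ε)..(θ + ε), W τ) - ∫ τ in (0 - ε)..(0 + ε), W τ) := by
      rw [smul_sub]; abel
    rw [e]
    refine (norm_add₃_le).trans ?_
    rw [norm_neg]
    gcongr
  rw [norm_smul, Complex.norm_real, Real.norm_of_nonneg (by positivity)] at h5
  have h6 : W θ - W 0 = (conjugate A H θ - H) x := by
    simp only [hW, conjugate_zero hA, sub_apply]
  rw [h6] at h5
  have h7 : (c * ε + |θ| * ‖H‖ / ε) * ‖x‖
      = (c * ε ^ 2 * ‖x‖ + c * ε ^ 2 * ‖x‖ + 2 * (|θ| * (‖H‖ * ‖x‖))) / (2 * ε) := by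
    field_simp
    ring
  rw [h7, le_div_iff₀ (by positivity)]
  linarith

/-- For `H` of class `𝒞^{1,1}(A)` the function `θ ↦ e^{iθA} H e^{-iθA}` is norm continuous. -/
theorem ClassC11.continuous_conjugate (hA : IsSelfAdjoint A) (hH : ClassC11 A H) :
    Continuous (conjugate A H) := by
  set I := ∫⁻ θ in Ioo (0 : ℝ) 1, ENNReal.ofReal (secondDiff A H θ / θ ^ 2) with hI
  have hIfin : I ≠ ⊤ := ne_of_lt hH
  set c := I.toReal with hc
  have hc0 : 0 ≤ c := ENNReal.toReal_nonneg
  have hIc : I ≤ ENNReal.ofReal c := (ENNReal.ofReal_toReal hIfin).ge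
  have h0 : Tendsto (fun θ => ‖conjugate A H θ - H‖) (𝓝 0) (𝓝 0) := by
    rw [Metric.tendsto_nhds]
    intro η hη
    set ε := min 1 (η / (2 * (c + 1))) with hε
    have hε0 : 0 < ε := lt_min one_pos (by positivity)
    have h2 : Tendsto (fun θ : ℝ => |θ| * ‖H‖ / ε) (𝓝 0) (𝓝 0) := by
      have : Continuous fun θ : ℝ => |θ| * ‖H‖ / ε := by fun_prop
      simpa using this.tendsto 0
    filter_upwards [h2.eventually (gt_mem_nhds (half_pos hη))] with θ hθ
    rw [dist_zero_right, norm_norm]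
    refine (norm_conjugate_sub_le hA hc0 hIc hε0 (min_le_left _ _) θ).trans_lt ?_
    have h3 : c * ε ≤ η / 2 := by
      calc c * ε ≤ (c + 1) * (η / (2 * (c + 1))) := by
            gcongr
            · linarith
            · exact min_le_right _ _
        _ = η / 2 := by field_simp
    linarith
  rw [continuous_iff_continuousAt]
  intro θ₀
  rw [ContinuousAt, tendsto_iff_norm_sub_tendsto_zero]
  have h1 : Tendsto (fun θ => ‖conjugate A H (θ - θ₀) - H‖) (𝓝 θ₀) (𝓝 0) := by
    refine h0.comp ?_
    have : Continuous fun θ : ℝ => θ - θ₀ := by fun_prop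
    simpa using this.tendsto θ₀
  refine squeeze_zero (fun _ => norm_nonneg _) (fun θ => ?_) h1
  have : conjugate A H θ - conjugate A H θ₀ = conjugate A (conjugate A H (θ - θ₀) - H) θ₀ := by
    rw [conjugate_sub, conjugate_conjugate hA, sub_add_cancel]
  rw [this]
  exact norm_conjugate_le hA _ _

theorem ClassC11.continuous_secondDiff (hA : IsSelfAdjoint A) (hH : ClassC11 A H) :
    Continuous (secondDiff A H) := by
  have := hH.continuous_conjugate hA
  unfold secondDiff
  fun_prop

theorem ClassC11.intervalIntegrable (hA : IsSelfAdjoint A) (hH : ClassC11 A H) :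
    IntervalIntegrable (fun τ => secondDiff A H τ / τ ^ 2) volume 0 1 := by
  rw [intervalIntegrable_iff_integrableOn_Ioo_of_le zero_le_one]
  refine ⟨((hH.continuous_secondDiff hA).measurable.div (by fun_prop)).aestronglyMeasurable, ?_⟩
  rw [hasFiniteIntegral_iff_ofReal (Eventually.of_forall fun τ =>
    div_nonneg (secondDiff_nonneg τ) (sq_nonneg τ))]
  exact hH

theorem classC11_star (hH : ClassC11 A H) : ClassC11 A (star H) := by
  have h : ∀ θ : ℝ, ‖conjugate A (star H) θ + conjugate A (star H) (-θ) - (2 : ℂ) • star H‖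
      = ‖conjugate A H θ + conjugate A H (-θ) - (2 : ℂ) • H‖ := fun θ => by
    rw [← star_conjugate, ← star_conjugate, ← norm_star]
    simp [star_add, star_sub, star_smul]
  unfold ClassC11
  simp only [h]
  exact hH

end SecondDiff

/-! ### The positive commutator estimate as an inequality between quadratic forms -/

section QuadraticForms

omit [CompleteSpace E] in
theorem re_inner_le_of_le {S T : E →L[ℂ] E} (h : S ≤ T) (u : E) :
    (inner ℂ u (S u)).re ≤ (inner ℂ u (T u)).re := by
  have h1 := ((ContinuousLinearMap.le_def S T).1 h).re_inner_nonneg_right u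
  rw [sub_apply, inner_sub_right, map_sub, sub_nonneg] at h1
  exact h1

theorem isSelfAdjoint_realPart (H : E →L[ℂ] E) : IsSelfAdjoint (ℜ H : E →L[ℂ] E) := (ℜ H).2

theorem isSelfAdjoint_imaginaryPart (H : E →L[ℂ] E) : IsSelfAdjoint (ℑ H : E →L[ℂ] E) := (ℑ H).2

theorem inner_apply_eq_re {T : E →L[ℂ] E} (hT : IsSelfAdjoint T) (u : E) :
    inner ℂ u (T u) = ((inner ℂ u (T u)).re : ℂ) :=
  (hT.isSymmetric.coe_re_inner_self_apply u).symm

theorem realPart_apply_add (H : E →L[ℂ] E) (u : E) :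
    H u = (ℜ H : E →L[ℂ] E) u + Complex.I • (ℑ H : E →L[ℂ] E) u := by
  conv_lhs => rw [← realPart_add_I_smul_imaginaryPart H]
  rfl

theorem re_inner_apply (H : E →L[ℂ] E) (u : E) :
    (inner ℂ u (H u)).re = (inner ℂ u ((ℜ H : E →L[ℂ] E) u)).re := by
  rw [realPart_apply_add, inner_add_right, inner_smul_right,
    inner_apply_eq_re (isSelfAdjoint_imaginaryPart H)]
  simp

theorem im_inner_apply (H : E →L[ℂ] E) (u : E) :
    (inner ℂ u (H u)).im = (inner ℂ u ((ℑ H : E →L[ℂ] E) u)).re := by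
  rw [realPart_apply_add, inner_add_right, inner_smul_right,
    inner_apply_eq_re (isSelfAdjoint_realPart H),
    inner_apply_eq_re (isSelfAdjoint_imaginaryPart H)]
  simp

/-- A nonnegative operator satisfies `V² ≤ (‖V‖ + 1) V`. -/
theorem norm_sq_apply_le_of_nonneg {V : E →L[ℂ] E} (hV : IsSelfAdjoint V)
    (h0 : ∀ u, 0 ≤ (inner ℂ u (V u)).re) (u : E) :
    ‖V u‖ ^ 2 ≤ (‖V‖ + 1) * (inner ℂ u (V u)).re := by
  have hn : 0 < ‖V‖ + 1 := by positivity
  set t : ℝ := (‖V‖ + 1)⁻¹ with ht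
  have ht0 : 0 < t := inv_pos.2 hn
  -- positivity of the form at `u - t V u`
  have h1 := h0 (u - (t : ℂ) • V u)
  have hsym : inner ℂ (V u) (V u) = inner ℂ u (V (V u)) := hV.isSymmetric u (V u)
  have h2 : (inner ℂ (u - (t : ℂ) • V u) (V (u - (t : ℂ) • V u))).re
      = (inner ℂ u (V u)).re - 2 * t * ‖V u‖ ^ 2 + t ^ 2 * (inner ℂ (V u) (V (V u))).re := by
    rw [map_sub, map_smul, inner_sub_left, inner_sub_right, inner_sub_right, inner_smul_left,
      inner_smul_right, inner_smul_right, inner_smul_left, ← hsym, inner_self_eq_norm_sq_to_K]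
    have : ((‖V u‖ : ℂ) ^ 2).re = ‖V u‖ ^ 2 := by
      rw [← Complex.ofReal_pow, Complex.ofReal_re]
    simp [this]
    ring
  have h3 : (inner ℂ (V u) (V (V u))).re ≤ ‖V‖ * ‖V u‖ ^ 2 := by
    calc (inner ℂ (V u) (V (V u))).re ≤ ‖V u‖ * ‖V (V u)‖ :=
          (Complex.re_le_norm _).trans (norm_inner_le_norm _ _)
      _ ≤ ‖V u‖ * (‖V‖ * ‖V u‖) := by gcongr; exact V.le_opNorm _
      _ = _ := by ring
  rw [h2] at h1
  have h4 : t * (‖V‖ + 1) = 1 := inv_mul_cancel₀ hn.ne'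
  have h5 : t ^ 2 * (inner ℂ (V u) (V (V u))).re ≤ t * ‖V u‖ ^ 2 := by
    calc t ^ 2 * (inner ℂ (V u) (V (V u))).re ≤ t ^ 2 * (‖V‖ * ‖V u‖ ^ 2) := by gcongr
      _ ≤ t ^ 2 * ((‖V‖ + 1) * ‖V u‖ ^ 2) := by gcongr; linarith
      _ = t * (t * (‖V‖ + 1)) * ‖V u‖ ^ 2 := by ring
      _ = t * ‖V u‖ ^ 2 := by rw [h4, mul_one]
  have h6 : t * ‖V u‖ ^ 2 ≤ (inner ℂ u (V u)).re := by linarith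
  rw [ht, inv_mul_le_iff₀ hn] at h6
  exact h6

theorem im_inner_le_sigmaPlus (H : E →L[ℂ] E) (u : E) :
    (inner ℂ u (H u)).im ≤ sigmaPlus H * ‖u‖ ^ 2 := by
  have h1 : (ℑ H : E →L[ℂ] E) ≤ algebraMap ℝ (E →L[ℂ] E) (sigmaPlus H) := by
    refine le_algebraMap_of_spectrum_le (fun r hr => ?_) (isSelfAdjoint_imaginaryPart H)
    exact le_csSup (spectrum.isCompact (𝕜 := ℝ) (ℑ H : E →L[ℂ] E)).bddAbove hr
  have h2 := re_inner_le_of_le h1 u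
  rw [im_inner_apply]
  refine h2.trans_eq ?_
  rw [Algebra.algebraMap_eq_smul_one, smul_apply, one_apply_eq_self, ← Complex.coe_smul,
    inner_smul_right, inner_self_eq_norm_sq_to_K, Complex.re_ofReal_mul]
  norm_cast

/-- The spectral projection dominates a quadratic polynomial: `1_Δ(t) ≥ 1 - (t - x)² / δ²`. -/
theorem re_inner_spectralProj_ge {T : E →L[ℂ] E} (hT : IsSelfAdjoint T) {Δ : Set ℝ}
    (hΔ : MeasurableSet Δ) {x δ : ℝ} (hδ : 0 < δ) (hx : ∀ t, |t - x| < δ → t ∈ Δ) (u : E) :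
    ‖u‖ ^ 2 - (δ ^ 2)⁻¹ * ‖T u - (x : ℂ) • u‖ ^ 2 ≤ (inner ℂ u (spectralProj T Δ u)).re := by
  have hTn : IsStarNormal T := hT.isStarNormal
  have hb : IsBddBorel fun w : ℂ => Δ.indicator (fun _ => (1 : ℂ)) w.re := by
    refine ⟨(measurable_const.indicator hΔ).comp Complex.measurable_re, 1, fun w => ?_⟩
    by_cases hw : w.re ∈ Δ <;> simp [hw]
  have hE : inner ℂ u (spectralProj T Δ u) = _ := hb.isBorelCalc (N := T) u
  let q : ℂ → ℂ := fun w => ((1 - (δ ^ 2)⁻¹ * (w.re - x) ^ 2 : ℝ) : ℂ)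
  have hq : Continuous q := by fun_prop
  have hcalc := isBorelCalc_cfc T hq
  have hcfc : cfc q T = 1 - ((δ ^ 2)⁻¹ : ℂ) • ((T - algebraMap ℂ _ (x : ℂ))
      * (T - algebraMap ℂ _ (x : ℂ))) := by
    have e1 : cfc q T = cfc (fun w : ℂ => 1 - ((δ ^ 2)⁻¹ : ℂ) * ((w - x) * (w - x))) T := by
      refine cfc_congr fun w hw => ?_
      have : w = (w.re : ℂ) := hT.mem_spectrum_eq_re hw
      simp only [q]
      conv_rhs => rw [this]
      push_cast
      ring
    rw [e1, cfc_sub (a := T) _ _ (by fun_prop) (by fun_prop), cfc_const_one ℂ T,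
      cfc_const_mul _ _ T (by fun_prop), cfc_mul _ _ T (by fun_prop) (by fun_prop),
      cfc_sub (a := T) _ _ (by fun_prop) (by fun_prop), cfc_id' ℂ T, cfc_const _ T]
  have hquad : (inner ℂ u (cfc q T u)).re
      = ‖u‖ ^ 2 - (δ ^ 2)⁻¹ * ‖T u - (x : ℂ) • u‖ ^ 2 := by
    have hSapp : ∀ v, (T - algebraMap ℂ (E →L[ℂ] E) (x : ℂ)) v = T v - (x : ℂ) • v := fun v => by
      rw [Algebra.algebraMap_eq_smul_one]; rfl
    have hS : IsSelfAdjoint (T - algebraMap ℂ (E →L[ℂ] E) (x : ℂ)) := by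
      refine hT.sub ?_
      rw [IsSelfAdjoint, ← algebraMap_star_comm]
      simp
    have h1 := hS.isSymmetric u ((T - algebraMap ℂ (E →L[ℂ] E) (x : ℂ)) u)
    simp only [ContinuousLinearMap.coe_coe] at h1
    rw [hcfc, sub_apply, smul_apply, one_apply_eq_self, mul_apply_eq_comp, inner_sub_right,
      inner_smul_right, ← h1, hSapp, inner_self_eq_norm_sq_to_K, inner_self_eq_norm_sq_to_K]
    have e2 : ((‖u‖ : ℂ) ^ 2 - ((δ : ℂ) ^ 2)⁻¹ * (‖T u - (x : ℂ) • u‖ : ℂ) ^ 2)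
        = ((‖u‖ ^ 2 - (δ ^ 2)⁻¹ * ‖T u - (x : ℂ) • u‖ ^ 2 : ℝ) : ℂ) := by push_cast; ring
    exact (congrArg Complex.re e2).trans (Complex.ofReal_re _)
  rw [← hquad, hcalc u, hE]
  have hi : ∀ w, Δ.indicator (fun _ => (1 : ℂ)) w = ((Δ.indicator (fun _ => (1 : ℝ)) w : ℝ) : ℂ) :=
    fun w => by by_cases hw : w ∈ Δ <;> simp [hw]
  simp only [hi, q]
  rw [integral_complex_ofReal, integral_complex_ofReal, Complex.ofReal_re, Complex.ofReal_re]
  refine integral_mono ?_ ?_ fun w => ?_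
  · -- the polynomial is bounded on the spectrum
    obtain ⟨C, hC⟩ := (spectrum.isCompact (𝕜 := ℂ) T).exists_bound_of_continuousOn
      hq.continuousOn
    refine Integrable.of_bound (C := C) (Continuous.aestronglyMeasurable (by fun_prop)) ?_
    filter_upwards [ae_mem_spectrum T u] with w hw
    have := hC w hw
    rwa [Complex.norm_real] at this
  · have := (hb.integrable (spectralMeasure T u)).re
    simpa [hi] using this
  · have h1 : 0 ≤ (δ ^ 2)⁻¹ * (w.re - x) ^ 2 := by positivity
    by_cases hw : w.re ∈ Δ
    · simp only [indicator_of_mem hw]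
      linarith
    · simp only [indicator_of_notMem hw]
      have h2 : δ ≤ |w.re - x| := not_lt.1 fun h => hw (hx _ h)
      have h3 : δ ^ 2 ≤ (w.re - x) ^ 2 := by
        rw [← sq_abs (w.re - x)]
        gcongr
      rw [sub_nonpos, ← div_eq_inv_mul, one_le_div (by positivity)]
      exact h3

end QuadraticForms

/-- The form version of the estimate (M+), around a point `x` of the interval. The spectral
projection is replaced by a quadratic polynomial of `Re H - x`. -/
theorem MourrePlus.exists_forall_le {A : E →ₗ.[ℂ] E} {H : E →L[ℂ] E} {Δ : Set ℝ}
    (hM : MourrePlus A H Δ) (hΔ : IsOpen Δ) {δ : ℝ} (hδ : 0 < δ) :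
    ∃ a c β : ℝ, 0 < a ∧ 0 ≤ c ∧ 0 ≤ β ∧ ∀ x : ℝ, (∀ t, |t - x| < δ → t ∈ Δ) → ∀ u : E,
      a * ‖u‖ ^ 2 - c * ‖(ℜ H : E →L[ℂ] E) u - (x : ℂ) • u‖ ^ 2
        ≤ (inner ℂ u ((Complex.I • ad A (ℜ H : E →L[ℂ] E)) u)).re
          + β * (sigmaPlus H * ‖u‖ ^ 2 - (inner ℂ u (H u)).im) := by
  obtain ⟨-, a, b, β, ha, hb, hβ, h⟩ := hM
  refine ⟨a, (a + b) * (δ ^ 2)⁻¹, β, ha, by positivity, hβ, fun x hx u => ?_⟩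
  have h1 := re_inner_le_of_le h u
  have h2 := re_inner_spectralProj_ge (isSelfAdjoint_realPart H) hΔ.measurableSet hδ hx u
  have hu : (inner ℂ u u).re = ‖u‖ ^ 2 := by
    rw [inner_self_eq_norm_sq_to_K]
    norm_cast
  simp only [sub_apply, add_apply, smul_apply, one_apply_eq_self, inner_sub_right, inner_add_right,
    inner_smul_right, Complex.sub_re, Complex.add_re, Complex.re_ofReal_mul, hu] at h1
  rw [smul_apply, inner_smul_right, im_inner_apply]
  nlinarith [mul_le_mul_of_nonneg_left h2 (by linarith : 0 ≤ a + b)]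

/-! ### The imaginary part of the regularized operator -/

section Regularized

variable {A : E →ₗ.[ℂ] E} {H : E →L[ℂ] E}

theorem realPart_conjugate (θ : ℝ) :
    (ℜ (conjugate A H θ) : E →L[ℂ] E) = conjugate A (ℜ H : E →L[ℂ] E) θ := by
  rw [realPart_apply_coe, realPart_apply_coe, star_conjugate, ← conjugate_add, ← Complex.coe_smul,
    ← Complex.coe_smul, conjugate_smul]

theorem norm_conjugate_realPart_sub_le (θ : ℝ) :
    ‖conjugate A (ℜ H : E →L[ℂ] E) θ - (ℜ H : E →L[ℂ] E)‖ ≤ ‖conjugate A H θ - H‖ := by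
  have h := realPart.norm_le (conjugate A H θ - H)
  have e : (ℜ (conjugate A H θ - H) : E →L[ℂ] E)
      = conjugate A (ℜ H : E →L[ℂ] E) θ - (ℜ H : E →L[ℂ] E) := by
    rw [map_sub, ← realPart_conjugate]
    rfl
  rwa [← e]

/-- The lower bound for the odd part of `τ ↦ Re ⟨w, e^{iτA} H e^{-iτA} w⟩`: it is the integral over
`[-τ, τ]` of the form of the commutator at the vectors `e^{-iτA} w`, to which the positive
commutator estimate applies. -/
theorem le_re_inner_conjugate_sub (hA : IsSelfAdjoint A) (hH : ClassC11 A H)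
    (hR : ClassC A 1 (ℜ H : E →L[ℂ] E)) {a c β x : ℝ} (hc : 0 ≤ c) (hβ : 0 ≤ β)
    (hx : ∀ u : E, a * ‖u‖ ^ 2 - c * ‖(ℜ H : E →L[ℂ] E) u - (x : ℂ) • u‖ ^ 2
        ≤ (inner ℂ u ((Complex.I • ad A (ℜ H : E →L[ℂ] E)) u)).re
          + β * (sigmaPlus H * ‖u‖ ^ 2 - (inner ℂ u (H u)).im))
    {ε d : ℝ} (hd : ∀ τ, |τ| ≤ ε → ‖conjugate A H τ - H‖ ≤ d) (w : E) {τ : ℝ}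
    (hτ0 : 0 ≤ τ) (hτ : τ ≤ ε) :
    2 * τ * (a * ‖w‖ ^ 2 - 2 * c * ‖(ℜ H : E →L[ℂ] E) w - (x : ℂ) • w‖ ^ 2
        - 2 * c * d ^ 2 * ‖w‖ ^ 2 - β * (sigmaPlus H * ‖w‖ ^ 2 - (inner ℂ w (H w)).im))
      - β * ‖w‖ ^ 2 * ∫ σ in (0 : ℝ)..τ, secondDiff A H σ
      ≤ (inner ℂ w (conjugate A H τ w)).re - (inner ℂ w (conjugate A H (-τ) w)).re := by
  set R : E →L[ℂ] E := (ℜ H : E →L[ℂ] E) with hRdef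
  set ρ := ‖R w - (x : ℂ) • w‖ with hρ
  set κ := a * ‖w‖ ^ 2 - 2 * c * ρ ^ 2 - 2 * c * d ^ 2 * ‖w‖ ^ 2
    - β * (sigmaPlus H * ‖w‖ ^ 2 - (inner ℂ w (H w)).im) with hκ
  let r : ℝ → ℝ := fun τ => (inner ℂ w (conjugate A R τ w)).re
  let r' : ℝ → ℝ := fun τ => (inner ℂ w (conjugate A (Complex.I • ad A R) τ w)).re
  have hre : ∀ τ, (inner ℂ w (conjugate A H τ w)).re = r τ := fun τ => by
    rw [re_inner_apply, realPart_conjugate]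
  have hrd : ∀ τ, HasDerivAt r (r' τ) τ := fun τ => by
    have h1 := hR.hasDerivAt_conjugate hA w τ
    exact (Complex.reCLM.hasFDerivAt.comp_hasDerivAt τ
      (((innerSL ℂ w).restrictScalars ℝ).hasFDerivAt.comp_hasDerivAt τ h1))
  have hr' : ∀ τ, |τ| ≤ ε → a * ‖w‖ ^ 2 - 2 * c * ρ ^ 2 - 2 * c * d ^ 2 * ‖w‖ ^ 2
      - β * (sigmaPlus H * ‖w‖ ^ 2 - (inner ℂ w (conjugate A H τ w)).im) ≤ r' τ := by
    intro τ hτ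
    have h1 := hx (expI A (-τ) w)
    rw [← inner_conjugate, ← inner_conjugate, norm_expI_apply hA] at h1
    have h2 : ‖R (expI A (-τ) w) - (x : ℂ) • expI A (-τ) w‖ ≤ ρ + d * ‖w‖ := by
      have e : expI A τ (R (expI A (-τ) w) - (x : ℂ) • expI A (-τ) w)
          = (R w - (x : ℂ) • w) + (conjugate A R τ - R) w := by
        have hinv : expI A τ (expI A (-τ) w) = w := by
          rw [← mul_apply_eq_comp, expI_mul_neg hA, one_apply_eq_self]
        rw [map_sub, map_smul, hinv, sub_apply, conjugate_apply]
        abel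
      rw [← norm_expI_apply hA τ, e]
      refine (norm_add_le _ _).trans ?_
      gcongr
      exact ContinuousLinearMap.le_of_opNorm_le _
        ((norm_conjugate_realPart_sub_le τ).trans (hd τ hτ)) w
    have h3 : ‖R (expI A (-τ) w) - (x : ℂ) • expI A (-τ) w‖ ^ 2
        ≤ 2 * ρ ^ 2 + 2 * d ^ 2 * ‖w‖ ^ 2 := by
      calc _ ≤ (ρ + d * ‖w‖) ^ 2 := by gcongr
        _ ≤ _ := by nlinarith [sq_nonneg (ρ - d * ‖w‖)]
    have h4 := mul_le_mul_of_nonneg_left h3 hc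
    have h5 : r' τ = (inner ℂ w (conjugate A (Complex.I • ad A R) τ w)).re := rfl
    linarith
  have hωc := hH.continuous_secondDiff hA
  let f : ℝ → ℝ := fun τ => r τ - r (-τ) - 2 * τ * κ
    + β * ‖w‖ ^ 2 * ∫ σ in (0 : ℝ)..τ, secondDiff A H σ
  have hfd : ∀ τ, HasDerivAt f (r' τ + r' (-τ) - 2 * κ + β * ‖w‖ ^ 2 * secondDiff A H τ) τ := by
    intro τ
    have h1 : HasDerivAt (fun τ => r (-τ)) (-r' (-τ)) τ :=
      ((hrd (-τ)).scomp τ (hasDerivAt_neg τ)).congr_deriv (by simp)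
    have h2 : HasDerivAt (fun τ : ℝ => 2 * τ * κ) (2 * κ) τ := by
      simpa using ((hasDerivAt_id τ).const_mul 2).mul_const κ
    have h3 := intervalIntegral.integral_hasDerivAt_right (hωc.intervalIntegrable 0 τ)
      hωc.stronglyMeasurable.stronglyMeasurableAtFilter hωc.continuousAt
    exact ((((hrd τ).sub h1).sub h2).add (h3.const_mul (β * ‖w‖ ^ 2))).congr_deriv (by ring)
  have hmono : MonotoneOn f (Icc 0 ε) := by
    refine monotoneOn_of_deriv_nonneg (convex_Icc 0 ε)
      (fun τ _ => (hfd τ).continuousAt.continuousWithinAt)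
      (fun τ _ => (hfd τ).differentiableAt.differentiableWithinAt) fun τ hτ => ?_
    rw [interior_Icc] at hτ
    rw [(hfd τ).deriv]
    have h1 := hr' τ (by rw [abs_of_pos hτ.1]; exact hτ.2.le)
    have h2 := hr' (-τ) (by rw [abs_neg, abs_of_pos hτ.1]; exact hτ.2.le)
    have h3 : 2 * (inner ℂ w (H w)).im - secondDiff A H τ * ‖w‖ ^ 2
        ≤ (inner ℂ w (conjugate A H τ w)).im + (inner ℂ w (conjugate A H (-τ) w)).im := by
      have h4 : ‖inner ℂ w ((conjugate A H τ + conjugate A H (-τ) - (2 : ℂ) • H) w)‖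
          ≤ ‖w‖ * (secondDiff A H τ * ‖w‖) :=
        (norm_inner_le_norm _ _).trans (by gcongr; exact ContinuousLinearMap.le_opNorm _ _)
      have h5 := (abs_le.1 ((Complex.abs_im_le_norm _).trans h4)).1
      simp only [sub_apply, add_apply, smul_apply, inner_sub_right, inner_add_right,
        inner_smul_right, Complex.sub_im, Complex.add_im, Complex.mul_im, Complex.re_ofNat,
        Complex.im_ofNat, zero_mul, add_zero] at h5
      nlinarith
    have h6 := mul_le_mul_of_nonneg_left h3 hβ
    linarith
  have h0 : f 0 = 0 := by simp [f]
  have h1 := hmono (left_mem_Icc.2 (hτ0.trans hτ)) ⟨hτ0, hτ⟩ hτ0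
  rw [h0] at h1
  rw [hre, hre]
  simp only [f] at h1
  linarith

theorem integral_mul_ge_of_odd {ψ : ℝ → ℝ} (hψ : IsOddKernel ψ) {r : ℝ → ℝ} (hr : Continuous r)
    {ε κ : ℝ} (h : ∀ t, 0 ≤ t → t ≤ 1 → 2 * (ε * t) * κ ≤ r (ε * t) - r (-(ε * t))) :
    ε * κ ≤ ∫ t, ψ t * r (ε * t) := by
  have hψc := hψ.contDiff.continuous
  have hint : ∀ g : ℝ → ℝ, Continuous g → Integrable fun t => ψ t * g t := fun g hg =>
    (hψc.mul hg).integrable_of_hasCompactSupport (HasCompactSupport.intro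
      (isCompact_Icc (a := (-1 : ℝ)) (b := 1)) fun t ht => by
        change ψ t * g t = 0
        rw [hψ.eq_zero t (by rw [mem_Icc, ← abs_le] at ht; exact not_le.1 ht), zero_mul])
  have i1 := hint (fun t => r (ε * t)) (by fun_prop)
  have i2 := hint (fun t => r (-(ε * t))) (by fun_prop)
  have i3 := hint (fun t => 2 * (ε * t) * κ) (by fun_prop)
  have e1 : ∫ t, ψ t * r (-(ε * t)) = -∫ t, ψ t * r (ε * t) := by
    rw [← integral_neg_eq_self, ← integral_neg]
    congr 1 with t
    rw [hψ.odd]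
    ring_nf
  have e2 : ∫ t, ψ t * (2 * (ε * t) * κ) = 2 * (ε * κ) := by
    have : ∀ t, ψ t * (2 * (ε * t) * κ) = 2 * (ε * κ) * (t * ψ t) := fun t => by ring
    simp only [this]
    rw [integral_const_mul, hψ.integral_mul, mul_one]
  have h2 : ∫ t, ψ t * (2 * (ε * t) * κ) ≤ ∫ t, (ψ t * r (ε * t) - ψ t * r (-(ε * t))) := by
    refine integral_mono i3 (i1.sub i2) fun t => ?_
    simp only
    rw [← mul_sub]
    by_cases ht : 1 < |t|
    · simp [hψ.eq_zero t ht]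
    rw [not_lt, abs_le] at ht
    rcases le_total 0 t with h0 | h0
    · exact mul_le_mul_of_nonneg_left (h t h0 ht.2) (hψ.nonneg t h0)
    · have h3 := mul_le_mul_of_nonneg_left (h (-t) (by linarith) (by linarith))
        (hψ.nonneg (-t) (by linarith))
      rw [hψ.odd] at h3
      simp only [mul_neg, neg_neg] at h3
      linarith
  rw [integral_sub i1 i2, e1, e2] at h2
  linarith

/-- The regularized operator dominates `ε` times the positive form of the commutator. -/
theorem exists_forall_im_inner_regularize_le (hA : IsSelfAdjoint A) (hH : ClassC11 A H)
    (hR : ClassC A 1 (ℜ H : E →L[ℂ] E)) {ψ : ℝ → ℝ} (hψ : IsOddKernel ψ) {a c β : ℝ} (ha : 0 < a)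
    (hc : 0 ≤ c) (hβ : 0 ≤ β) :
    ∃ ε₀ : ℝ, 0 < ε₀ ∧ ε₀ ≤ 1 ∧ ∀ ε, 0 < ε → ε ≤ ε₀ → ∀ x : ℝ,
      (∀ u : E, a * ‖u‖ ^ 2 - c * ‖(ℜ H : E →L[ℂ] E) u - (x : ℂ) • u‖ ^ 2
        ≤ (inner ℂ u ((Complex.I • ad A (ℜ H : E →L[ℂ] E)) u)).re
          + β * (sigmaPlus H * ‖u‖ ^ 2 - (inner ℂ u (H u)).im)) →
      ∀ w : E, (inner ℂ w (regularize ψ (conjugate A H) ε w)).im ≤ (inner ℂ w (H w)).im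
        - ε * (a / 2 * ‖w‖ ^ 2 - 2 * c * ‖(ℜ H : E →L[ℂ] E) w - (x : ℂ) • w‖ ^ 2
          - β * (sigmaPlus H * ‖w‖ ^ 2 - (inner ℂ w (H w)).im)) := by
  have hWc := hH.continuous_conjugate hA
  have hωc := hH.continuous_secondDiff hA
  have hωi := hH.intervalIntegrable hA
  have hψc := hψ.contDiff.continuous
  let k : ℝ → ℂ := fun t => (t : ℂ) * (ψ t : ℂ)
  have hk : Continuous k := Complex.continuous_ofReal.mul (Complex.continuous_ofReal.comp hψc)
  have hk0 : ∀ t, 1 < |t| → k t = 0 := fun t ht => by simp [k, hψ.eq_zero t ht]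
  obtain ⟨M, hM0, hM⟩ := exists_bound_of_eq_zero hk hk0
  set d : ℝ := Real.sqrt (a / (8 * (c + 1))) with hd
  have hdpos : 0 < d := Real.sqrt_pos.2 (by positivity)
  have hd2 : 2 * c * d ^ 2 ≤ a / 4 := by
    rw [hd, Real.sq_sqrt (by positivity), mul_div_assoc', div_le_iff₀ (by positivity)]
    nlinarith
  set I : ℝ → ℝ := fun ε => ∫ τ in (0 : ℝ)..ε, secondDiff A H τ / τ ^ 2 with hI
  have hItend : Tendsto (fun ε => (β / 2 + M) * I ε) (𝓝[>] 0) (𝓝 0) := by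
    simpa using (tendsto_integral_div_sq hωi).const_mul (β / 2 + M)
  have hcont0 : Tendsto (fun τ => ‖conjugate A H τ - H‖) (𝓝 0) (𝓝 0) := by
    have : Continuous fun τ => ‖conjugate A H τ - H‖ := by fun_prop
    simpa [conjugate_zero hA] using this.tendsto 0
  obtain ⟨ε₁, hε₁, h₁⟩ := Metric.eventually_nhds_iff.1 (hcont0.eventually (gt_mem_nhds hdpos))
  obtain ⟨ε₂, hε₂, h₂⟩ := mem_nhdsGT_iff_exists_Ioo_subset.1
    (hItend.eventually (gt_mem_nhds (by positivity : 0 < a / 4)))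
  have hε₂' : 0 < ε₂ := hε₂
  refine ⟨min 1 (min (ε₁ / 2) (ε₂ / 2)), by positivity, min_le_left _ _, ?_⟩
  intro ε hε hεle x hx w
  have hε1 : ε ≤ 1 := hεle.trans (min_le_left _ _)
  have hεε₁ : ε ≤ ε₁ / 2 := hεle.trans ((min_le_right _ _).trans (min_le_left _ _))
  have hεε₂ : ε ≤ ε₂ / 2 := hεle.trans ((min_le_right _ _).trans (min_le_right _ _))
  have hIε : (β / 2 + M) * I ε < a / 4 := h₂ ⟨hε, by linarith⟩
  have hI0 : ∀ {τ}, 0 ≤ τ → 0 ≤ I τ := fun {τ} hτ =>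
    intervalIntegral.integral_nonneg hτ fun σ _ => div_nonneg (secondDiff_nonneg σ) (sq_nonneg σ)
  have hN : ∀ {τ}, 0 ≤ τ → τ ≤ ε → ∫ σ in (0 : ℝ)..τ, secondDiff A H σ ≤ τ ^ 2 * I ε := by
    intro τ h0 h1
    rcases h0.eq_or_lt with rfl | h0'
    · simp
    refine (integral_le_sq_mul hωc secondDiff_nonneg hωi h0' (h1.trans hε1)).trans ?_
    gcongr
    refine intervalIntegral.integral_mono_interval le_rfl h0 h1
      (Eventually.of_forall fun σ => div_nonneg (secondDiff_nonneg σ) (sq_nonneg σ))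
      (intervalIntegrable_of_le_one hωi hε.le hε1)
  set ρ := ‖(ℜ H : E →L[ℂ] E) w - (x : ℂ) • w‖ with hρ
  set v := sigmaPlus H * ‖w‖ ^ 2 - (inner ℂ w (H w)).im with hv
  set h : ℝ → ℂ := fun τ => inner ℂ w (conjugate A H τ w) with hh
  have hhc : Continuous h := continuous_const.inner (continuous_conjugate_apply hA H w)
  have hh0 : h 0 = inner ℂ w (H w) := by simp only [hh, conjugate_zero hA]
  -- the odd part of the kernel
  have hodd := integral_mul_ge_of_odd hψ (r := fun τ => (h τ).re) (ε := ε)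
    (κ := a * ‖w‖ ^ 2 - 2 * c * ρ ^ 2 - 2 * c * d ^ 2 * ‖w‖ ^ 2 - β * v
      - β / 2 * I ε * ‖w‖ ^ 2) (Complex.continuous_re.comp hhc) (by
    intro t ht0 ht1
    have hτ0 : 0 ≤ ε * t := by positivity
    have hτ1 : ε * t ≤ ε := by nlinarith
    have h3 := le_re_inner_conjugate_sub hA hH hR hc hβ hx (ε := ε) (fun τ hτ =>
      (h₁ (by rw [Real.dist_eq, sub_zero]; linarith)).le) w hτ0 hτ1
    refine le_trans ?_ h3
    have h4 : ∫ σ in (0 : ℝ)..(ε * t), secondDiff A H σ ≤ ε * t * I ε := by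
      refine (hN hτ0 hτ1).trans ?_
      have := hI0 hε.le
      rw [sq]
      gcongr
      nlinarith
    have h5 := mul_le_mul_of_nonneg_left h4 (by positivity : 0 ≤ β * ‖w‖ ^ 2)
    linarith)
  -- the even part of the kernel
  have heven := norm_integral_even_smul_sub_le hk hhc hk0
    (fun t => by simp [k, hψ.odd]) hM hε
  rw [hψ.integral_ofReal_mul, one_smul, hh0] at heven
  have hNw : ∫ τ in (0 : ℝ)..ε, ‖h τ + h (-τ) - (2 : ℂ) • inner ℂ w (H w)‖
      ≤ ‖w‖ ^ 2 * (ε ^ 2 * I ε) := by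
    calc _ ≤ ∫ τ in (0 : ℝ)..ε, ‖w‖ ^ 2 * secondDiff A H τ := by
          refine intervalIntegral.integral_mono_on hε.le
            (Continuous.intervalIntegrable (by fun_prop) _ _)
            ((continuous_const.mul hωc).intervalIntegrable _ _) fun τ _ => ?_
          have e : h τ + h (-τ) - (2 : ℂ) • inner ℂ w (H w)
              = inner ℂ w ((conjugate A H τ + conjugate A H (-τ) - (2 : ℂ) • H) w) := by
            simp only [hh, sub_apply, add_apply, smul_apply, inner_sub_right, inner_add_right,
              inner_smul_right, smul_eq_mul]
          rw [e]
          calc _ ≤ ‖w‖ * (secondDiff A H τ * ‖w‖) :=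
                (norm_inner_le_norm _ _).trans (by gcongr; exact ContinuousLinearMap.le_opNorm _ _)
            _ = _ := by ring
      _ = ‖w‖ ^ 2 * ∫ τ in (0 : ℝ)..ε, secondDiff A H τ := intervalIntegral.integral_const_mul _ _
      _ ≤ _ := by gcongr; exact hN hε.le le_rfl
  have heven2 : (∫ t, k t • h (ε * t)).im ≤ (inner ℂ w (H w)).im + ε * (M * I ε * ‖w‖ ^ 2) := by
    have h3 : M * ε⁻¹ * (∫ τ in (0 : ℝ)..ε, ‖h τ + h (-τ) - (2 : ℂ) • inner ℂ w (H w)‖)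
        ≤ ε * (M * I ε * ‖w‖ ^ 2) := by
      calc _ ≤ M * ε⁻¹ * (‖w‖ ^ 2 * (ε ^ 2 * I ε)) := by gcongr
        _ = _ := by field_simp
    have h4 := (Complex.im_le_norm _).trans (heven.trans h3)
    rw [Complex.sub_im] at h4
    linarith
  -- decomposition of the form of the regularized operator
  have hform : inner ℂ w (regularize ψ (conjugate A H) ε w) = ∫ t, cKernel ψ t • h (ε * t) := by
    have hi : Integrable fun t => cKernel ψ t • conjugate A H (ε * t) :=
      integrable_kernel_smul hψ.contDiff_cKernel.continuous (hWc.comp (continuous_const_mul ε))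
        hψ.cKernel_eq_zero
    rw [regularize, ContinuousLinearMap.integral_apply hi]
    have h5 := (innerSL ℂ w).integral_comp_comm (hi.apply_continuousLinearMap w)
    rw [innerSL_apply_apply] at h5
    rw [← h5]
    congr 1 with t
    simp [hh]
  have hψ0 : ∀ t, 1 < |t| → (ψ t : ℂ) = 0 := fun t ht => by simp [hψ.eq_zero t ht]
  have j1 : Integrable fun t => k t • h (ε * t) :=
    integrable_kernel_smul hk (hhc.comp (continuous_const_mul ε)) hk0
  have j2 : Integrable fun t => (ψ t : ℂ) • h (ε * t) :=
    integrable_kernel_smul (Complex.continuous_ofReal.comp hψc)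
      (hhc.comp (continuous_const_mul ε)) hψ0
  have hdec : (inner ℂ w (regularize ψ (conjugate A H) ε w)).im
      = (∫ t, k t • h (ε * t)).im - ∫ t, ψ t * (h (ε * t)).re := by
    have e1 : ∀ t, cKernel ψ t • h (ε * t)
        = k t • h (ε * t) - Complex.I * ((ψ t : ℂ) • h (ε * t)) := fun t => by
      simp only [cKernel, k, smul_eq_mul]; ring
    have e2 : (∫ t, (ψ t : ℂ) • h (ε * t)).re = ∫ t, ψ t * (h (ε * t)).re := by
      have := integral_re j2
      simp only [smul_eq_mul, RCLike.re_eq_complex_re, Complex.re_ofReal_mul] at this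
      exact this.symm
    rw [hform]
    simp only [e1]
    rw [integral_sub j1 (j2.const_mul _), integral_const_mul, Complex.sub_im, Complex.I_mul_im, e2]
  rw [hdec]
  have h6 : ε * ((a / 2 * ‖w‖ ^ 2 - 2 * c * ρ ^ 2 - β * v) + M * I ε * ‖w‖ ^ 2)
      ≤ ε * (a * ‖w‖ ^ 2 - 2 * c * ρ ^ 2 - 2 * c * d ^ 2 * ‖w‖ ^ 2 - β * v
        - β / 2 * I ε * ‖w‖ ^ 2) := by
    gcongr
    have h7 : (2 * c * d ^ 2 + (β / 2 + M) * I ε) * ‖w‖ ^ 2 ≤ a / 2 * ‖w‖ ^ 2 := by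
      gcongr
      linarith
    linarith
  linarith

end Regularized

/-! ### Coercivity and invertibility -/

section Coercive

omit [CompleteSpace E] in
theorem norm_inner_self (x : E) : ‖(inner ℂ x x : ℂ)‖ = ‖x‖ ^ 2 := by
  rw [inner_self_eq_norm_sq_to_K]
  simp

/-- Absorption of the error terms of the positive commutator estimate. The quadratic form bound
`h1` controls `n = ‖w‖` up to `ρ = ‖(Re H - x) w‖`, and `h2` bounds `ρ` by `t = ‖T w‖` and by
quantities that `h1` controls. -/
theorem mul_sq_le_of_quadratic_bounds {a c β y v ε m n ρ t q κ Q : ℝ} (hc : 0 ≤ c) (hv : 0 ≤ v)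
    (hy0 : 0 ≤ y) (hy1 : y ≤ 1) (hε : 0 ≤ ε) (hρ : 0 ≤ ρ)
    (h1 : y * n ^ 2 + v + ε * (a / 2 * n ^ 2 - 2 * c * ρ ^ 2 - β * v) ≤ m)
    (h2 : ρ ≤ t + y * n + q + κ * n) (h3 : q ^ 2 ≤ Q * v)
    (s1 : 8 * c * ε ≤ 1) (s2 : ε * (8 * c * Q + β) ≤ 1) (s3 : 8 * c * κ ^ 2 ≤ a / 4) :
    a * ε / 4 * n ^ 2 ≤ m + 8 * c * ε * t ^ 2 := by
  have h4 : ρ ^ 2 ≤ 4 * (t ^ 2 + y ^ 2 * n ^ 2 + Q * v + κ ^ 2 * n ^ 2) := by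
    have h5 : ρ ^ 2 ≤ (t + y * n + q + κ * n) ^ 2 := by gcongr
    nlinarith [sq_nonneg (t - y * n), sq_nonneg (t - q), sq_nonneg (t - κ * n),
      sq_nonneg (y * n - q), sq_nonneg (y * n - κ * n), sq_nonneg (q - κ * n)]
  have hcε : 0 ≤ 2 * c * ε := by positivity
  have h5 := mul_le_mul_of_nonneg_left h4 hcε
  have h6 : 8 * c * ε * (y ^ 2 * n ^ 2) ≤ 1 * (y * n ^ 2) := by
    gcongr
    nlinarith
  have h7 : ε * (8 * c * Q + β) * v ≤ 1 * v := by gcongr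
  have h8 : ε * (8 * c * κ ^ 2) * n ^ 2 ≤ ε * (a / 4) * n ^ 2 := by gcongr
  linarith

theorem isUnit_of_norm_le {T : E →L[ℂ] E} {c : ℝ} (hc : 0 < c)
    (h1 : ∀ w, c * ‖w‖ ≤ ‖T w‖) (h2 : ∀ w, c * ‖w‖ ≤ ‖star T w‖) : IsUnit T := by
  have key : ∀ S : E →L[ℂ] E, (∀ w, c * ‖w‖ ≤ ‖S w‖) → IsUnit (star S * S) := by
    intro S hS
    refine ContinuousLinearMap.isUnit_of_forall_le_norm_inner_map _ (c := ⟨c ^ 2, by positivity⟩)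
      (by exact_mod_cast (by positivity : 0 < c ^ 2)) fun x => ?_
    rw [mul_apply_eq_comp, ContinuousLinearMap.star_eq_adjoint,
      ContinuousLinearMap.adjoint_inner_left, norm_inner_self]
    have := hS x
    calc ‖x‖ ^ 2 * c ^ 2 = (c * ‖x‖) ^ 2 := by ring
      _ ≤ ‖S x‖ ^ 2 := by gcongr
  obtain ⟨a, ha⟩ := key T h1
  obtain ⟨b, hb⟩ := key (star T) h2
  rw [star_star] at hb
  refine isUnit_iff_exists_and_exists.2 ⟨⟨star T * ((b⁻¹ : (E →L[ℂ] E)ˣ) : E →L[ℂ] E), ?_⟩,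
    ⟨((a⁻¹ : (E →L[ℂ] E)ˣ) : E →L[ℂ] E) * star T, ?_⟩⟩
  · rw [← mul_assoc, ← hb, Units.mul_inv]
  · rw [mul_assoc, ← ha, Units.inv_mul]

/-- A coercivity estimate for `T` and its adjoint makes `T` invertible, with a bound of the
inverse. -/
theorem isUnit_of_quadratic_bound {T : E →L[ℂ] E} {b e : ℝ} (hb : 0 < b) (he : 0 ≤ e)
    (h1 : ∀ w, b * ‖w‖ ^ 2 ≤ |(inner ℂ w (T w)).im| + e * ‖T w‖ ^ 2)
    (h2 : ∀ w, b * ‖w‖ ^ 2 ≤ |(inner ℂ w (star T w)).im| + e * ‖star T w‖ ^ 2) :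
    IsUnit T ∧ ‖Ring.inverse T‖ ≤ Real.sqrt ((2 * b⁻¹ + 2 * e) / b) := by
  set D := (2 * b⁻¹ + 2 * e) / b with hD
  have hDpos : 0 < D := by positivity
  have key : ∀ S : E →L[ℂ] E, (∀ w, b * ‖w‖ ^ 2 ≤ |(inner ℂ w (S w)).im| + e * ‖S w‖ ^ 2) →
      ∀ w, ‖w‖ ≤ Real.sqrt D * ‖S w‖ := by
    intro S hS w
    have h3 : |(inner ℂ w (S w)).im| ≤ ‖w‖ * ‖S w‖ :=
      (Complex.abs_im_le_norm _).trans (norm_inner_le_norm _ _)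
    have h4 : ‖w‖ * ‖S w‖ ≤ b / 2 * ‖w‖ ^ 2 + b⁻¹ * ‖S w‖ ^ 2 := by
      have h5 : 0 ≤ b⁻¹ / 2 * (b * ‖w‖ - ‖S w‖) ^ 2 := by positivity
      have h6 : b⁻¹ / 2 * (b * ‖w‖ - ‖S w‖) ^ 2
          = b / 2 * ‖w‖ ^ 2 - ‖w‖ * ‖S w‖ + b⁻¹ / 2 * ‖S w‖ ^ 2 := by field_simp; ring
      have h7 : 0 ≤ b⁻¹ / 2 * ‖S w‖ ^ 2 := by positivity
      linarith
    have h5 : ‖w‖ ^ 2 ≤ D * ‖S w‖ ^ 2 := by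
      rw [hD, div_mul_eq_mul_div, le_div_iff₀ hb]
      have := hS w
      linarith
    calc ‖w‖ = Real.sqrt (‖w‖ ^ 2) := (Real.sqrt_sq (norm_nonneg w)).symm
      _ ≤ Real.sqrt (D * ‖S w‖ ^ 2) := Real.sqrt_le_sqrt h5
      _ = Real.sqrt D * ‖S w‖ := by
          rw [Real.sqrt_mul hDpos.le, Real.sqrt_sq (norm_nonneg _)]
  have hsD : 0 < Real.sqrt D := Real.sqrt_pos.2 hDpos
  have hu : IsUnit T := by
    refine isUnit_of_norm_le (inv_pos.2 hsD) (fun w => ?_) fun w => ?_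
    · rw [inv_mul_le_iff₀ hsD]; exact key T h1 w
    · rw [inv_mul_le_iff₀ hsD]; exact key (star T) h2 w
  refine ⟨hu, ContinuousLinearMap.opNorm_le_bound _ hsD.le fun x => ?_⟩
  have h3 := key T h1 (Ring.inverse T x)
  rwa [← mul_apply_eq_comp T, Ring.mul_inverse_cancel T hu, one_apply_eq_self] at h3

theorem im_inner_star_apply (T : E →L[ℂ] E) (w : E) :
    (inner ℂ w (star T w)).im = -(inner ℂ w (T w)).im := by
  rw [ContinuousLinearMap.star_eq_adjoint, ContinuousLinearMap.adjoint_inner_right,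
    ← inner_conj_symm, Complex.conj_im]

omit [CompleteSpace E] in
theorem im_inner_algebraMap_sub (K : E →L[ℂ] E) (z : ℂ) (w : E) :
    (inner ℂ w ((algebraMap ℂ (E →L[ℂ] E) z - K) w)).im
      = z.im * ‖w‖ ^ 2 - (inner ℂ w (K w)).im := by
  rw [Algebra.algebraMap_eq_smul_one, sub_apply, smul_apply, one_apply_eq_self, inner_sub_right,
    inner_smul_right, inner_self_eq_norm_sq_to_K, Complex.sub_im]
  congr 1
  have : ((‖w‖ : ℂ) ^ 2) = ((‖w‖ ^ 2 : ℝ) : ℂ) := by push_cast; rfl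
  exact (congrArg (fun c => (z * c).im) this).trans (Complex.im_mul_ofReal _ _)

/-- The resolvent set of `H` contains the half plane above the numerical range. -/
theorem mem_resolventSet_of_sigmaPlus_lt {H : E →L[ℂ] E} {z : ℂ} (hz : sigmaPlus H < z.im) :
    z ∈ resolventSet ℂ H ∧ ‖resolvent H z‖ ≤ (z.im - sigmaPlus H)⁻¹ := by
  set y := z.im - sigmaPlus H with hy
  have hy0 : 0 < y := sub_pos.2 hz
  set T := algebraMap ℂ (E →L[ℂ] E) z - H with hT
  have h1 : ∀ w, y * ‖w‖ ^ 2 ≤ (inner ℂ w (T w)).im := fun w => by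
    rw [hT, im_inner_algebraMap_sub]
    have := im_inner_le_sigmaPlus H w
    linarith
  have hb : ∀ S : E →L[ℂ] E, (∀ w, y * ‖w‖ ^ 2 ≤ |(inner ℂ w (S w)).im|) →
      ∀ w, y * ‖w‖ ≤ ‖S w‖ := by
    intro S hS w
    rcases (norm_nonneg w).eq_or_lt with h0 | h0
    · rw [← h0, mul_zero]; exact norm_nonneg _
    have h2 := (hS w).trans ((Complex.abs_im_le_norm _).trans (norm_inner_le_norm _ _))
    refine le_of_mul_le_mul_left ?_ h0
    linarith
  have h2 := hb T fun w => (h1 w).trans (le_abs_self _)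
  have hu : IsUnit T := isUnit_of_norm_le hy0 h2 (hb (star T) fun w => by
    rw [im_inner_star_apply, abs_neg]
    exact (h1 w).trans (le_abs_self _))
  refine ⟨hu, ContinuousLinearMap.opNorm_le_bound _ (by positivity) fun x => ?_⟩
  have h3 := h2 (resolvent H z x)
  rw [← mul_apply_eq_comp T, resolvent, Ring.mul_inverse_cancel T hu, one_apply_eq_self,
    ← le_inv_mul_iff₀ hy0] at h3
  exact h3

/-- The coercivity of `z - K` and of its adjoint, for a perturbation `K` of `H` whose imaginary part
satisfies the bound `hK`. -/
theorem quadratic_bound_of_im_inner_le {H K : E →L[ℂ] E} {a c β ε κ : ℝ} {z : ℂ} (hc : 0 ≤ c)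
    (hε : 0 ≤ ε) (hz0 : sigmaPlus H ≤ z.im) (hz1 : z.im ≤ sigmaPlus H + 1)
    (hK : ∀ w : E, (inner ℂ w (K w)).im ≤ (inner ℂ w (H w)).im
        - ε * (a / 2 * ‖w‖ ^ 2 - 2 * c * ‖(ℜ H : E →L[ℂ] E) w - (z.re : ℂ) • w‖ ^ 2
          - β * (sigmaPlus H * ‖w‖ ^ 2 - (inner ℂ w (H w)).im)))
    (hκ : ‖K - H‖ ≤ κ) (s1 : 8 * c * ε ≤ 1)
    (s2 : ε * (8 * c * (‖(sigmaPlus H : ℂ) • (1 : E →L[ℂ] E) - (ℑ H : E →L[ℂ] E)‖ + 1) + β) ≤ 1)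
    (s3 : 8 * c * κ ^ 2 ≤ a / 4) (w : E) :
    a * ε / 4 * ‖w‖ ^ 2 ≤ |(inner ℂ w ((algebraMap ℂ (E →L[ℂ] E) z - K) w)).im|
      + 8 * c * ε * ‖(algebraMap ℂ (E →L[ℂ] E) z - K) w‖ ^ 2 ∧
    a * ε / 4 * ‖w‖ ^ 2 ≤ |(inner ℂ w (star (algebraMap ℂ (E →L[ℂ] E) z - K) w)).im|
      + 8 * c * ε * ‖star (algebraMap ℂ (E →L[ℂ] E) z - K) w‖ ^ 2 := by
  set σ := sigmaPlus H with hσ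
  set V : E →L[ℂ] E := (σ : ℂ) • (1 : E →L[ℂ] E) - (ℑ H : E →L[ℂ] E) with hV
  set T := algebraMap ℂ (E →L[ℂ] E) z - K with hT
  set R : E →L[ℂ] E := (ℜ H : E →L[ℂ] E) with hR
  set J : E →L[ℂ] E := (ℑ H : E →L[ℂ] E) with hJ
  have hVsa : IsSelfAdjoint V := by
    refine IsSelfAdjoint.sub ?_ (isSelfAdjoint_imaginaryPart H)
    rw [IsSelfAdjoint, star_smul, star_one]
    simp
  have hVform : ∀ u, (inner ℂ u (V u)).re = σ * ‖u‖ ^ 2 - (inner ℂ u (H u)).im := fun u => by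
    rw [im_inner_apply, hV, sub_apply, smul_apply, one_apply_eq_self, inner_sub_right,
      inner_smul_right, inner_self_eq_norm_sq_to_K, Complex.sub_re, Complex.re_ofReal_mul]
    norm_cast
  have hV0 : ∀ u, 0 ≤ (inner ℂ u (V u)).re := fun u => by
    rw [hVform]
    have := im_inner_le_sigmaPlus H u
    linarith
  have hV2 := norm_sq_apply_le_of_nonneg hVsa hV0 w
  rw [hVform] at hV2
  have hv0 := hV0 w
  rw [hVform] at hv0
  set v := σ * ‖w‖ ^ 2 - (inner ℂ w (H w)).im with hv
  have hy0 : 0 ≤ z.im - σ := by linarith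
  have hform : (z.im - σ) * ‖w‖ ^ 2 + v + ε * (a / 2 * ‖w‖ ^ 2
      - 2 * c * ‖R w - (z.re : ℂ) • w‖ ^ 2 - β * v) ≤ (inner ℂ w (T w)).im := by
    rw [hT, im_inner_algebraMap_sub]
    have := hK w
    linarith
  have hzw : z • w = (z.re : ℂ) • w + Complex.I • ((z.im : ℂ) • w) := by
    conv_lhs => rw [← Complex.re_add_im z]
    rw [add_smul, smul_smul, mul_comm Complex.I]
  have hTw : T w = z • w - K w := by
    rw [hT, Algebra.algebraMap_eq_smul_one]; rfl
  have hVw : V w = (σ : ℂ) • w - J w := rfl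
  have hw0 := norm_nonneg w
  have hDw : ‖(K - H) w‖ ≤ κ * ‖w‖ := ContinuousLinearMap.le_of_opNorm_le _ hκ w
  have hDw' : ‖star (K - H) w‖ ≤ κ * ‖w‖ :=
    ContinuousLinearMap.le_of_opNorm_le _ (by rwa [norm_star]) w
  have hyn : ‖Complex.I • (((z.im - σ : ℝ) : ℂ) • w)‖ = (z.im - σ) * ‖w‖ := by
    rw [norm_smul, norm_smul, Complex.norm_I, one_mul, Complex.norm_real, Real.norm_of_nonneg hy0]
  have hIV : ‖Complex.I • V w‖ = ‖V w‖ := by rw [norm_smul, Complex.norm_I, one_mul]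
  have hρ1 : ‖R w - (z.re : ℂ) • w‖ ≤ ‖T w‖ + (z.im - σ) * ‖w‖ + ‖V w‖ + κ * ‖w‖ := by
    have e : R w - (z.re : ℂ) • w = -T w + Complex.I • (((z.im - σ : ℝ) : ℂ) • w)
        + Complex.I • V w + -(K - H) w := by
      rw [hTw, hzw, hVw, sub_apply, realPart_apply_add H w, Complex.ofReal_sub, sub_smul,
        smul_sub, smul_sub]
      abel
    rw [e]
    refine (norm_add₄_le).trans ?_
    rw [norm_neg, hyn, hIV, norm_neg]
    gcongr
  have hρ2 : ‖R w - (z.re : ℂ) • w‖ ≤ ‖star T w‖ + (z.im - σ) * ‖w‖ + ‖V w‖ + κ * ‖w‖ := by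
    have hsT : star T w = (starRingEnd ℂ z) • w - star K w := by
      rw [hT, star_sub, ← algebraMap_star_comm, Algebra.algebraMap_eq_smul_one]; rfl
    have hsH : star H w = R w - Complex.I • J w := by
      have h1 : star H = R - Complex.I • J := by
        conv_lhs => rw [← realPart_add_I_smul_imaginaryPart H]
        rw [star_add, star_smul, (isSelfAdjoint_realPart H).star_eq,
          (isSelfAdjoint_imaginaryPart H).star_eq]
        simp [sub_eq_add_neg]
        rfl
      rw [h1]; rfl
    have hzw' : (starRingEnd ℂ z) • w = (z.re : ℂ) • w - Complex.I • ((z.im : ℂ) • w) := by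
      conv_lhs => rw [← Complex.re_add_im z]
      rw [map_add, map_mul, Complex.conj_I, Complex.conj_ofReal, Complex.conj_ofReal, add_smul,
        smul_smul, mul_neg, neg_smul, mul_comm Complex.I, sub_eq_add_neg]
    have e : R w - (z.re : ℂ) • w = -star T w + -(Complex.I • (((z.im - σ : ℝ) : ℂ) • w))
        + -(Complex.I • V w) + -star (K - H) w := by
      rw [hsT, hzw', hVw, star_sub, sub_apply, hsH, Complex.ofReal_sub, sub_smul,
        smul_sub, smul_sub]
      abel
    rw [e]
    refine (norm_add₄_le).trans ?_
    rw [norm_neg, norm_neg, norm_neg, norm_neg, hyn, hIV]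
    gcongr
  constructor
  · exact mul_sq_le_of_quadratic_bounds hc hv0 hy0 (by linarith) hε (norm_nonneg _)
      (hform.trans (le_abs_self _)) hρ1 hV2 s1 s2 s3
  · refine mul_sq_le_of_quadratic_bounds hc hv0 hy0 (by linarith) hε (norm_nonneg _)
      (hform.trans ?_) hρ2 hV2 s1 s2 s3
    rw [im_inner_star_apply, abs_neg]
    exact le_abs_self _

end Coercive

/-! ### The differential inequality -/

section DifferentialInequality

/-- A Gronwall estimate on `(0, ε₀]` for a coefficient `Φ'` with a bounded primitive. -/
theorem norm_sq_le_of_deriv_le {f f' : ℝ → ℂ} {Φ Φ' : ℝ → ℝ} {ε₀ : ℝ}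
    (hf : ∀ ε, 0 < ε → ε ≤ ε₀ → HasDerivAt f (f' ε) ε)
    (hΦ : ∀ ε, 0 < ε → ε ≤ ε₀ → HasDerivAt Φ (Φ' ε) ε)
    (hΦ0 : ∀ ε, 0 < ε → ε ≤ ε₀ → 0 ≤ Φ ε)
    (hle : ∀ ε, 0 < ε → ε ≤ ε₀ → ‖f' ε‖ ≤ Φ' ε * (1 + ‖f ε‖)) {ε : ℝ} (h0 : 0 < ε)
    (h1 : ε ≤ ε₀) : ‖f ε‖ ^ 2 ≤ (1 + ‖f ε₀‖ ^ 2) * Real.exp (4 * Φ ε₀) := by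
  have hd : ∀ η, 0 < η → η ≤ ε₀ → HasDerivAt (fun η => Real.log (1 + ‖f η‖ ^ 2) + 4 * Φ η)
      (2 * inner ℝ (f η) (f' η) / (1 + ‖f η‖ ^ 2) + 4 * Φ' η) η := fun η h h' =>
    ((((hf η h h').norm_sq).const_add 1).log (by positivity)).add ((hΦ η h h').const_mul 4)
  have hmono : MonotoneOn (fun η => Real.log (1 + ‖f η‖ ^ 2) + 4 * Φ η) (Icc ε ε₀) := by
    refine monotoneOn_of_deriv_nonneg (convex_Icc ε ε₀)
      (fun η hη => (hd η (h0.trans_le hη.1) hη.2).continuousAt.continuousWithinAt)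
      (fun η hη => ?_) fun η hη => ?_
    · rw [interior_Icc] at hη
      exact (hd η (h0.trans hη.1) hη.2.le).differentiableAt.differentiableWithinAt
    · rw [interior_Icc] at hη
      have hη0 := h0.trans hη.1
      rw [(hd η hη0 hη.2.le).deriv]
      have h2 := hle η hη0 hη.2.le
      have hΦ' : 0 ≤ Φ' η := by
        have h3 := (norm_nonneg _).trans h2
        exact nonneg_of_mul_nonneg_left h3 (by positivity)
      have h3 : -(‖f η‖ * (Φ' η * (1 + ‖f η‖))) ≤ inner ℝ (f η) (f' η) := by
        have h4 := neg_le_of_abs_le (abs_real_inner_le_norm (f η) (f' η))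
        have h5 := mul_le_mul_of_nonneg_left h2 (norm_nonneg (f η))
        linarith
      have h4 : 0 < 1 + ‖f η‖ ^ 2 := by positivity
      rw [← neg_le_iff_add_nonneg, ← neg_mul, le_div_iff₀ h4]
      nlinarith [mul_nonneg hΦ' (sq_nonneg (‖f η‖ - 1))]
  have h2 := hmono (left_mem_Icc.2 h1) (right_mem_Icc.2 h1) h1
  simp only at h2
  have h3 := hΦ0 ε h0 h1
  have h4 : Real.log (1 + ‖f ε‖ ^ 2) ≤ Real.log (1 + ‖f ε₀‖ ^ 2) + 4 * Φ ε₀ := by linarith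
  have h5 := (Real.log_le_iff_le_exp (by positivity)).1 h4
  rw [Real.exp_add, Real.exp_log (by positivity)] at h5
  linarith

omit [CompleteSpace E] in
/-- A bound of the quadratic form bounds the operator. -/
theorem norm_le_of_forall_norm_inner_le {T : E →L[ℂ] E} {c : ℝ} (hc : 0 ≤ c)
    (h : ∀ x, ‖inner ℂ x (T x)‖ ≤ c * ‖x‖ ^ 2) : ‖T‖ ≤ 2 * c := by
  have hpol : ∀ x y : E, ‖inner ℂ y (T x)‖ ≤ c * (‖x‖ ^ 2 + ‖y‖ ^ 2) := by
    intro x y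
    have hb : ∀ z, ‖inner ℂ (T z) z‖ ≤ c * ‖z‖ ^ 2 := fun z => by
      rw [norm_inner_symm]; exact h z
    rw [norm_inner_symm, ← ContinuousLinearMap.coe_coe T,
      inner_map_polarization (T : E →ₗ[ℂ] E) y x, norm_div, Complex.norm_ofNat,
      div_le_iff₀ (by norm_num)]
    simp only [ContinuousLinearMap.coe_coe]
    have p1 := parallelogram_law_with_norm ℂ y x
    have p2 := parallelogram_law_with_norm ℂ y (Complex.I • x)
    rw [norm_smul, Complex.norm_I, one_mul] at p2
    calc _ ≤ ‖inner ℂ (T (y + x)) (y + x)‖ + ‖inner ℂ (T (y - x)) (y - x)‖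
          + ‖Complex.I * inner ℂ (T (y + Complex.I • x)) (y + Complex.I • x)‖
          + ‖Complex.I * inner ℂ (T (y - Complex.I • x)) (y - Complex.I • x)‖ := by
            refine (norm_sub_le _ _).trans ?_
            gcongr
            refine (norm_add_le _ _).trans ?_
            gcongr
            exact norm_sub_le _ _
      _ ≤ c * ‖y + x‖ ^ 2 + c * ‖y - x‖ ^ 2 + c * ‖y + Complex.I • x‖ ^ 2
          + c * ‖y - Complex.I • x‖ ^ 2 := by
            simp only [norm_mul, Complex.norm_I, one_mul]
            gcongr <;> exact hb _
      _ = _ := by linear_combination c * p1 + c * p2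
  refine ContinuousLinearMap.opNorm_le_bound _ (by positivity) fun x => ?_
  rcases eq_or_ne (T x) 0 with h0 | h0
  · rw [h0, norm_zero]; positivity
  have hx : 0 < ‖x‖ := norm_pos_iff.2 fun hx => h0 (by rw [hx, map_zero])
  have hTx : 0 < ‖T x‖ := norm_pos_iff.2 h0
  have h1 := hpol x (((‖x‖ / ‖T x‖ : ℝ) : ℂ) • T x)
  rw [inner_smul_left, norm_mul, norm_smul, Complex.conj_ofReal, Complex.norm_real,
    norm_inner_self, Real.norm_of_nonneg (by positivity), div_mul_cancel₀ _ hTx.ne'] at h1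
  have h2 : ‖x‖ / ‖T x‖ * ‖T x‖ ^ 2 = ‖x‖ * ‖T x‖ := by field_simp
  rw [h2] at h1
  refine le_of_mul_le_mul_left ?_ hx
  linarith

variable {A : E →ₗ.[ℂ] E}

theorem conjugate_resolvent (hA : IsSelfAdjoint A) {K : E →L[ℂ] E} {z : ℂ}
    (hT : IsUnit (algebraMap ℂ (E →L[ℂ] E) z - K)) (θ : ℝ) :
    conjugate A (resolvent K z) θ = resolvent (conjugate A K θ) z := by
  have hc : ∀ B : E →L[ℂ] E, conjugate A (algebraMap ℂ (E →L[ℂ] E) z - B) θ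
      = algebraMap ℂ (E →L[ℂ] E) z - conjugate A B θ := fun B => by
    rw [conjugate_sub, Algebra.algebraMap_eq_smul_one, conjugate_smul, conjugate_one hA]
  have h1 : (algebraMap ℂ (E →L[ℂ] E) z - conjugate A K θ) * conjugate A (resolvent K z) θ = 1 := by
    rw [← hc, ← conjugate_mul hA, resolvent, Ring.mul_inverse_cancel _ hT, conjugate_one hA]
  have h2 : conjugate A (resolvent K z) θ * (algebraMap ℂ (E →L[ℂ] E) z - conjugate A K θ) = 1 := by
    rw [← hc, ← conjugate_mul hA, resolvent, Ring.inverse_mul_cancel _ hT, conjugate_one hA]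
  exact (Ring.inverse_unit ⟨_, _, h1, h2⟩).symm

theorem hasDerivAt_resolvent {K : ℝ → E →L[ℂ] E} {K' : E →L[ℂ] E} {ε : ℝ} {z : ℂ}
    (hK : HasDerivAt K K' ε) (hT : IsUnit (algebraMap ℂ (E →L[ℂ] E) z - K ε)) :
    HasDerivAt (fun ε => resolvent (K ε) z) (resolvent (K ε) z * K' * resolvent (K ε) z) ε := by
  obtain ⟨U, hU⟩ := hT
  have h1 : HasDerivAt (fun ε => algebraMap ℂ (E →L[ℂ] E) z - K ε) (-K') ε := hK.const_sub _
  have h2 := hasFDerivAt_ringInverse (𝕜 := ℝ) U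
  rw [hU] at h2
  have h3 := h2.comp_hasDerivAt ε h1
  have h4 : resolvent (K ε) z = ((U⁻¹ : (E →L[ℂ] E)ˣ) : E →L[ℂ] E) := by
    rw [resolvent, ← hU, Ring.inverse_unit]
  rw [h4]
  exact h3.congr_deriv (by simp [mul_assoc])

/-- The derivative of `ε ↦ ⟨u_ε, G_ε u_ε⟩` for `G_ε = (z - K_ε)⁻¹`. Up to the error
`∂_ε K_ε + i ∂_θ K_ε`, the derivative of `G_ε` is the commutator `A G_ε - G_ε A`, in which `A` acts
on the vectors `u_ε`. Here `v` stands for `A u_ε`. -/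
theorem exists_hasDerivAt_inner_resolvent (hA : IsSelfAdjoint A) {K : ℝ → E →L[ℂ] E}
    {K' L : E →L[ℂ] E} {ε : ℝ} {z : ℂ} (hK : HasDerivAt K K' ε)
    (hL : HasDerivAt (fun θ => conjugate A (K ε) θ) L 0)
    (hT : IsUnit (algebraMap ℂ (E →L[ℂ] E) z - K ε)) {u : ℝ → E} {u' v : E}
    (hu : HasDerivAt u u' ε)
    (hv : HasDerivAt (fun θ => expI A (-θ) (u ε)) (-(Complex.I • v)) 0) :
    ∃ f' : ℂ, HasDerivAt (fun ε => inner ℂ (u ε) (resolvent (K ε) z (u ε))) f' ε ∧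
      ‖f'‖ ≤ ‖K' + Complex.I • L‖ * ‖star (resolvent (K ε) z) (u ε)‖ * ‖resolvent (K ε) z (u ε)‖
        + (‖u'‖ + ‖v‖) * (‖star (resolvent (K ε) z) (u ε)‖ + ‖resolvent (K ε) z (u ε)‖) := by
  have happ : ∀ {B : ℝ → E →L[ℂ] E} {B' : E →L[ℂ] E} {w : ℝ → E} {w' : E} {t : ℝ},
      HasDerivAt B B' t → HasDerivAt w w' t →
      HasDerivAt (fun s => B s (w s)) (B' (w t) + B t w') t := fun {B B' w w' t} hB hw =>
    HasDerivAt.clm_apply (c := fun s => (B s).restrictScalars ℝ) (c' := B'.restrictScalars ℝ)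
      ((ContinuousLinearMap.restrictScalarsL ℂ E E ℝ ℝ).hasFDerivAt.comp_hasDerivAt t hB) hw
  set G := resolvent (K ε) z with hG
  have hG' := hasDerivAt_resolvent hK hT
  -- two expressions for the derivative of `θ ↦ ⟨u, e^{iθA} G e^{-iθA} u⟩` at `θ = 0`
  have hcomm : inner ℂ (u ε) ((G * L * G) (u ε))
      = -(Complex.I * inner ℂ (u ε) (G v)) + Complex.I * inner ℂ v (G (u ε)) := by
    have h1 : HasDerivAt (fun θ => conjugate A G θ) (G * L * G) 0 := by
      have h0 : conjugate A (K ε) 0 = K ε := conjugate_zero hA _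
      have h2 := hasDerivAt_resolvent (z := z) hL (by rwa [h0])
      simp only [h0] at h2
      refine h2.congr_of_eventuallyEq (Eventually.of_forall fun θ => ?_)
      exact conjugate_resolvent hA hT θ
    have h2 := (hasDerivAt_const (0 : ℝ) (u ε)).inner ℂ (happ h1 (hasDerivAt_const (0 : ℝ) (u ε)))
    have h3 := hv.inner ℂ (happ (hasDerivAt_const (0 : ℝ) G) hv)
    simp only [← inner_conjugate] at h3
    have h4 := h2.unique h3
    simpa [expI_zero hA, inner_add_left, inner_neg_left, inner_smul_left, inner_smul_right] using h4
  refine ⟨_, hu.inner ℂ (happ hG' hu), ?_⟩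
  have hstar : ∀ w, inner ℂ (u ε) (G w) = inner ℂ (star G (u ε)) w := fun w => by
    rw [ContinuousLinearMap.star_eq_adjoint, ContinuousLinearMap.adjoint_inner_left]
  have hK' : (G * K' * G) (u ε) = G ((K' + Complex.I • L) (G (u ε)))
      - Complex.I • (G * L * G) (u ε) := by
    simp [mul_assoc, mul_apply_eq_comp]
  have e : inner ℂ (u ε) ((G * K' * G) (u ε) + G u') + inner ℂ u' (G (u ε))
      = inner ℂ (star G (u ε)) ((K' + Complex.I • L) (G (u ε)))
        + (inner ℂ (star G (u ε)) u' - inner ℂ (star G (u ε)) v)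
        + (inner ℂ u' (G (u ε)) + inner ℂ v (G (u ε))) := by
    rw [inner_add_right, hK', inner_sub_right, inner_smul_right, hcomm, hstar, hstar, hstar]
    linear_combination (inner ℂ (star G (u ε)) v - inner ℂ v (G (u ε))) * Complex.I_sq
  rw [e]
  have n1 : ‖inner ℂ (star G (u ε)) ((K' + Complex.I • L) (G (u ε)))‖
      ≤ ‖star G (u ε)‖ * (‖K' + Complex.I • L‖ * ‖G (u ε)‖) :=
    (norm_inner_le_norm _ _).trans (by gcongr; exact ContinuousLinearMap.le_opNorm _ _)
  have n2 := norm_inner_le_norm (𝕜 := ℂ) (star G (u ε)) u'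
  have n3 := norm_inner_le_norm (𝕜 := ℂ) (star G (u ε)) v
  have n4 := norm_inner_le_norm (𝕜 := ℂ) u' (G (u ε))
  have n5 := norm_inner_le_norm (𝕜 := ℂ) v (G (u ε))
  refine norm_add₃_le.trans ?_
  have n6 := norm_sub_le (inner ℂ (star G (u ε)) u') (inner ℂ (star G (u ε)) v)
  have n7 := norm_add_le (inner ℂ u' (G (u ε))) (inner ℂ v (G (u ε)))
  linarith

theorem conjugate_regularize (hA : IsSelfAdjoint A) {H : E →L[ℂ] E} {ψ : ℝ → ℝ}
    (hψ : IsOddKernel ψ) (hW : Continuous (conjugate A H)) (ε θ : ℝ) :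
    conjugate A (regularize ψ (conjugate A H) ε) θ
      = regularize ψ (fun τ => conjugate A H (τ + θ)) ε := by
  have hi : Integrable fun t => cKernel ψ t • conjugate A H (ε * t) :=
    integrable_kernel_smul hψ.contDiff_cKernel.continuous (hW.comp (continuous_const_mul ε))
      hψ.cKernel_eq_zero
  rw [regularize, ← conjugateL_apply, ← (conjugateL A θ).integral_comp_comm hi, regularize]
  congr 1 with t
  simp [conjugateL_apply, conjugate_conjugate hA]

end DifferentialInequality

/-! ### The limiting absorption principle -/

section LimitingAbsorption

omit [CompleteSpace E] in
theorem norm_sq_inverse_apply_le {T : E →L[ℂ] E} (hT : IsUnit T) {b e : ℝ}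
    (h : ∀ w, b * ‖w‖ ^ 2 ≤ |(inner ℂ w (T w)).im| + e * ‖T w‖ ^ 2) (u : E) :
    b * ‖Ring.inverse T u‖ ^ 2 ≤ ‖inner ℂ u (Ring.inverse T u)‖ + e * ‖u‖ ^ 2 := by
  have h1 := h (Ring.inverse T u)
  rw [← mul_apply_eq_comp T, Ring.mul_inverse_cancel T hT, one_apply_eq_self] at h1
  have h2 := Complex.abs_im_le_norm (inner ℂ (Ring.inverse T u) u)
  rw [norm_inner_symm] at h2
  linarith

variable {A : E →ₗ.[ℂ] E} {H : E →L[ℂ] E} {s : ℝ}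

/-- The estimate (M+) makes `z - K_ε` and its adjoint coercive, with a constant of order `ε` that
does not depend on `z`, for the regularization `K_ε` of `H`. -/
theorem MourrePlus.exists_forall_quadratic_bound (hA : IsSelfAdjoint A) (hH : ClassC11 A H)
    {Δ : Set ℝ} (hM : MourrePlus A H Δ) (hΔ : IsOpen Δ) {δ : ℝ} (hδ : 0 < δ) {ψ : ℝ → ℝ}
    (hψ : IsOddKernel ψ) :
    ∃ a c ε₀ : ℝ, 0 < a ∧ 0 ≤ c ∧ 0 < ε₀ ∧ ε₀ ≤ 1 ∧ ∀ z : ℂ,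
      (∀ t, |t - z.re| < δ → t ∈ Δ) → sigmaPlus H ≤ z.im → z.im ≤ sigmaPlus H + 1 →
      ∀ ε, 0 < ε → ε ≤ ε₀ → ∀ T, T = algebraMap ℂ (E →L[ℂ] E) z - regularize ψ (conjugate A H) ε →
      ∀ w, a * ε / 4 * ‖w‖ ^ 2 ≤ |(inner ℂ w (T w)).im| + 8 * c * ε * ‖T w‖ ^ 2 ∧
        a * ε / 4 * ‖w‖ ^ 2 ≤ |(inner ℂ w (star T w)).im| + 8 * c * ε * ‖star T w‖ ^ 2 := by
  obtain ⟨a, c, β, ha, hc, hβ, hform⟩ := hM.exists_forall_le hΔ hδ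
  obtain ⟨ε₁, hε₁, hε₁', hreg⟩ := exists_forall_im_inner_regularize_le hA hH hM.1 hψ ha hc hβ
  set κ := Real.sqrt (a / (32 * (c + 1))) with hκ
  have hκ0 : 0 < κ := Real.sqrt_pos.2 (by positivity)
  have s3 : 8 * c * κ ^ 2 ≤ a / 4 := by
    rw [hκ, Real.sq_sqrt (by positivity), ← mul_div_assoc, div_le_div_iff₀ (by positivity)
      (by norm_num)]
    nlinarith
  have hlim := hψ.tendsto_regularize (hH.continuous_conjugate hA) (norm_conjugate_le hA H)
  rw [conjugate_zero hA] at hlim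
  obtain ⟨ε₂, hε₂, hclose⟩ := Metric.tendsto_nhds_nhds.1 hlim κ hκ0
  set B := 8 * c * (‖(sigmaPlus H : ℂ) • (1 : E →L[ℂ] E) - (ℑ H : E →L[ℂ] E)‖ + 1) + β with hB
  have hB0 : 0 ≤ B := by positivity
  refine ⟨a, c, min (min ε₁ (ε₂ / 2)) (min (8 * c + 1)⁻¹ (B + 1)⁻¹), ha, hc, by positivity,
    (min_le_left _ _).trans ((min_le_left _ _).trans hε₁'), ?_⟩
  rintro z hz hz0 hz1 ε h0 h1 T rfl w
  obtain ⟨⟨l1, l2⟩, l3, l4⟩ : (ε ≤ ε₁ ∧ ε ≤ ε₂ / 2) ∧ ε ≤ (8 * c + 1)⁻¹ ∧ ε ≤ (B + 1)⁻¹ := by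
    simpa only [le_min_iff] using h1
  refine quadratic_bound_of_im_inner_le hc h0.le hz0 hz1 (hreg ε h0 l1 z.re (hform z.re hz))
    ?_ ?_ ?_ s3 w
  · have := hclose (x := ε) (by rw [dist_zero_right, Real.norm_of_nonneg h0.le]; linarith)
    rw [dist_eq_norm] at this
    exact this.le
  · rw [le_inv_comm₀ h0 (by positivity)] at l3
    have := (le_inv_comm₀ (by positivity) h0).1 l3
    have h2 := mul_le_mul_of_nonneg_right this (by positivity : 0 ≤ 8 * c + 1)
    rw [inv_mul_cancel₀ (by positivity)] at h2
    linarith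
  · have h2 := mul_le_mul_of_nonneg_right l4 (by positivity : 0 ≤ B + 1)
    rw [inv_mul_cancel₀ (by positivity)] at h2
    linarith

/-- The uniform bound of `⟨u_ε, (z - K_ε)⁻¹ u_ε⟩`, where `u_ε = ⟨A⟩^{-s} (1 + ε |A|)⁻¹ x`. The
differential inequality in `ε` has a coefficient that is integrable at `0`, since `H` is in
`𝒞^{1,1}(A)` and `s > 1/2`. -/
theorem exists_forall_norm_inner_resolvent_le (hA : IsSelfAdjoint A) (hH : ClassC11 A H)
    (hs : 1 / 2 < s) {ψ : ℝ → ℝ} (hψ : IsOddKernel ψ) {a c ε₀ : ℝ} (ha : 0 < a) (hc : 0 ≤ c)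
    (hε₀ : 0 < ε₀) (hε₁ : ε₀ ≤ 1) :
    ∃ C : ℝ, 0 ≤ C ∧ ∀ z : ℂ,
      (∀ ε, 0 < ε → ε ≤ ε₀ → ∀ T, T = algebraMap ℂ (E →L[ℂ] E) z - regularize ψ (conjugate A H) ε →
        ∀ w, a * ε / 4 * ‖w‖ ^ 2 ≤ |(inner ℂ w (T w)).im| + 8 * c * ε * ‖T w‖ ^ 2 ∧
          a * ε / 4 * ‖w‖ ^ 2 ≤ |(inner ℂ w (star T w)).im| + 8 * c * ε * ‖star T w‖ ^ 2) →
      ∀ x : E, ‖x‖ ≤ 1 → ∀ ε, 0 < ε → ε ≤ ε₀ →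
        ‖inner ℂ (smoothedWeight A s ε x)
          (resolvent (regularize ψ (conjugate A H) ε) z (smoothedWeight A s ε x))‖ ≤ C := by
  obtain ⟨M, hM0, hM⟩ := hψ.exists_hasDerivAt_regularize (F := E →L[ℂ] E)
  have hs0 : 0 ≤ s := by linarith
  have hWc := hH.continuous_conjugate hA
  have hω := hH.continuous_secondDiff hA
  have hint := hH.intervalIntegrable hA
  obtain ⟨p, hp, hp1, hps⟩ : ∃ p : ℝ, 1 / 2 < p ∧ p ≤ 1 ∧ p ≤ s :=
    ⟨min s 1, lt_min hs (by norm_num), min_le_right _ _, min_le_left _ _⟩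
  have hp0 : 0 < p - 1 / 2 := by linarith
  set D := 4 * (1 + 8 * c) / a with hD
  have hD0 : 0 < D := by positivity
  set Φ : ℝ → ℝ := fun ε => M * D * diniPrimitive (secondDiff A H) ε
    + 4 * Real.sqrt D * (ε ^ (p - 1 / 2) / (p - 1 / 2)) with hΦ
  set Φ' : ℝ → ℝ := fun ε => M * D * ((ε ^ 3)⁻¹ * ∫ τ in (0 : ℝ)..ε, secondDiff A H τ)
    + 4 * Real.sqrt D * ε ^ (p - 1 / 2 - 1) with hΦ'
  have hΦd : ∀ ε, 0 < ε → ε ≤ ε₀ → HasDerivAt Φ (Φ' ε) ε := by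
    intro ε h0 h1
    refine ((hasDerivAt_diniPrimitive hω hint h0 (h1.trans hε₁)).const_mul _).add
      (HasDerivAt.const_mul _ ?_)
    exact ((Real.hasDerivAt_rpow_const (Or.inl h0.ne')).div_const _).congr_deriv
      (mul_div_cancel_left₀ _ hp0.ne')
  have hΦ0 : ∀ ε, 0 < ε → ε ≤ ε₀ → 0 ≤ Φ ε := fun ε h0 h1 => by
    have := diniPrimitive_nonneg hω secondDiff_nonneg hint h0 (h1.trans hε₁)
    positivity
  set C₀ := Real.sqrt ((2 * (a * ε₀ / 4)⁻¹ + 2 * (8 * c * ε₀)) / (a * ε₀ / 4)) with hC₀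
  refine ⟨Real.sqrt ((1 + C₀ ^ 2) * Real.exp (4 * Φ ε₀)), Real.sqrt_nonneg _, ?_⟩
  intro z hz x hx ε h0 h1
  set K := regularize ψ (conjugate A H) with hK
  set u : ℝ → E := fun ε => smoothedWeight A s ε x with hu
  set f : ℝ → ℂ := fun ε => inner ℂ (u ε) (resolvent (K ε) z (u ε)) with hf
  have hun : ∀ ε, 0 < ε → ‖u ε‖ ≤ 1 := fun ε h0 =>
    (ContinuousLinearMap.le_of_opNorm_le _ (norm_smoothedWeight_le hA hs0 h0.le) x).trans
      (by linarith)
  have hunit : ∀ ε, 0 < ε → ε ≤ ε₀ → IsUnit (algebraMap ℂ (E →L[ℂ] E) z - K ε) ∧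
      ‖resolvent (K ε) z‖ ≤ Real.sqrt ((2 * (a * ε / 4)⁻¹ + 2 * (8 * c * ε)) / (a * ε / 4)) :=
    fun ε h0 h1 => isUnit_of_quadratic_bound (by positivity) (by positivity)
      (fun w => (hz ε h0 h1 _ rfl w).1) fun w => (hz ε h0 h1 _ rfl w).2
  have hder : ∀ ε, 0 < ε → ε ≤ ε₀ → ∃ f' : ℂ, HasDerivAt f f' ε ∧
      ‖f'‖ ≤ Φ' ε * (1 + ‖f ε‖) := by
    intro ε h0 h1
    obtain ⟨hT, -⟩ := hunit ε h0 h1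
    obtain ⟨K', L, hK', hL, hKL⟩ := hM _ hWc ⟨‖H‖, norm_conjugate_le hA H⟩ ε h0
    simp only [← conjugate_regularize hA hψ hWc, conjugate_zero hA] at hL hKL
    obtain ⟨u', hu', hu'n⟩ := exists_hasDerivAt_smoothedWeight hA (by linarith) hp1 hps h0 x
    obtain ⟨v, hv, hvn⟩ := exists_hasDerivAt_expI_smoothedWeight hA (by linarith) hp1 hps h0 x
    obtain ⟨f', hf', hf'n⟩ := exists_hasDerivAt_inner_resolvent hA hK' hL hT hu' hv
    refine ⟨f', hf', hf'n.trans ?_⟩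
    set n₁ := ‖star (resolvent (K ε) z) (u ε)‖
    set n₂ := ‖resolvent (K ε) z (u ε)‖
    set X := D * ε⁻¹ * (1 + ‖f ε‖) with hX
    have habs : ∀ n, a * ε / 4 * n ^ 2 ≤ ‖f ε‖ + 8 * c * ε * ‖u ε‖ ^ 2 → n ^ 2 ≤ X := by
      intro n hn
      have h2 : ‖f ε‖ + 8 * c * ε * ‖u ε‖ ^ 2 ≤ (1 + 8 * c) * (1 + ‖f ε‖) := by
        have h3 : ε * ‖u ε‖ ^ 2 ≤ 1 :=
          mul_le_one₀ (h1.trans hε₁) (by positivity) (pow_le_one₀ (norm_nonneg _) (hun ε h0))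
        have h4 := mul_le_mul_of_nonneg_left h3 (by positivity : 0 ≤ 8 * c)
        have h5 : 0 ≤ 8 * c * ‖f ε‖ := by positivity
        linarith
      have h3 : X = (1 + 8 * c) * (1 + ‖f ε‖) / (a * ε / 4) := by
        rw [hX, hD]; field_simp
      rw [h3, le_div_iff₀ (by positivity)]
      linarith
    have hn₂ : n₂ ^ 2 ≤ X :=
      habs _ (norm_sq_inverse_apply_le hT (fun w => (hz ε h0 h1 _ rfl w).1) (u ε))
    have hn₁ : n₁ ^ 2 ≤ X := by
      refine habs _ ?_
      have h2 := norm_sq_inverse_apply_le hT.star (fun w => (hz ε h0 h1 _ rfl w).2) (u ε)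
      rw [Ring.inverse_star, ContinuousLinearMap.star_eq_adjoint,
        ContinuousLinearMap.adjoint_inner_right, norm_inner_symm] at h2
      exact h2
    have hprod : n₁ * n₂ ≤ X := by nlinarith [sq_nonneg (n₁ - n₂)]
    have hF : 1 ≤ 1 + ‖f ε‖ := by linarith [norm_nonneg (f ε)]
    have hroot : ∀ n, n ^ 2 ≤ X → n ≤ Real.sqrt D * ε ^ (-(1 / 2 : ℝ)) * (1 + ‖f ε‖) := by
      intro n hn
      refine le_of_sq_le_sq (hn.trans ?_) (by positivity)
      rw [mul_pow, mul_pow, Real.sq_sqrt hD0.le, ← Real.rpow_mul_natCast h0.le]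
      norm_num
      rw [Real.rpow_neg_one, hX]
      gcongr
      exact le_self_pow₀ hF two_ne_zero
    have hsum : ‖u'‖ + ‖v‖ ≤ 2 * ε ^ (p - 1) := by
      have h2 : ε ^ (p - 1) * ‖x‖ ≤ ε ^ (p - 1) * 1 := by gcongr
      linarith
    have hpow : ε ^ (p - 1) * ε ^ (-(1 / 2 : ℝ)) = ε ^ (p - 1 / 2 - 1) := by
      rw [← Real.rpow_add h0]; congr 1; ring
    have hI : 0 ≤ ∫ τ in (0 : ℝ)..ε, secondDiff A H τ :=
      intervalIntegral.integral_nonneg h0.le fun τ _ => secondDiff_nonneg τ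
    calc _ ≤ (M * (ε ^ 2)⁻¹ * ∫ τ in (0 : ℝ)..ε, secondDiff A H τ) * X
          + 2 * ε ^ (p - 1) * (2 * (Real.sqrt D * ε ^ (-(1 / 2 : ℝ)) * (1 + ‖f ε‖))) := by
            rw [mul_assoc ‖K' + Complex.I • L‖]
            gcongr
            · exact hKL
            · have := hroot _ hn₁
              have := hroot _ hn₂
              linarith
      _ = Φ' ε * (1 + ‖f ε‖) := by
          simp only [hΦ', hX, ← hpow]
          field_simp
          ring
  choose! f' hf' hf'n using hder
  have hend : ‖f ε₀‖ ≤ C₀ := by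
    refine (norm_inner_le_norm _ _).trans ?_
    have h2 := ContinuousLinearMap.le_of_opNorm_le _ (hunit ε₀ hε₀ le_rfl).2 (u ε₀)
    have h3 := hun ε₀ hε₀
    calc _ ≤ 1 * (C₀ * 1) := by gcongr; exact h2.trans (by gcongr)
      _ = C₀ := by ring
  have hfin := norm_sq_le_of_deriv_le hf' hΦd hΦ0 hf'n h0 h1
  refine Real.le_sqrt_of_sq_le (hfin.trans ?_)
  gcongr

theorem tendsto_resolvent {K : ℝ → E →L[ℂ] E} {l : Filter ℝ} {z : ℂ} (hK : Tendsto K l (𝓝 H))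
    (hz : z ∈ resolventSet ℂ H) :
    Tendsto (fun ε => resolvent (K ε) z) l (𝓝 (resolvent H z)) := by
  obtain ⟨U, hU⟩ := hz
  have h := NormedRing.inverse_continuousAt U
  rw [hU] at h
  exact h.tendsto.comp (hK.const_sub _)

/-- The resolvent estimate for the upper half plane. Away from the numerical range it is trivial;
close to it, it is the limit `ε → 0` of the bound for the regularizations. -/
theorem MourrePlus.exists_forall_norm_weightedResolvent_le (hA : IsSelfAdjoint A)
    (hH : ClassC11 A H) (hs : 1 / 2 < s) {Δ : Set ℝ} (hM : MourrePlus A H Δ) (hΔ : IsOpen Δ)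
    {Δ₀ : Set ℝ} (hb : Bornology.IsBounded Δ₀) (hΔ₀ : closure Δ₀ ⊆ Δ) :
    ∃ C : ℝ, ∀ z : ℂ, z.re ∈ Δ₀ → sigmaPlus H < z.im →
      z ∈ resolventSet ℂ H ∧ ‖weightedResolvent A H s z‖ ≤ C := by
  have hs0 : 0 ≤ s := by linarith
  obtain ⟨δ, hδ, hthick⟩ := hb.isCompact_closure.exists_thickening_subset_open hΔ hΔ₀
  have hnear : ∀ x ∈ Δ₀, ∀ t, |t - x| < δ → t ∈ Δ := fun x hx t ht =>
    hthick (Metric.mem_thickening_iff.2 ⟨x, subset_closure hx, by rwa [Real.dist_eq]⟩)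
  obtain ⟨ψ, hψ⟩ := exists_isOddKernel
  obtain ⟨a, c, ε₀, ha, hc, hε₀, hε₁, hquad⟩ :=
    hM.exists_forall_quadratic_bound hA hH hΔ hδ hψ
  obtain ⟨C, hC0, hC⟩ := exists_forall_norm_inner_resolvent_le hA hH hs hψ ha hc hε₀ hε₁
  have hw : ‖weight A s‖ ≤ 1 := by
    rw [weight_eq_smoothedWeight]; exact norm_smoothedWeight_le hA hs0 le_rfl
  refine ⟨max 1 (2 * C), fun z hz hy => ?_⟩
  obtain ⟨hres, hresn⟩ := mem_resolventSet_of_sigmaPlus_lt hy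
  refine ⟨hres, ?_⟩
  rcases le_total z.im (sigmaPlus H + 1) with h1 | h1
  · refine le_max_of_le_right ?_
    have hunit : ∀ x : E, ‖x‖ ≤ 1 → ‖inner ℂ x (weightedResolvent A H s z x)‖ ≤ C := by
      intro x hx
      have hK : Tendsto (regularize ψ (conjugate A H)) (𝓝[>] 0) (𝓝 H) := by
        have := hψ.tendsto_regularize (hH.continuous_conjugate hA) (norm_conjugate_le hA H)
        rw [conjugate_zero hA] at this
        exact this.mono_left nhdsWithin_le_nhds
      have hu := tendsto_smoothedWeight hA hs0 x
      have hG : Tendsto (fun ε => resolvent (regularize ψ (conjugate A H) ε) z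
          (smoothedWeight A s ε x)) (𝓝[>] 0) (𝓝 (resolvent H z (weight A s x))) :=
        ((isBoundedBilinearMap_apply (𝕜 := ℂ) (E := E) (F := E)).continuous.tendsto
          (resolvent H z, weight A s x)).comp ((tendsto_resolvent hK hres).prodMk_nhds hu)
      have hlim := (hu.inner hG (𝕜 := ℂ)).norm
      have e : inner ℂ x (weightedResolvent A H s z x)
          = inner ℂ (weight A s x) (resolvent H z (weight A s x)) := by
        conv_rhs => rw [← star_weight (A := A) hs0]
        rw [ContinuousLinearMap.star_eq_adjoint, ContinuousLinearMap.adjoint_inner_left,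
          ← ContinuousLinearMap.star_eq_adjoint, star_weight hs0]
        rfl
      rw [e]
      refine le_of_tendsto hlim ?_
      filter_upwards [Ioc_mem_nhdsGT hε₀] with ε hε
      exact hC z (fun ε h0 h1' => hquad z (hnear _ hz) hy.le h1 ε h0 h1') x hx ε hε.1 hε.2
    refine norm_le_of_forall_norm_inner_le hC0 fun x => ?_
    rcases eq_or_ne x 0 with rfl | hx
    · simp
    have hx0 : 0 < ‖x‖ := norm_pos_iff.2 hx
    have h2 := hunit (((‖x‖⁻¹ : ℝ) : ℂ) • x) (by
      rw [norm_smul, Complex.norm_real, Real.norm_of_nonneg (by positivity),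
        inv_mul_cancel₀ hx0.ne'])
    rw [map_smul, inner_smul_left, inner_smul_right, Complex.conj_ofReal, norm_mul, norm_mul,
      Complex.norm_real, Real.norm_of_nonneg (by positivity), ← mul_assoc, ← mul_inv, ← sq,
      inv_mul_le_iff₀ (by positivity)] at h2
    linarith
  · refine le_max_of_le_left ?_
    have h2 : ‖resolvent H z‖ ≤ 1 := hresn.trans (inv_le_one_of_one_le₀ (by linarith))
    calc _ ≤ ‖weight A s‖ * ‖resolvent H z‖ * ‖weight A s‖ := norm_mul₃_le
      _ ≤ 1 * 1 * 1 := by gcongr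
      _ = 1 := by norm_num

/-! ### The lower half plane -/

theorem realPart_star (H : E →L[ℂ] E) : (ℜ (star H) : E →L[ℂ] E) = (ℜ H : E →L[ℂ] E) := by
  rw [realPart_apply_coe, realPart_apply_coe, star_star, add_comm]

theorem imaginaryPart_star (H : E →L[ℂ] E) :
    (ℑ (star H) : E →L[ℂ] E) = -(ℑ H : E →L[ℂ] E) := by
  rw [imaginaryPart_apply_coe, imaginaryPart_apply_coe, star_star, ← smul_neg, ← smul_neg, neg_sub]

theorem sigmaPlus_star (H : E →L[ℂ] E) : sigmaPlus (star H) = -sigmaMinus H := by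
  rw [sigmaPlus, sigmaMinus, imaginaryPart_star, ← spectrum.neg_eq, Real.sInf_def, neg_neg]

theorem MourreMinus.mourrePlus_star {Δ : Set ℝ} (hM : MourreMinus A H Δ) :
    MourrePlus A (star H) Δ := by
  obtain ⟨h1, a, b, β, ha, hb, hβ, h⟩ := hM
  refine ⟨by rwa [realPart_star], a, b, β, ha, hb, hβ, ?_⟩
  rw [realPart_star, sigmaPlus_star, imaginaryPart_star, Complex.ofReal_neg, neg_smul,
    sub_neg_eq_add, neg_add_eq_sub]
  exact h

theorem mem_resolventSet_star {z : ℂ} :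
    (starRingEnd ℂ) z ∈ resolventSet ℂ (star H) ↔ z ∈ resolventSet ℂ H := by
  rw [spectrum.mem_resolventSet_iff, spectrum.mem_resolventSet_iff, starRingEnd_apply,
    algebraMap_star_comm, ← star_sub, isUnit_star]

theorem star_weightedResolvent (hs : 0 ≤ s) (z : ℂ) :
    star (weightedResolvent A H s z) = weightedResolvent A (star H) s ((starRingEnd ℂ) z) := by
  rw [weightedResolvent, weightedResolvent, star_mul, star_mul, star_weight hs, resolvent,
    resolvent, ← Ring.inverse_star, star_sub, ← algebraMap_star_comm, starRingEnd_apply, mul_assoc]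

/-- The lower half plane is the upper half plane for the adjoint. -/
theorem MourreMinus.exists_forall_norm_weightedResolvent_le (hA : IsSelfAdjoint A)
    (hH : ClassC11 A H) (hs : 1 / 2 < s) {Δ : Set ℝ} (hM : MourreMinus A H Δ) (hΔ : IsOpen Δ)
    {Δ₀ : Set ℝ} (hb : Bornology.IsBounded Δ₀) (hΔ₀ : closure Δ₀ ⊆ Δ) :
    ∃ C : ℝ, ∀ z : ℂ, z.re ∈ Δ₀ → z.im < sigmaMinus H →
      z ∈ resolventSet ℂ H ∧ ‖weightedResolvent A H s z‖ ≤ C := by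
  obtain ⟨C, hC⟩ := hM.mourrePlus_star.exists_forall_norm_weightedResolvent_le hA
    (classC11_star hH) hs hΔ hb hΔ₀
  refine ⟨C, fun z hz hy => ?_⟩
  obtain ⟨h1, h2⟩ := hC ((starRingEnd ℂ) z) (by rwa [Complex.conj_re])
    (by rw [sigmaPlus_star, Complex.conj_im]; linarith)
  rw [← star_weightedResolvent (by linarith), norm_star] at h2
  exact ⟨mem_resolventSet_star.1 h1, h2⟩

end LimitingAbsorption

end NSAMourre

end

theorem mainTheorem5 {E : Type*} [NormedAddCommGroup E] [InnerProductSpace ℂ E] [CompleteSpace E]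
    (A : E →ₗ.[ℂ] E) (hA : IsSelfAdjoint A)
    (H : E →L[ℂ] E) (hH : NSAMourre.ClassC11 A H)
    (Δ : Set ℝ) (hΔ_open : IsOpen Δ) (hΔ_int : Δ.OrdConnected)
    (s : ℝ) (hs : 1 / 2 < s) :
    (NSAMourre.MourrePlus A H Δ →
      ∀ Δ₀ : Set ℝ, Δ₀.OrdConnected → Bornology.IsBounded Δ₀ → closure Δ₀ ⊆ Δ →
        ∃ C : ℝ, ∀ z : ℂ, z.re ∈ Δ₀ → NSAMourre.sigmaPlus H < z.im →
          z ∈ resolventSet ℂ H ∧ ‖NSAMourre.weightedResolvent A H s z‖ ≤ C) ∧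
    (NSAMourre.MourreMinus A H Δ →
      ∀ Δ₀ : Set ℝ, Δ₀.OrdConnected → Bornology.IsBounded Δ₀ → closure Δ₀ ⊆ Δ →
        ∃ C : ℝ, ∀ z : ℂ, z.re ∈ Δ₀ → z.im < NSAMourre.sigmaMinus H →
          z ∈ resolventSet ℂ H ∧ ‖NSAMourre.weightedResolvent A H s z‖ ≤ C) := by
  refine ⟨fun hM Δ₀ _ hb hΔ₀ => ?_, fun hM Δ₀ _ hb hΔ₀ => ?_⟩
  · exact hM.exists_forall_norm_weightedResolvent_le hA hH hs hΔ_open hb hΔ₀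
  · exact hM.exists_forall_norm_weightedResolvent_le hA hH hs hΔ_open hb hΔ₀
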